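/- A rooted planar triangulation here is a locally finite connected planar map (loops and multiple edges allowed) with a distinguished root vertex and a marked edge emerging from it, considered up to orientation preserving isomorphism; let $S_k$ be the set of vertices at graph distance $k$ from the root. It is an infinite causal triangulation if all faces are triangles, there is no loop at the root and, for every $k\ge 1$, the vertices of $S_k$ together with the edges joining two of them form a cycle (a single vertex with a loop and two vertices joined by two edges being allowed as cycles). It is a finite causal triangulation of height $K\ge 2$ if all vertices are at distance at most $K$ from the root, there is no loop at the root, $S_k$ spans a cycle for $1\le k<K$, all faces except one exterior face are triangles, and the vertices of $S_K$ arise by attaching to each edge of the cycle $S_{K-1}$ one triangle whose third vertex has degree $2$ and lies on the exterior face, the boundary of which alternates between $S_{K}$ and $S_{K-1}$. Let $\mathcal C$ be the set of all finite and infinite causal triangulations, and let $B_R(G)$ be the rooted planar graph spanned by the vertices of $G$ at distance at most $R$ from the root, with $|B_R(G)|$ its number of edges. Equip $\mathcal C$ with the metric $d(G,G')=\inf\{\tfrac1{R+1}: B_R(G)=B_R(G')\}$ and, for $N\ge 1$, let $\rho_N$ be the uniform distribution on the set of finite causal triangulations with exactly $2N$ triangles. Theorem. The weak limit $\rho=\lim_{N\to\infty}\rho_N$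 exists as a Borel probability measure on $\mathcal C$ (the uniform infinite causal triangulation), and $\rho$-almost every $G$ is an infinite causal triangulation of Hausdorff dimension $2$, that is, $$\lim_{R\to\infty}\frac{\log|B_R(G)|}{\log R}=2 .$$ -/

import Mathlib

/-- A rooted map: a graph (loops and multiple edges allowed) drawn on an oriented surface, with one
marked oriented edge. It is given by its oriented edges (darts): `rot` turns a dart into the
next one around its initial vertex, `flip` reverses a dart, and `root` is the marked edge, oriented
away from the root vertex. -/
structure RootedMap where
  Dart : Type
  rot : Equiv.Perm Dart
  flip : Equiv.Perm Dart
  flip_flip : ∀ d, flip (flip d) = d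
  flip_ne : ∀ d, flip d ≠ d
  root : Dart

namespace RootedMap

/-- The permutation that follows a dart by the next dart along the boundary of a face. -/
def facePerm (G : RootedMap) : Equiv.Perm G.Dart := G.rot * G.flip

/-- Vertices, edges and faces are the cycles of `rot`, `flip` and `facePerm`. -/
def Vertex (G : RootedMap) : Type := Quotient (Equiv.Perm.SameCycle.setoid G.rot)

def Edge (G : RootedMap) : Type := Quotient (Equiv.Perm.SameCycle.setoid G.flip)

def Face (G : RootedMap) : Type := Quotient (Equiv.Perm.SameCycle.setoid G.facePerm)

/-- The initial vertex of a dart. -/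
def vert (G : RootedMap) (d : G.Dart) : G.Vertex := Quotient.mk _ d

/-- The edge underlying a dart. -/
def edge (G : RootedMap) (d : G.Dart) : G.Edge := Quotient.mk _ d

/-- The face whose boundary walk contains a dart. -/
def face (G : RootedMap) (d : G.Dart) : G.Face := Quotient.mk _ d

/-- The number of sides of the face at `d` (`0` for a face with infinitely many sides). -/
noncomputable def faceDegree (G : RootedMap) (d : G.Dart) : ℕ :=
  Function.minimalPeriod G.facePerm d

/-- The simple graph underlying the map; it has the same graph distance as the map. -/
def graph (G : RootedMap) : SimpleGraph G.Vertex where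
  Adj u v := u ≠ v ∧ ∃ d, G.vert d = u ∧ G.vert (G.flip d) = v
  symm := ⟨fun u v h => by
    obtain ⟨hne, d, hu, hv⟩ := h
    exact ⟨hne.symm, G.flip d, hv, by rw [G.flip_flip, hu]⟩⟩
  loopless := ⟨fun u h => h.1 rfl⟩

/-- The height of a vertex: its graph distance from the root vertex. -/
noncomputable def height (G : RootedMap) (v : G.Vertex) : ℕ := G.graph.dist (G.vert G.root) v

/-- The height of the initial vertex of a dart. -/
noncomputable def ht (G : RootedMap) (d : G.Dart) : ℕ := G.height (G.vert d)

/-- Every vertex has finite degree. -/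
def LocallyFinite (G : RootedMap) : Prop := ∀ v : G.Vertex, {d | G.vert d = v}.Finite

/-- Planarity of a connected map all of whose faces have finitely many sides. Glue a disk into every
face: the resulting connected oriented surface is the sphere (finite maps) or the plane (infinite
maps) exactly when its first cohomology vanishes, i.e. when every integral 1-cochain `θ` whose sum
around each face is zero is the coboundary of a function on the vertices. -/
def Planar (G : RootedMap) : Prop :=
  ∀ θ : G.Dart → ℤ, (∀ d, θ (G.flip d) = - θ d) →
    (∀ d, ∑ i ∈ Finset.range (G.faceDegree d), θ ((G.facePerm ^ i) d) = 0) →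
    ∃ p : G.Vertex → ℤ, ∀ d, θ d = p (G.vert (G.flip d)) - p (G.vert d)

/-- The vertices at height `k`, with the edges joining two of them, form a cycle: there are `n ≥ 1`
such vertices `v i` and `n` such edges, the edge `e i` joining `v i` to `v (i + 1)`, indices
being taken modulo `n`. For `n = 1` this is a loop, for `n = 2` a pair of parallel edges. -/
def CycleAt (G : RootedMap) (k : ℕ) : Prop :=
  ∃ n : ℕ, 1 ≤ n ∧ ∃ e : ZMod n → G.Dart,
    Set.BijOn (fun i => G.vert (e i)) Set.univ {v | G.height v = k} ∧
    (∀ i, G.vert (G.flip (e i)) = G.vert (e (i + 1))) ∧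
    Set.BijOn (fun i => G.edge (e i)) Set.univ
      {x | ∃ d, G.edge d = x ∧ G.ht d = k ∧ G.ht (G.flip d) = k}

/-- There is no loop at the root vertex. -/
def NoRootLoop (G : RootedMap) : Prop := ∀ d, G.ht d = 0 → G.ht (G.flip d) ≠ 0

/-- Infinite causal triangulations: all faces are triangles and the vertices at each height `k ≥ 1`
form a cycle. -/
def IsInfiniteCT (G : RootedMap) : Prop :=
  G.graph.Connected ∧ G.LocallyFinite ∧ G.Planar ∧ G.NoRootLoop ∧
  (∀ d, G.faceDegree d = 3) ∧ ∀ k, 1 ≤ k → G.CycleAt k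

/-- Finite causal triangulations of height `K ≥ 2`: the vertices at each height `1 ≤ k < K` form a
cycle, and the cycle at height `K - 1` is decorated by a triangle on each of its edges. -/
def IsFiniteCT (G : RootedMap) (K : ℕ) : Prop :=
  2 ≤ K ∧
  G.graph.Connected ∧ G.LocallyFinite ∧ G.Planar ∧ G.NoRootLoop ∧
  (∀ d, G.ht d ≤ K) ∧ (∀ k, 1 ≤ k → k < K → G.CycleAt k) ∧
  -- the exterior face; its boundary alternates between the heights `K` and `K - 1`
  ∃ ext : G.Face,
    (∀ d, G.face d ≠ ext → G.faceDegree d = 3) ∧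
    (∀ d, G.face d = ext →
      (G.ht d = K ∧ G.ht (G.flip d) = K - 1) ∨ (G.ht d = K - 1 ∧ G.ht (G.flip d) = K)) ∧
    -- a vertex at height `K` has degree 2, is joined to height `K - 1` only, and lies on the exterior
    -- face and on one triangle
    (∀ d, G.ht d = K → G.rot d ≠ d ∧ G.rot (G.rot d) = d ∧ G.ht (G.flip d) = K - 1 ∧
      (G.face d = ext ↔ G.face (G.rot d) ≠ ext)) ∧
    -- each edge of the cycle at height `K - 1` has on exactly one of its sides a triangle whose third
    -- vertex is at height `K`
    (∀ d, G.ht d = K - 1 → G.ht (G.flip d) = K - 1 →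
      ∃! e, (e = d ∨ e = G.flip d) ∧ G.ht (G.flip (G.facePerm e)) = K)

/-- Causal triangulations with a marked edge at the root. -/
def IsCT (G : RootedMap) : Prop := G.IsInfiniteCT ∨ ∃ K, G.IsFiniteCT K

/-- Orientation preserving isomorphism of rooted maps. -/
def Iso (G H : RootedMap) : Prop :=
  ∃ f : G.Dart ≃ H.Dart, f G.root = H.root ∧
    (∀ d, f (G.rot d) = H.rot (f d)) ∧ ∀ d, f (G.flip d) = H.flip (f d)

/-- The area: the number of triangles. -/
noncomputable def area (G : RootedMap) : ℕ :=
  {x : G.Face | ∃ d, G.face d = x ∧ G.faceDegree d = 3}.ncard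

/-- The darts of the ball of radius `R`, the subgraph spanned by the vertices at distance at most
`R` from the root vertex. -/
def ballDarts (G : RootedMap) (R : ℕ) : Set G.Dart := {d | G.ht d ≤ R ∧ G.ht (G.flip d) ≤ R}

/-- The number of edges of the ball of radius `R`. -/
noncomputable def ballSize (G : RootedMap) (R : ℕ) : ℕ := (G.edge '' G.ballDarts R).ncard

/-- Turning once around the initial vertex of `a`, starting at `a`, one meets `b` no later than
`c`. In particular `a`, `b`, `c` start at the same vertex. -/
def InOrder (G : RootedMap) (a b c : G.Dart) : Prop :=
  ∃ m n : ℕ, m ≤ n ∧ n < Function.minimalPeriod G.rot a ∧ (G.rot ^ m) a = b ∧ (G.rot ^ n) a = c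

/-- The balls of radius `R` in `G` and `H` coincide as rooted planar graphs: there is a bijection of
their darts respecting reversal, the cyclic order around each vertex, the marked
edge and the distance to the root. (A ball of radius 0 is a single vertex.) -/
def SameBall (R : ℕ) (G H : RootedMap) : Prop :=
  ∃ f : G.ballDarts R ≃ H.ballDarts R,
    (∀ a b : G.ballDarts R, G.flip a = b ↔ H.flip (f a) = f b) ∧
    (∀ a b c : G.ballDarts R, G.InOrder a b c ↔ H.InOrder (f a) (f b) (f c)) ∧
    (∀ a : G.ballDarts R, (a : G.Dart) = G.root ↔ (f a : H.Dart) = H.root) ∧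
    ∀ a : G.ballDarts R, G.ht a = H.ht (f a)

/-- `G` has Hausdorff dimension `δ`, i.e. `log |B_R(G)| / log R → δ` as `R → ∞`, where
`|B_R(G)|` is the number of edges of the ball of radius `R` about the root. -/
def HasHausdorffDim (G : RootedMap) (δ : ℝ) : Prop :=
  Filter.Tendsto (fun R : ℕ => Real.log (G.ballSize R) / Real.log R) Filter.atTop (nhds δ)

theorem SameBall.refl (R : ℕ) (G : RootedMap) : SameBall R G G :=
  ⟨Equiv.refl _, fun _ _ => Iff.rfl, fun _ _ _ => Iff.rfl, fun _ => Iff.rfl, fun _ => rfl⟩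

theorem SameBall.symm {R : ℕ} {G H : RootedMap} (h : SameBall R G H) : SameBall R H G := by
  obtain ⟨f, h1, h2, h3, h4⟩ := h
  refine ⟨f.symm, fun a b => ?_, fun a b c => ?_, fun a => ?_, fun a => ?_⟩
  · simpa using (h1 (f.symm a) (f.symm b)).symm
  · simpa using (h2 (f.symm a) (f.symm b) (f.symm c)).symm
  · simpa using (h3 (f.symm a)).symm
  · simpa using (h4 (f.symm a)).symm

theorem SameBall.trans {R : ℕ} {G H J : RootedMap} (h : SameBall R G H) (h' : SameBall R H J) :
    SameBall R G J := by
  obtain ⟨f, h1, h2, h3, h4⟩ := h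
  obtain ⟨g, k1, k2, k3, k4⟩ := h'
  exact ⟨f.trans g, fun a b => (h1 a b).trans (k1 _ _), fun a b c => (h2 a b c).trans (k2 _ _ _),
    fun a => (h3 a).trans (k3 _), fun a => (h4 a).trans (k4 _)⟩

theorem SameBall.mono {R S : ℕ} (hRS : R ≤ S) {G H : RootedMap} (h : SameBall S G H) :
    SameBall R G H := by
  obtain ⟨f, h1, h2, h3, h4⟩ := h
  have sub : ∀ J : RootedMap, J.ballDarts R ⊆ J.ballDarts S :=
    fun J d hd => ⟨hd.1.trans hRS, hd.2.trans hRS⟩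
  have hfl : ∀ (J : RootedMap) (a : J.ballDarts S), J.flip a ∈ J.ballDarts S :=
    fun J a => ⟨a.2.2, by rw [J.flip_flip]; exact a.2.1⟩
  have key : ∀ a : G.ballDarts S, (a : G.Dart) ∈ G.ballDarts R ↔ (f a : H.Dart) ∈ H.ballDarts R := by
    intro a
    have e1 := h4 a
    have e2 := h4 ⟨G.flip a, hfl G a⟩
    have e3 := (h1 a ⟨G.flip a, hfl G a⟩).1 rfl
    rw [← e3] at e2
    change (G.ht a ≤ R ∧ G.ht (G.flip a) ≤ R) ↔ (H.ht (f a) ≤ R ∧ H.ht (H.flip (f a)) ≤ R)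
    exact and_congr (iff_of_eq (congrArg (· ≤ R) e1)) (iff_of_eq (congrArg (· ≤ R) e2))
  let g : G.ballDarts R ≃ H.ballDarts R :=
    { toFun := fun a => ⟨f ⟨a, sub G a.2⟩, (key _).1 a.2⟩
      invFun := fun b => ⟨f.symm ⟨b, sub H b.2⟩, (key _).2 (by simp)⟩
      left_inv := fun a => by simp
      right_inv := fun b => by simp }
  exact ⟨g, fun a b => h1 ⟨a, sub G a.2⟩ ⟨b, sub G b.2⟩,
    fun a b c => h2 ⟨a, sub G a.2⟩ ⟨b, sub G b.2⟩ ⟨c, sub G c.2⟩,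
    fun a => h3 ⟨a, sub G a.2⟩, fun a => h4 ⟨a, sub G a.2⟩⟩

/-- Causal triangulations are considered up to isomorphism. -/
def ctSetoid : Setoid {G : RootedMap // G.IsCT} where
  r G H := Iso G.1 H.1
  iseqv :=
    { refl := fun G => ⟨Equiv.refl _, rfl, fun _ => rfl, fun _ => rfl⟩
      symm := by
        rintro G H ⟨f, h1, h2, h3⟩
        refine ⟨f.symm, by rw [← h1]; simp, fun d => ?_, fun d => ?_⟩
        · apply f.injective; simp [h2]
        · apply f.injective; simp [h3]
      trans := by
        rintro G H J ⟨f, h1, h2, h3⟩ ⟨g, k1, k2, k3⟩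
        exact ⟨f.trans g, by simp [h1, k1], fun d => by simp [h2, k2], fun d => by simp [h3, k3]⟩ }

end RootedMap

/-- The set of causal triangulations (isomorphism classes). -/
def CausalTriangulation : Type 1 := Quotient RootedMap.ctSetoid

namespace CausalTriangulation

/-- A rooted map in the isomorphism class. All the notions below are isomorphism invariant, so it
does not matter which. -/
noncomputable def toMap (c : CausalTriangulation) : RootedMap :=
  (Quotient.out (s := RootedMap.ctSetoid) c).1

/-- The distance `inf {1 / (R + 1) : B_R(G) = B_R(G')}`. -/
noncomputable instance : PseudoMetricSpace CausalTriangulation where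
  dist c c' := sInf {x : ℝ | ∃ R : ℕ, RootedMap.SameBall R c.toMap c'.toMap ∧ x = 1 / ((R : ℝ) + 1)}
  dist_self c := by
    have hnn : ∀ x ∈ {x : ℝ | ∃ R : ℕ, RootedMap.SameBall R c.toMap c.toMap ∧
        x = 1 / ((R : ℝ) + 1)}, 0 ≤ x := by
      rintro x ⟨R, -, rfl⟩
      positivity
    apply le_antisymm
    · apply le_of_forall_pos_le_add
      intro ε hε
      obtain ⟨n, hn⟩ := exists_nat_one_div_lt hε
      have := csInf_le ⟨0, hnn⟩ ⟨n, RootedMap.SameBall.refl n c.toMap, rfl⟩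
      linarith
    · exact Real.sInf_nonneg hnn
  dist_comm c c' := by
    congr 1
    ext x
    exact ⟨fun ⟨R, h, e⟩ => ⟨R, h.symm, e⟩, fun ⟨R, h, e⟩ => ⟨R, h.symm, e⟩⟩
  dist_triangle a b c := by
    have hne : ∀ a b : CausalTriangulation, {x : ℝ | ∃ R : ℕ,
        RootedMap.SameBall R a.toMap b.toMap ∧ x = 1 / ((R : ℝ) + 1)}.Nonempty := by
      intro a b
      have hloop : ∀ c : CausalTriangulation, IsEmpty (c.toMap.ballDarts 0) := by
        intro c
        have hc : c.toMap.NoRootLoop := by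
          rcases (Quotient.out (s := RootedMap.ctSetoid) c).2 with h | ⟨K, h⟩
          · exact h.2.2.2.1
          · exact h.2.2.2.2.1
        exact ⟨fun d => hc d (Nat.le_zero.1 d.2.1) (Nat.le_zero.1 d.2.2)⟩
      have ha := hloop a
      have hb := hloop b
      exact ⟨_, 0, ⟨Equiv.equivOfIsEmpty _ _, fun x => isEmptyElim x, fun x => isEmptyElim x,
        fun x => isEmptyElim x, fun x => isEmptyElim x⟩, rfl⟩
    have hbd : ∀ a b : CausalTriangulation, BddBelow {x : ℝ | ∃ R : ℕ,
        RootedMap.SameBall R a.toMap b.toMap ∧ x = 1 / ((R : ℝ) + 1)} := by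
      intro a b
      refine ⟨0, ?_⟩
      rintro x ⟨R, -, rfl⟩
      positivity
    apply le_of_forall_pos_le_add
    intro ε hε
    obtain ⟨x, ⟨R, hR, rfl⟩, hx⟩ := exists_lt_of_csInf_lt (hne a b)
      (lt_add_of_pos_right _ (half_pos hε))
    obtain ⟨y, ⟨S, hS, rfl⟩, hy⟩ := exists_lt_of_csInf_lt (hne b c)
      (lt_add_of_pos_right _ (half_pos hε))
    have pR : (0 : ℝ) < 1 / ((R : ℝ) + 1) := by positivity
    have pS : (0 : ℝ) < 1 / ((S : ℝ) + 1) := by positivity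
    rcases le_total R S with h | h
    · have := csInf_le (hbd a c) ⟨R, hR.trans (hS.mono h), rfl⟩
      linarith
    · have := csInf_le (hbd a c) ⟨S, (hR.mono h).trans hS, rfl⟩
      linarith

noncomputable instance : MeasurableSpace CausalTriangulation := borel _

instance : BorelSpace CausalTriangulation := ⟨rfl⟩

/-- The set of finite causal triangulations of area `2 * N`. -/
def ofArea (N : ℕ) : Set CausalTriangulation :=
  {c | (∃ K, c.toMap.IsFiniteCT K) ∧ c.toMap.area = 2 * N}

/-- The uniform distribution on the causal triangulations of area `2 * N` (zero if `N = 0`). -/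
noncomputable def uniformOfArea (N : ℕ) : MeasureTheory.FiniteMeasure CausalTriangulation :=
  ⟨ProbabilityTheory.uniformOn (ofArea N), inferInstance⟩

/-- `ρ` is the law of the uniform infinite causal triangulation: the weak limit of the uniform
distributions on the causal triangulations of area `2 * N` as `N → ∞`. -/
def IsUniformInfiniteCT (ρ : MeasureTheory.ProbabilityMeasure CausalTriangulation) : Prop :=
  Filter.Tendsto uniformOfArea Filter.atTop (nhds ρ.toFiniteMeasure)

end CausalTriangulation

/-! A causal triangulation is a plane tree in disguise. At every vertex of height `k + 1` keep the
downward edge that follows the horizontal edge `right` in the rotation; these edges form a plane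
tree whose levels are the cycles. Conversely the tree determines the triangulation: each vertex of
positive height sends one further edge up, to the first child of the next vertex that has one, and
consecutive vertices of a level are joined. Every triangle has exactly one horizontal side and every
horizontal edge borders two triangles, so area `2 * N` means `N` vertices besides the root.
`LayerCode.toRootedMap` builds the triangulation, `RootedMap.IsFiniteCT.exists_layerCode` reads the
tree off a finite triangulation, `LayerCode.eq_of_iso` shows that nothing is lost, and
`CausalTriangulation.ofArea_eq` puts these together.

The trees of size `N` whose lowest levels form a given trunk of size `s` and top width `m` are
counted by the ballot number `forestCount (N - s) m`. Relative to `forestCount N 1` this tends to `m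
* 2 ^ m / 2 / 4 ^ s`. These limits multiply from level to level (`trunkWeight_concat`): they are the
probabilities of trunks in the critical geometric branching process conditioned to survive, a Markov
chain realised by `treeLaw`. Balls depend on the lowest levels only (`LayerCode.Agree.sameBall`), so
an open set is reached through events about finite trunks, and the liminf criterion for open sets
gives weak convergence to the image `limitLaw` of `treeLaw`. As that image is a probability measure
from the start, no tightness argument is needed.

For the dimension, the number of edges of a ball lies between `V` and `4 * V`, where `V` is the sum
of the widths of the levels `1, ..., R`. The width of level `k` has mean `2 * k + 1` and its inverse
has mean `1 / (k + 1)`. Hence almost surely, for every `ε > 0`, the widths sum to at most a constant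
times `R ^ (2 + ε)` and their inverses to at most a constant times `R ^ ε`. The second bound and the
Cauchy–Schwarz inequality `R ^ 2 ≤ (∑ w) * ∑ w⁻¹` give `V` at least of order `R ^ (2 - ε)`. -/

/-! ### Levels of a plane tree -/

/-- The number of vertices at each level of the plane tree in which the `i`-th vertex of level `k`
has `c k i` children. -/
def levelSize (c : ℕ → ℕ → ℕ) : ℕ → ℕ
  | 0 => 1
  | k + 1 => ∑ i ∈ Finset.range (levelSize c k), c k i

/-- The number of children of the first `i` vertices of a level. -/
def childSum (f : ℕ → ℕ) (i : ℕ) : ℕ := ∑ x ∈ Finset.range i, f x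

/-- The parent of the `j`-th vertex of the level following a level of `n` vertices. -/
def parentIdx (f : ℕ → ℕ) (n j : ℕ) : ℕ := Nat.findGreatest (fun i => childSum f i ≤ j) (n - 1)

/-- The rank among its siblings of the `j`-th vertex of a level. -/
def siblingIdx (f : ℕ → ℕ) (n j : ℕ) : ℕ := j - childSum f (parentIdx f n j)

def cycSucc (n i : ℕ) : ℕ := if i + 1 < n then i + 1 else 0

def cycPred (n i : ℕ) : ℕ := if i = 0 then n - 1 else i - 1

theorem cycSucc_lt {n i : ℕ} (h : i < n) : cycSucc n i < n := by
  unfold cycSucc; split_ifs <;> omega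

theorem cycPred_lt {n i : ℕ} (h : i < n) : cycPred n i < n := by
  unfold cycPred; split_ifs <;> omega

theorem cycSucc_cycPred {n i : ℕ} (h : i < n) : cycSucc n (cycPred n i) = i := by
  unfold cycSucc cycPred; split_ifs <;> omega

theorem cycPred_cycSucc {n i : ℕ} (h : i < n) : cycPred n (cycSucc n i) = i := by
  by_cases h' : i + 1 < n
  · simp [cycSucc, cycPred, h']
  · simp only [cycSucc, cycPred, h', if_false, if_true]; omega

theorem childSum_zero (f : ℕ → ℕ) : childSum f 0 = 0 := rfl

theorem childSum_succ (f : ℕ → ℕ) (i : ℕ) : childSum f (i + 1) = childSum f i + f i :=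
  Finset.sum_range_succ _ _

theorem childSum_mono (f : ℕ → ℕ) : Monotone (childSum f) :=
  monotone_nat_of_le_succ fun i => by rw [childSum_succ]; omega

theorem levelSize_succ (c : ℕ → ℕ → ℕ) (k : ℕ) :
    levelSize c (k + 1) = childSum (c k) (levelSize c k) := rfl

theorem levelSize_one (c : ℕ → ℕ → ℕ) : levelSize c 1 = c 0 0 := by
  simp [levelSize]

theorem childSum_add_lt {f : ℕ → ℕ} {n i a : ℕ} (hi : i < n) (ha : a < f i) :
    childSum f i + a < childSum f n := by
  have := childSum_mono f (Nat.succ_le_of_lt hi)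
  rw [Nat.succ_eq_add_one, childSum_succ] at this
  omega

theorem childSum_congr {f g : ℕ → ℕ} {n i : ℕ} (h : ∀ x < n, f x = g x) (hi : i ≤ n) :
    childSum f i = childSum g i :=
  Finset.sum_congr rfl fun x hx => h x (by rw [Finset.mem_range] at hx; omega)

theorem exists_pos_of_childSum_pos {f : ℕ → ℕ} {n : ℕ} (h : 0 < childSum f n) :
    ∃ i < n, 0 < f i := by
  by_contra! hc
  have : childSum f n = 0 := Finset.sum_eq_zero fun i hi => by
    have := hc i (Finset.mem_range.1 hi); omega
  omega

theorem childSum_parentIdx_le (f : ℕ → ℕ) (n j : ℕ) : childSum f (parentIdx f n j) ≤ j :=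
  Nat.findGreatest_spec (P := fun i => childSum f i ≤ j) (Nat.zero_le _) (Nat.zero_le j)

theorem childSum_add_siblingIdx (f : ℕ → ℕ) (n j : ℕ) :
    childSum f (parentIdx f n j) + siblingIdx f n j = j := by
  have := childSum_parentIdx_le f n j
  unfold siblingIdx; omega

theorem pos_of_lt_childSum {f : ℕ → ℕ} {n j : ℕ} (hj : j < childSum f n) : 0 < n := by
  rcases Nat.eq_zero_or_pos n with rfl | h
  · simp [childSum_zero] at hj
  · exact h

theorem parentIdx_lt {f : ℕ → ℕ} {n j : ℕ} (hj : j < childSum f n) : parentIdx f n j < n := by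
  have h1 : parentIdx f n j ≤ n - 1 := Nat.findGreatest_le _
  have := pos_of_lt_childSum hj
  omega

/-- The parent is the greatest `i` with `childSum f i ≤ j`, so childless vertices are skipped and
`j` lies before `childSum f (i + 1)`. -/
theorem siblingIdx_lt {f : ℕ → ℕ} {n j : ℕ} (hj : j < childSum f n) :
    siblingIdx f n j < f (parentIdx f n j) := by
  have h1 := parentIdx_lt hj
  have h2 := childSum_succ f (parentIdx f n j)
  have h3 := childSum_add_siblingIdx f n j
  have h4 : j < childSum f (parentIdx f n j + 1) := by
    by_cases h : parentIdx f n j + 1 ≤ n - 1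
    · exact not_le.1 (Nat.findGreatest_is_greatest (P := fun i => childSum f i ≤ j)
        (n := n - 1) (lt_add_one (parentIdx f n j)) h)
    · have : parentIdx f n j + 1 = n := by omega
      rwa [this]
  omega

/-- The children of distinct vertices occupy disjoint intervals. Hence parent and rank are
coordinates on the next level. -/
theorem childSum_add_inj {f : ℕ → ℕ} {i a i' a' : ℕ} (ha : a < f i) (ha' : a' < f i')
    (h : childSum f i + a = childSum f i' + a') : i = i' ∧ a = a' := by
  rcases lt_trichotomy i i' with hi | rfl | hi
  · have := childSum_add_lt hi ha; omega
  · omega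
  · have := childSum_add_lt hi ha'; omega

theorem parentIdx_childSum_add {f : ℕ → ℕ} {n i a : ℕ} (hi : i < n) (ha : a < f i) :
    parentIdx f n (childSum f i + a) = i :=
  (childSum_add_inj (siblingIdx_lt (childSum_add_lt hi ha)) ha
    (childSum_add_siblingIdx f n _)).1

theorem siblingIdx_childSum_add {f : ℕ → ℕ} {n i a : ℕ} (hi : i < n) (ha : a < f i) :
    siblingIdx f n (childSum f i + a) = a :=
  (childSum_add_inj (siblingIdx_lt (childSum_add_lt hi ha)) ha
    (childSum_add_siblingIdx f n _)).2

theorem parentIdx_congr {f g : ℕ → ℕ} {n j : ℕ} (h : ∀ x < n, f x = g x) (hj : j < childSum f n) :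
    parentIdx g n j = parentIdx f n j ∧ siblingIdx g n j = siblingIdx f n j := by
  have h1 := parentIdx_lt hj
  have h2 := siblingIdx_lt hj
  have h3 := childSum_add_siblingIdx f n j
  have h4 := childSum_congr h h1.le
  have h5 : siblingIdx f n j < g (parentIdx f n j) := by rwa [← h _ h1]
  have := parentIdx_childSum_add (n := n) h1 h5
  have h6 := siblingIdx_childSum_add (n := n) h1 h5
  rw [← h4, h3] at this h6
  exact ⟨this, h6⟩

theorem levelSize_congr {c d : ℕ → ℕ → ℕ} {R : ℕ} (h : ∀ k < R, ∀ i < levelSize c k, c k i = d k i) :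
    ∀ k ≤ R, levelSize c k = levelSize d k := by
  intro k
  induction k with
  | zero => intro _; rfl
  | succ k ih =>
    intro hk
    rw [levelSize_succ, levelSize_succ, ← ih (by omega)]
    exact childSum_congr (h k (by omega)) le_rfl

/-- A property of the vertical edges of a strip which holds for the edges followed by a child and
passes from the first edge of a vertex to the last edge of the preceding vertex holds for all
edges, provided that there is at least one child. -/
theorem strip_induction {f : ℕ → ℕ} {n : ℕ} (hf : 0 < childSum f n) (Q : ℕ → ℕ → Prop)
    (h1 : ∀ i < n, ∀ a < f i, Q i a)
    (h2 : ∀ i < n, Q (cycSucc n i) 0 → Q i (f i)) : ∀ i < n, ∀ a ≤ f i, Q i a := by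
  obtain ⟨i₀, hi₀, hp⟩ := exists_pos_of_childSum_pos hf
  -- The passage `h2` runs backwards around the cycle, through childless vertices too, where the
  -- first edge is also the last. A vertex `i₀` with a child starts it: go down from `i₀` to `0`,
  -- then from `n - 1` downwards, using that `0` is the cyclic successor of `n - 1`.
  have hfirst : ∀ d i, i + d = i₀ → Q i 0 := by
    intro d
    induction d with
    | zero => intro i hi; obtain rfl : i = i₀ := by omega
              exact h1 i hi₀ 0 hp
    | succ d ih =>
      intro i hi
      rcases Nat.eq_zero_or_pos (f i) with h | h
      · have := h2 i (by omega)
        rw [h] at this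
        apply this
        rw [cycSucc, if_pos (by omega)]
        exact ih _ (by omega)
      · exact h1 i (by omega) 0 h
  have h0 : ∀ d i, i + d + 1 = n → Q (cycSucc n i) 0 := by
    intro d
    induction d with
    | zero => intro i hi
              rw [cycSucc, if_neg (by omega)]
              exact hfirst i₀ 0 (by omega)
    | succ d ih =>
      intro i hi
      rw [cycSucc, if_pos (by omega)]
      rcases Nat.eq_zero_or_pos (f (i + 1)) with h | h
      · have := h2 (i + 1) (by omega) (ih _ (by omega))
        rwa [h] at this
      · exact h1 _ (by omega) 0 h
  intro i hi a ha
  rcases ha.lt_or_eq with h | rfl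
  · exact h1 i hi a h
  · exact h2 i hi (h0 (n - 1 - i) i (by omega))

/-! ### The triangulation encoded by a plane tree -/

/-- Darts of the triangulation encoded by a tree: the edges `up k i a` lead from the `i`-th vertex
of level `k` to level `k + 1`, the edges `right k i` to the next vertex of level `k`; `down`
and `left` are the reversed edges. -/
inductive StripDart : Type
  | up (k i a : ℕ) : StripDart
  | down (k i a : ℕ) : StripDart
  | right (k i : ℕ) : StripDart
  | left (k i : ℕ) : StripDart

/-- A plane tree all of whose levels are nonempty, cut at the height `top`, where `top = 0` means
that it is not cut at all. Each vertex just below the cut has one child. -/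
structure LayerCode where
  c : ℕ → ℕ → ℕ
  top : ℕ
  top_ne : top ≠ 1
  pos : ∀ k, 0 < levelSize c k
  top_eq : ∀ k, k + 1 = top → ∀ i, c k i = 1

namespace LayerCode

open StripDart

variable (C : LayerCode)

abbrev n (k : ℕ) : ℕ := levelSize C.c k

/-- These are the heights that carry horizontal edges and upward edges. At height `top` itself there
are only the apexes of the decorating triangles. -/
def Below (k : ℕ) : Prop := C.top = 0 ∨ k < C.top

/-- The rank `a = c k i` is the extra upward edge of a vertex, to the first child of the next vertex
that has one. The root has no such edge, because its edges already close up around it. -/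
def Ok : StripDart → Prop
  | up k i a => C.Below k ∧ i < C.n k ∧ (a < C.c k i ∨ (a = C.c k i ∧ 0 < k))
  | down k i a => C.Below k ∧ i < C.n k ∧ (a < C.c k i ∨ (a = C.c k i ∧ 0 < k))
  | right k i => 0 < k ∧ C.Below k ∧ i < C.n k
  | left k i => 0 < k ∧ C.Below k ∧ i < C.n k

/-- The order around a vertex is: upward edges by rank, `right`, the tree edge to the parent, the
extra edges of preceding vertices of the lower level that end here, `left`. The dart `left k i`
starts at the vertex after the `i`-th. At height `top` there are no horizontal edges, and the
rotation exchanges the two downward darts. -/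
def rotFun : StripDart → StripDart
  | up k i a =>
    if a < C.c k i then
      if k = 0 ∧ a + 1 = C.c 0 0 then up 0 0 0 else up k i (a + 1)
    else right k i
  | right k i => down (k - 1) (parentIdx (C.c (k - 1)) (C.n (k - 1)) i)
      (siblingIdx (C.c (k - 1)) (C.n (k - 1)) i)
  | down k i 0 => if k = 0 then left 1 (C.c 0 0 - 1)
      else down k (cycPred (C.n k) i) (C.c k (cycPred (C.n k) i))
  | down k i (a + 1) => if k + 1 = C.top then down k (cycSucc (C.n k) i) 0
      else left (k + 1) (childSum (C.c k) i + a)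
  | left k i => up k (cycSucc (C.n k) i) 0

def rotInvFun : StripDart → StripDart
  | up k i 0 => if k = 0 then up 0 0 (C.c 0 0 - 1) else left k (cycPred (C.n k) i)
  | up k i (a + 1) => up k i a
  | right k i => up k i (C.c k i)
  | down k i a =>
    if a < C.c k i then
      if k + 1 = C.top then down k (cycPred (C.n k) i) 1
      else right (k + 1) (childSum (C.c k) i + a)
    else down k (cycSucc (C.n k) i) 0
  | left k i =>
    if k = 1 ∧ i + 1 = C.c 0 0 then down 0 0 0
    else down (k - 1) (parentIdx (C.c (k - 1)) (C.n (k - 1)) i)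
      (siblingIdx (C.c (k - 1)) (C.n (k - 1)) i + 1)

def flipFun : StripDart → StripDart
  | up k i a => down k i a
  | down k i a => up k i a
  | right k i => left k i
  | left k i => right k i

variable {C}

theorem n_zero : C.n 0 = 1 := rfl

theorem n_succ (k : ℕ) : C.n (k + 1) = childSum (C.c k) (C.n k) := rfl

theorem c_zero_pos : 0 < C.c 0 0 := levelSize_one C.c ▸ C.pos 1

theorem lt_childSum_of_ok {k i : ℕ} (hk : 0 < k) (hi : i < C.n k) :
    i < childSum (C.c (k - 1)) (C.n (k - 1)) := by
  obtain ⟨k, rfl⟩ : ∃ m, k = m + 1 := ⟨k - 1, by omega⟩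
  exact hi

theorem ok_rotFun : ∀ d, C.Ok d → C.Ok (C.rotFun d)
  | up k i a, ⟨hk, hi, ha⟩ => by
    simp only [rotFun]
    split_ifs with h1 h2
    · exact ⟨by obtain ⟨rfl, -⟩ := h2; exact hk, Nat.one_pos, Or.inl c_zero_pos⟩
    · refine ⟨hk, hi, ?_⟩
      rcases Nat.eq_zero_or_pos k with rfl | h
      · obtain rfl : i = 0 := by rw [n_zero] at hi; omega
        left; omega
      · omega
    · exact ⟨by omega, hk, hi⟩
  | right k i, ⟨h0, hk, hi⟩ => by
    have h := lt_childSum_of_ok h0 hi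
    exact ⟨by unfold Below at *; omega, parentIdx_lt h, Or.inl (siblingIdx_lt h)⟩
  | down k i 0, ⟨hk, hi, ha⟩ => by
    simp only [rotFun]
    split_ifs with h
    · subst h
      refine ⟨one_pos, by have := C.top_ne; unfold Below at *; omega, ?_⟩
      have := c_zero_pos (C := C)
      change _ < levelSize C.c 1
      rw [levelSize_one]; omega
    · exact ⟨hk, cycPred_lt hi, Or.inr ⟨rfl, by omega⟩⟩
  | down k i (a + 1), ⟨hk, hi, ha⟩ => by
    simp only [rotFun]
    split_ifs with h
    · refine ⟨hk, cycSucc_lt hi, Or.inl ?_⟩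
      rw [C.top_eq k h]; exact one_pos
    · refine ⟨by omega, by unfold Below at *; omega, ?_⟩
      rw [n_succ]
      exact childSum_add_lt hi (by omega)
  | left k i, ⟨h0, hk, hi⟩ => by
    refine ⟨hk, cycSucc_lt hi, ?_⟩
    rcases Nat.eq_zero_or_pos (C.c k (cycSucc (C.n k) i)) with h | h
    · exact Or.inr ⟨h.symm, h0⟩
    · exact Or.inl h

theorem ok_rotInvFun : ∀ d, C.Ok d → C.Ok (C.rotInvFun d)
  | up k i 0, ⟨hk, hi, ha⟩ => by
    simp only [rotInvFun]
    split_ifs with h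
    · subst h
      have := c_zero_pos (C := C)
      exact ⟨hk, one_pos, Or.inl (by omega)⟩
    · exact ⟨by omega, hk, cycPred_lt hi⟩
  | up k i (a + 1), ⟨hk, hi, ha⟩ => ⟨hk, hi, by omega⟩
  | right k i, ⟨h0, hk, hi⟩ => ⟨hk, hi, Or.inr ⟨rfl, h0⟩⟩
  | down k i a, ⟨hk, hi, ha⟩ => by
    simp only [rotInvFun]
    split_ifs with h1 h2
    · refine ⟨hk, cycPred_lt hi, Or.inr ⟨(C.top_eq k h2 _).symm, ?_⟩⟩
      have := C.top_ne; omega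
    · exact ⟨by omega, by unfold Below at *; omega, childSum_add_lt hi h1⟩
    · refine ⟨hk, cycSucc_lt hi, ?_⟩
      rcases Nat.eq_zero_or_pos (C.c k (cycSucc (C.n k) i)) with h | h
      · exact Or.inr ⟨h.symm, by omega⟩
      · exact Or.inl h
  | left k i, ⟨h0, hk, hi⟩ => by
    have h := lt_childSum_of_ok h0 hi
    simp only [rotInvFun]
    split_ifs with h1
    · exact ⟨by unfold Below at *; omega, one_pos, Or.inl c_zero_pos⟩
    · have h2 := parentIdx_lt h
      have h3 := siblingIdx_lt h
      refine ⟨by unfold Below at *; omega, h2, ?_⟩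
      by_cases hk1 : k = 1
      · subst hk1
        have h4 := childSum_add_siblingIdx (C.c (1 - 1)) (C.n (1 - 1)) i
        have h5 : parentIdx (C.c (1 - 1)) (C.n (1 - 1)) i = 0 := by
          have : C.n (1 - 1) = 1 := rfl
          omega
        rw [h5] at h3 h4 ⊢
        have h6 : i + 1 ≠ C.c 0 0 := fun h => h1 ⟨rfl, h⟩
        rw [childSum_zero] at h4
        change _ < C.c 0 0 at h3
        left
        change _ < C.c 0 0
        omega
      · omega

theorem rotInvFun_rotFun : ∀ d, C.Ok d → C.rotInvFun (C.rotFun d) = d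
  | up k i a, ⟨hk, hi, ha⟩ => by
    simp only [rotFun]
    split_ifs with h1 h2
    · obtain ⟨rfl, h2⟩ := h2
      obtain rfl : i = 0 := by rw [n_zero] at hi; omega
      simp only [rotInvFun, if_true]
      congr 1; omega
    · rfl
    · simp only [rotInvFun]
      congr 1; omega
  | right k i, ⟨h0, hk, hi⟩ => by
    have h := lt_childSum_of_ok h0 hi
    simp only [rotFun, rotInvFun]
    rw [if_pos (siblingIdx_lt h), if_neg (by unfold Below at *; omega), childSum_add_siblingIdx]
    congr 1; omega
  | down k i 0, ⟨hk, hi, ha⟩ => by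
    simp only [rotFun]
    split_ifs with h
    · subst h
      obtain rfl : i = 0 := by rw [n_zero] at hi; omega
      have := c_zero_pos (C := C)
      simp only [rotInvFun]
      rw [if_pos ⟨trivial, by omega⟩]
    · simp only [rotInvFun, lt_irrefl, if_false, cycSucc_cycPred hi]
  | down k i (a + 1), ⟨hk, hi, ha⟩ => by
    simp only [rotFun]
    split_ifs with h
    · have h1 := C.top_eq k h
      simp only [rotInvFun]
      rw [if_pos (by rw [h1]; exact one_pos), if_pos h, cycPred_cycSucc hi]
      congr 1
      rw [h1] at ha; omega
    · have ha' : a < C.c k i := by omega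
      simp only [rotInvFun, Nat.add_sub_cancel]
      rw [parentIdx_childSum_add hi ha', siblingIdx_childSum_add hi ha', if_neg]
      rintro ⟨h1, h2⟩
      obtain rfl : k = 0 := by omega
      obtain rfl : i = 0 := by rw [n_zero] at hi; omega
      rw [childSum_zero] at h2
      omega
  | left k i, ⟨h0, hk, hi⟩ => by
    simp only [rotFun, rotInvFun]
    rw [if_neg (by omega), cycPred_cycSucc hi]

theorem rotFun_rotInvFun : ∀ d, C.Ok d → C.rotFun (C.rotInvFun d) = d
  | up k i 0, ⟨hk, hi, ha⟩ => by
    simp only [rotInvFun]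
    have := c_zero_pos (C := C)
    split_ifs with h
    · subst h
      obtain rfl : i = 0 := by rw [n_zero] at hi; omega
      simp only [rotFun]
      rw [if_pos (by omega), if_pos ⟨trivial, by omega⟩]
    · simp only [rotFun, cycSucc_cycPred hi]
  | up k i (a + 1), ⟨hk, hi, ha⟩ => by
    simp only [rotInvFun, rotFun]
    rw [if_pos (by omega), if_neg]
    rintro ⟨rfl, h⟩
    obtain rfl : i = 0 := by rw [n_zero] at hi; omega
    omega
  | right k i, ⟨h0, hk, hi⟩ => by simp [rotInvFun, rotFun]
  | down k i a, ⟨hk, hi, ha⟩ => by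
    simp only [rotInvFun]
    split_ifs with h1 h2
    · simp only [rotFun]
      rw [if_pos h2, cycSucc_cycPred hi]
      rw [C.top_eq k h2] at h1
      congr 1; omega
    · simp only [rotFun, Nat.add_sub_cancel]
      rw [parentIdx_childSum_add hi h1, siblingIdx_childSum_add hi h1]
    · simp only [rotFun]
      rw [if_neg (by omega), cycPred_cycSucc hi]
      congr 1; omega
  | left k i, ⟨h0, hk, hi⟩ => by
    have h := lt_childSum_of_ok h0 hi
    simp only [rotInvFun]
    split_ifs with h1
    · obtain ⟨rfl, h1⟩ := h1
      simp only [rotFun, if_true]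
      congr 1; omega
    · simp only [rotFun]
      rw [if_neg (by unfold Below at *; omega), childSum_add_siblingIdx]
      congr 1; omega

theorem ok_flipFun : ∀ d, C.Ok d → C.Ok (flipFun d)
  | up _ _ _, h => h
  | down _ _ _, h => h
  | right _ _, h => h
  | left _ _, h => h

theorem flipFun_flipFun : ∀ d, flipFun (flipFun d) = d
  | up _ _ _ => rfl
  | down _ _ _ => rfl
  | right _ _ => rfl
  | left _ _ => rfl

theorem flipFun_ne : ∀ d, flipFun d ≠ d
  | up _ _ _ => by simp [flipFun]
  | down _ _ _ => by simp [flipFun]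
  | right _ _ => by simp [flipFun]
  | left _ _ => by simp [flipFun]

theorem below_zero : C.Below 0 := by have := C.top_ne; unfold Below; omega

variable (C)

/-- The triangulation encoded by a plane tree. -/
def toRootedMap : RootedMap where
  Dart := {d : StripDart // C.Ok d}
  rot :=
    { toFun := fun d => ⟨C.rotFun d, ok_rotFun d d.2⟩
      invFun := fun d => ⟨C.rotInvFun d, ok_rotInvFun d d.2⟩
      left_inv := fun d => Subtype.ext (rotInvFun_rotFun d d.2)
      right_inv := fun d => Subtype.ext (rotFun_rotInvFun d d.2) }
  flip :=
    { toFun := fun d => ⟨flipFun d, ok_flipFun d d.2⟩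
      invFun := fun d => ⟨flipFun d, ok_flipFun d d.2⟩
      left_inv := fun d => Subtype.ext (flipFun_flipFun d)
      right_inv := fun d => Subtype.ext (flipFun_flipFun d) }
  flip_flip := fun d => Subtype.ext (flipFun_flipFun d)
  flip_ne := fun d h => flipFun_ne d.1 (congrArg Subtype.val h)
  root := ⟨up 0 0 0, below_zero, Nat.one_pos, Or.inl c_zero_pos⟩

end LayerCode

/-! ### Heights in a rooted map -/

namespace RootedMap

variable {G : RootedMap}

theorem vert_eq_iff {a b : G.Dart} : G.vert a = G.vert b ↔ G.rot.SameCycle a b := Quotient.eq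

theorem edge_eq_iff {a b : G.Dart} : G.edge a = G.edge b ↔ b = a ∨ b = G.flip a := by
  refine (Quotient.eq (r := Equiv.Perm.SameCycle.setoid G.flip)).trans ⟨?_, ?_⟩
  · rintro ⟨z, hz⟩
    have h2 : G.flip ^ (2 : ℤ) = 1 := by
      ext d
      rw [zpow_two]
      exact G.flip_flip d
    rcases Int.even_or_odd' z with ⟨m, rfl | rfl⟩
    · left; rw [← hz, zpow_mul, h2, one_zpow]; rfl
    · right; rw [← hz, zpow_add, zpow_mul, h2, one_zpow, one_mul, zpow_one]
  · rintro (rfl | rfl)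
    · exact Equiv.Perm.SameCycle.refl _ _
    · exact ⟨1, by simp⟩

theorem vert_rot (d : G.Dart) : G.vert (G.rot d) = G.vert d :=
  vert_eq_iff.2 ⟨-1, by simp⟩

theorem ht_rot (d : G.Dart) : G.ht (G.rot d) = G.ht d := by
  unfold ht; rw [vert_rot]

theorem ht_eq_of_vert_eq {a b : G.Dart} (h : G.vert a = G.vert b) : G.ht a = G.ht b := by
  unfold ht; rw [h]

theorem facePerm_apply (d : G.Dart) : G.facePerm d = G.rot (G.flip d) := rfl

theorem ht_facePerm (d : G.Dart) : G.ht (G.facePerm d) = G.ht (G.flip d) := ht_rot _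

theorem eq_of_invariant {α β : Type*} {σ : Equiv.Perm β} {ℓ : β → α} (h : ∀ d, ℓ (σ d) = ℓ d)
    {a b : β} (hab : σ.SameCycle a b) : ℓ a = ℓ b := by
  obtain ⟨z, rfl⟩ := hab
  have h' : ∀ d, ℓ (σ⁻¹ d) = ℓ d := fun d => by
    conv_rhs => rw [← Equiv.apply_symm_apply σ d, h]
    rfl
  induction z using Int.induction_on with
  | zero => rfl
  | succ n ih => rw [ih, add_comm, zpow_add, zpow_one, Equiv.Perm.mul_apply, h]
  | pred n ih => rw [ih, sub_eq_neg_add, zpow_add, zpow_neg_one, Equiv.Perm.mul_apply, h']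

theorem eq_of_rot_invariant {α : Type*} {ℓ : G.Dart → α} (h : ∀ d, ℓ (G.rot d) = ℓ d)
    {a b : G.Dart} (hab : G.rot.SameCycle a b) : ℓ a = ℓ b := eq_of_invariant h hab

/-- A function on the darts which satisfies the local characterization of the height is the
height. -/
theorem connected_and_ht_eq (ℓ : G.Dart → ℕ) (h1 : ∀ d, ℓ (G.rot d) = ℓ d)
    (h2 : ∀ d, ℓ (G.flip d) ≤ ℓ d + 1) (h3 : ∀ d, ℓ d = 0 ↔ G.rot.SameCycle G.root d)
    (h4 : ∀ d, 0 < ℓ d → ∃ d', G.rot.SameCycle d d' ∧ ℓ (G.flip d') < ℓ d) :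
    G.graph.Connected ∧ ∀ d, G.ht d = ℓ d := by
  let L : G.Vertex → ℕ := Quotient.lift ℓ fun a b h => eq_of_rot_invariant h1 h
  have hL : ∀ d, L (G.vert d) = ℓ d := fun d => rfl
  have hsurj : ∀ v : G.Vertex, ∃ d, G.vert d = v := fun v => Quotient.exists_rep v
  have hadj : ∀ u v, G.graph.Adj u v → L v ≤ L u + 1 := by
    rintro u v ⟨-, d, rfl, rfl⟩
    exact h2 d
  have hroot : L (G.vert G.root) = 0 := (h3 G.root).2 (Equiv.Perm.SameCycle.refl _ _)
  -- Descending by `h4` gives a walk from the root of length at most `ℓ`; by `h2` no walk can be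
  -- shorter.
  have hwalk : ∀ m v, L v = m → ∃ p : G.graph.Walk (G.vert G.root) v, p.length ≤ m := by
    intro m
    induction m using Nat.strong_induction_on with
    | _ m ih =>
      intro v hv
      obtain ⟨d, rfl⟩ := hsurj v
      rcases Nat.eq_zero_or_pos m with rfl | hm
      · have : G.vert G.root = G.vert d := vert_eq_iff.2 ((h3 d).1 hv)
        rw [← this]
        exact ⟨.nil, le_rfl⟩
      · rw [hL] at hv
        obtain ⟨d', hd, hlt⟩ := h4 d (hv ▸ hm)
        obtain ⟨p, hp⟩ := ih _ (hv ▸ hlt) (G.vert (G.flip d')) rfl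
        have hvv : G.vert d = G.vert d' := vert_eq_iff.2 hd
        have ha : G.graph.Adj (G.vert (G.flip d')) (G.vert d) := by
          refine ⟨fun h => ?_, G.flip d', rfl, by rw [G.flip_flip, hvv]⟩
          have := congrArg L h
          rw [hL, hL] at this; omega
        refine ⟨p.concat ha, ?_⟩
        rw [hL] at hp
        rw [SimpleGraph.Walk.length_concat]; omega
  have hlow : ∀ u v (p : G.graph.Walk u v), L v ≤ L u + p.length := by
    intro u v p
    induction p with
    | nil => simp
    | cons h p ih =>
      have := hadj _ _ h
      rw [SimpleGraph.Walk.length_cons]; omega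
  have hconn : G.graph.Connected := by
    have : Nonempty G.Vertex := ⟨G.vert G.root⟩
    refine SimpleGraph.Connected.mk fun u v => ?_
    obtain ⟨p, -⟩ := hwalk _ u rfl
    obtain ⟨q, -⟩ := hwalk _ v rfl
    exact ⟨p.reverse.append q⟩
  refine ⟨hconn, fun d => le_antisymm ?_ ?_⟩
  · obtain ⟨p, hp⟩ := hwalk _ (G.vert d) rfl
    exact (SimpleGraph.dist_le p).trans hp
  · obtain ⟨p, hp⟩ := (hconn (G.vert G.root) (G.vert d)).exists_walk_length_eq_dist
    have := hlow _ _ p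
    rw [hroot, hL, hp] at this
    change ℓ d ≤ G.graph.dist _ _
    omega

theorem ht_root : G.ht G.root = 0 := SimpleGraph.dist_self

theorem ht_flip_le (hc : G.graph.Connected) (d : G.Dart) : G.ht (G.flip d) ≤ G.ht d + 1 := by
  by_cases h : G.vert d = G.vert (G.flip d)
  · rw [ht_eq_of_vert_eq h]; omega
  · have h1 := hc.dist_triangle (u := G.vert G.root) (v := G.vert d) (w := G.vert (G.flip d))
    have h2 : G.graph.dist (G.vert d) (G.vert (G.flip d)) = 1 :=
      SimpleGraph.dist_eq_one_iff_adj.2 ⟨h, d, rfl, rfl⟩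
    rw [h2] at h1
    exact h1

theorem ht_le_flip (hc : G.graph.Connected) (d : G.Dart) : G.ht d ≤ G.ht (G.flip d) + 1 := by
  simpa [G.flip_flip] using ht_flip_le hc (G.flip d)

theorem ht_eq_zero_iff (hc : G.graph.Connected) (d : G.Dart) :
    G.ht d = 0 ↔ G.rot.SameCycle G.root d :=
  hc.dist_eq_zero_iff.trans vert_eq_iff

/-- Take the first edge of a geodesic to the root. -/
theorem exists_lower (hc : G.graph.Connected) (d : G.Dart) (hd : 0 < G.ht d) :
    ∃ d', G.rot.SameCycle d d' ∧ G.ht (G.flip d') + 1 = G.ht d := by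
  obtain ⟨p, hp⟩ := (hc (G.vert d) (G.vert G.root)).exists_walk_length_eq_dist
  have hh : G.ht d = p.length := by
    rw [hp, SimpleGraph.dist_comm]; rfl
  clear hp
  revert hh
  generalize hv : G.vert d = v at p
  cases p with
  | nil =>
    intro hh
    have := (SimpleGraph.Walk.length_nil (G := G.graph) (u := G.vert d)).symm.trans hh.symm
    omega
  | cons h q =>
    intro hh
    rw [SimpleGraph.Walk.length_cons] at hh
    obtain ⟨-, e, he, he'⟩ := h
    refine ⟨e, vert_eq_iff.1 (hv.trans he.symm), ?_⟩
    have h1 : G.ht (G.flip e) ≤ q.length := by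
      unfold ht height
      rw [SimpleGraph.dist_comm, he']
      exact SimpleGraph.dist_le q
    have h2 := ht_le_flip hc e
    have h3 := ht_eq_of_vert_eq (hv.trans he.symm)
    omega

end RootedMap

/-! ### Heights and positions in the triangulation of a tree -/

namespace LayerCode

open StripDart

/-- The level of the initial vertex of a dart. -/
def level : StripDart → ℕ
  | up k _ _ => k
  | down k _ _ => k + 1
  | right k _ => k
  | left k _ => k

variable (C : LayerCode)

/-- The position in its level of the initial vertex of a dart. -/
def idx : StripDart → ℕ
  | up _ i _ => i
  | down k i a => if childSum (C.c k) i + a < C.n (k + 1) then childSum (C.c k) i + a else 0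
  | right _ i => i
  | left k i => cycSucc (C.n k) i

variable {C}

theorem level_rotFun : ∀ d, C.Ok d → level (C.rotFun d) = level d
  | up k i a, _ => by
    simp only [rotFun]
    split_ifs with h1 h2
    · exact h2.1.symm
    · rfl
    · rfl
  | right k i, ⟨h0, _, _⟩ => by simp only [rotFun, level]; omega
  | down k i 0, _ => by
    simp only [rotFun]
    split_ifs with h
    · subst h; rfl
    · rfl
  | down k i (a + 1), _ => by
    simp only [rotFun]
    split_ifs <;> rfl
  | left k i, _ => rfl

theorem level_flipFun_le : ∀ d, level (flipFun d) ≤ level d + 1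
  | up _ _ _ => le_rfl
  | down k _ _ => by simp only [flipFun, level]; omega
  | right k _ => by simp only [flipFun, level]; omega
  | left k _ => by simp only [flipFun, level]; omega

theorem idx_down_of_lt {k i a : ℕ} (hi : i < C.n k) (ha : a < C.c k i) :
    C.idx (down k i a) = childSum (C.c k) i + a :=
  if_pos (childSum_add_lt hi ha)

/-- The children of a vertex are followed immediately by those of the next one, cyclically. This is
why the two edges compared here can be two sides of the triangle above `right k i`. -/
theorem idx_down_last {k i : ℕ} (hi : i < C.n k) :
    C.idx (down k i (C.c k i)) = C.idx (down k (cycSucc (C.n k) i) 0) := by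
  have hpos := C.pos (k + 1)
  simp only [idx, ← childSum_succ, cycSucc, add_zero]
  by_cases h : i + 1 < C.n k
  · rw [if_pos h]
  · have : i + 1 = C.n k := by omega
    rw [if_neg h, this, ← n_succ, if_neg (lt_irrefl _), childSum_zero, if_pos hpos]

theorem idx_rotFun : ∀ d, C.Ok d → C.idx (C.rotFun d) = C.idx d
  | up k i a, ⟨hk, hi, ha⟩ => by
    simp only [rotFun]
    split_ifs with h1 h2
    · obtain ⟨rfl, -⟩ := h2
      rw [n_zero] at hi
      simp only [idx]; omega
    · rfl
    · rfl
  | right k i, ⟨h0, hk, hi⟩ => by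
    have h := lt_childSum_of_ok h0 hi
    simp only [rotFun]
    rw [idx_down_of_lt (parentIdx_lt h) (siblingIdx_lt h), childSum_add_siblingIdx]
    rfl
  | down k i 0, ⟨hk, hi, ha⟩ => by
    simp only [rotFun]
    split_ifs with h
    · subst h
      obtain rfl : i = 0 := by rw [n_zero] at hi; omega
      have := c_zero_pos (C := C)
      have h1 : C.n 1 = C.c 0 0 := levelSize_one _
      simp only [idx, cycSucc, childSum_zero, h1]
      rw [if_neg (by omega), add_zero, ite_self]
    · rw [idx_down_last (cycPred_lt hi), cycSucc_cycPred hi]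
  | down k i (a + 1), ⟨hk, hi, ha⟩ => by
    simp only [rotFun]
    split_ifs with h
    · rw [C.top_eq k h] at ha
      obtain rfl : a = 0 := by omega
      rw [← idx_down_last hi, C.top_eq k h]
    · rfl
  | left k i, _ => rfl

theorem idx_lt : ∀ d, C.Ok d → C.idx d < C.n (level d)
  | up k i a, ⟨hk, hi, ha⟩ => hi
  | down k i a, _ => by
    have := C.pos (k + 1)
    simp only [idx, level]
    split_ifs <;> assumption
  | right k i, ⟨h0, hk, hi⟩ => hi
  | left k i, ⟨h0, hk, hi⟩ => cycSucc_lt hi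

/-! #### Faces -/

def faceFun (C : LayerCode) (d : StripDart) : StripDart := C.rotFun (flipFun d)

/-- The darts on the exterior face. -/
def IsExt (C : LayerCode) : StripDart → Prop
  | up k _ a => k + 1 = C.top ∧ a = 1
  | down k _ a => k + 1 = C.top ∧ a = 0
  | right _ _ => False
  | left _ _ => False

/-- The vertical edge following `up k i a` around its initial vertex, for `a < c k i`. -/
def nextUp (C : LayerCode) (k i a : ℕ) : StripDart :=
  if k = 0 ∧ a + 1 = C.c 0 0 then up 0 0 0 else up k i (a + 1)

theorem faceFun_right (k i : ℕ) : C.faceFun (right k i) = up k (cycSucc (C.n k) i) 0 := rfl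

theorem faceFun_up_zero {k i : ℕ} (hk : 0 < k) : C.faceFun (up k i 0) =
    down k (cycPred (C.n k) i) (C.c k (cycPred (C.n k) i)) :=
  if_neg (by omega)

theorem faceFun_down_last {k i : ℕ} : C.faceFun (down k i (C.c k i)) = right k i :=
  if_neg (lt_irrefl _)

theorem faceFun_down {k i a : ℕ} (ha : a < C.c k i) :
    C.faceFun (down k i a) = C.nextUp k i a :=
  if_pos ha

theorem faceFun_nextUp {k i a : ℕ} (hi : i < C.n k) (ha : a < C.c k i)
    (ht : k + 1 ≠ C.top) : C.faceFun (C.nextUp k i a) = left (k + 1) (childSum (C.c k) i + a) := by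
  unfold nextUp
  split_ifs with h
  · obtain ⟨rfl, h⟩ := h
    obtain rfl : i = 0 := by rw [n_zero] at hi; omega
    simp only [faceFun, flipFun, rotFun, if_true, childSum_zero]
    congr 1; omega
  · exact if_neg ht

theorem faceFun_left {k i a : ℕ} (hi : i < C.n k) (ha : a < C.c k i) :
    C.faceFun (left (k + 1) (childSum (C.c k) i + a)) = down k i a := by
  simp only [faceFun, flipFun, rotFun, Nat.add_sub_cancel]
  rw [parentIdx_childSum_add hi ha, siblingIdx_childSum_add hi ha]

theorem exists_cell {k j : ℕ} (hk : 0 < k) (hj : j < C.n k) : ∃ k' i a, k = k' + 1 ∧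
    i < C.n k' ∧ a < C.c k' i ∧ j = childSum (C.c k') i + a := by
  have h := lt_childSum_of_ok hk hj
  exact ⟨k - 1, _, _, by omega, parentIdx_lt h, siblingIdx_lt h,
    (childSum_add_siblingIdx _ _ _).symm⟩

theorem ok_faceFun {d : StripDart} (h : C.Ok d) : C.Ok (C.faceFun d) :=
  ok_rotFun _ (ok_flipFun _ h)

/-- Every dart off the exterior face lies on one of two kinds of triangles. -/
theorem triangle_cases {d : StripDart} (hd : C.Ok d) (he : ¬ C.IsExt d) :
    (∃ k i, 0 < k ∧ C.Below k ∧ i < C.n k ∧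
      (d = right k i ∨ d = up k (cycSucc (C.n k) i) 0 ∨ d = down k i (C.c k i))) ∨
    (∃ k i a, C.Below (k + 1) ∧ i < C.n k ∧ a < C.c k i ∧ k + 1 ≠ C.top ∧
      (d = left (k + 1) (childSum (C.c k) i + a) ∨ d = down k i a ∨ d = C.nextUp k i a)) := by
  cases d with
  | right k i => exact Or.inl ⟨k, i, hd.1, hd.2.1, hd.2.2, Or.inl rfl⟩
  | left k j =>
    obtain ⟨h0, hk, hj⟩ := hd
    obtain ⟨k, i, a, rfl, hi, ha, rfl⟩ := exists_cell h0 hj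
    exact Or.inr ⟨k, i, a, hk, hi, ha, by unfold Below at hk; omega, Or.inl rfl⟩
  | down k i a =>
    obtain ⟨hk, hi, ha⟩ := hd
    by_cases h : a < C.c k i
    · have ht : k + 1 ≠ C.top := fun ht => he ⟨ht, by rw [C.top_eq k ht] at h; omega⟩
      exact Or.inr ⟨k, i, a, by unfold Below at *; omega, hi, h, ht, Or.inr (Or.inl rfl)⟩
    · obtain ⟨rfl, h0⟩ : a = C.c k i ∧ 0 < k := by omega
      exact Or.inl ⟨k, i, h0, hk, hi, Or.inr (Or.inr rfl)⟩
  | up k i a =>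
    obtain ⟨hk, hi, ha⟩ := hd
    cases a with
    | zero =>
      rcases Nat.eq_zero_or_pos k with rfl | h0
      · obtain rfl : i = 0 := by rw [n_zero] at hi; omega
        have := c_zero_pos (C := C)
        have := C.top_ne
        refine Or.inr ⟨0, 0, C.c 0 0 - 1, by unfold Below at *; omega, hi, by omega, by omega,
          Or.inr (Or.inr ?_)⟩
        rw [nextUp, if_pos ⟨rfl, by omega⟩]
      · exact Or.inl ⟨k, _, h0, hk, cycPred_lt hi, Or.inr (Or.inl (by rw [cycSucc_cycPred hi]))⟩
    | succ a =>
      have ht : k + 1 ≠ C.top := fun ht => he ⟨ht, by rw [C.top_eq k ht] at ha; omega⟩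
      refine Or.inr ⟨k, i, a, by unfold Below at *; omega, hi, by omega, ht, Or.inr (Or.inr ?_)⟩
      rw [nextUp, if_neg]
      rintro ⟨rfl, h⟩
      obtain rfl : i = 0 := by rw [n_zero] at hi; omega
      omega

/-- Above `right k i` the boundary runs through the first upward edge of the next vertex and back
along the extra edge of the `i`-th. Below a horizontal edge it runs down the tree edge at one end of
that edge and up the following upward edge of the parent. -/
theorem faceFun_faceFun_faceFun {d : StripDart} (hd : C.Ok d) (he : ¬ C.IsExt d) :
    C.faceFun (C.faceFun (C.faceFun d)) = d := by
  rcases triangle_cases hd he with ⟨k, i, h0, hk, hi, h⟩ | ⟨k, i, a, hk, hi, ha, ht, h⟩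
  · have e1 := faceFun_right (C := C) k i
    have e2 := faceFun_up_zero (C := C) (i := cycSucc (C.n k) i) h0
    rw [cycPred_cycSucc hi] at e2
    have e3 := faceFun_down_last (C := C) (k := k) (i := i)
    rcases h with rfl | rfl | rfl <;> simp only [e1, e2, e3]
  · have e1 := faceFun_left (C := C) hi ha
    have e2 := faceFun_down (C := C) ha
    have e3 := faceFun_nextUp (C := C) hi ha ht
    rcases h with rfl | rfl | rfl <;> simp only [e1, e2, e3]

theorem faceFun_ne : ∀ d, C.faceFun d ≠ d
  | right k i => by simp [faceFun, flipFun, rotFun]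
  | left k i => by simp [faceFun, flipFun, rotFun]
  | up k i 0 => by simp only [faceFun, flipFun, rotFun]; split_ifs <;> simp
  | up k i (a + 1) => by simp only [faceFun, flipFun, rotFun]; split_ifs <;> simp
  | down k i a => by simp only [faceFun, flipFun, rotFun]; split_ifs <;> simp

/-! #### The map -/

theorem coe_flip (d : C.toRootedMap.Dart) : (C.toRootedMap.flip d).1 = flipFun d.1 := rfl

theorem coe_facePerm (d : C.toRootedMap.Dart) : (C.toRootedMap.facePerm d).1 = C.faceFun d.1 := rfl

/-- A dart of the map. -/
def dart (C : LayerCode) (d : StripDart) (h : C.Ok d) : C.toRootedMap.Dart := ⟨d, h⟩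

theorem rot_dart {d d' : StripDart} {h : C.Ok d} (e : C.rotFun d = d') :
    C.toRootedMap.rot (C.dart d h) = C.dart d' (e ▸ ok_rotFun d h) := Subtype.ext e

theorem sameCycle_of_rotFun {d d' : StripDart} {h : C.Ok d} {h' : C.Ok d'}
    (e : C.rotFun d = d') : C.toRootedMap.rot.SameCycle (C.dart d h) (C.dart d' h') :=
  ⟨1, by rw [zpow_one]; exact Subtype.ext e⟩

theorem sameCycle_up_right {k i : ℕ} (h0 : 0 < k) (hk : C.Below k) (hi : i < C.n k) :
    ∀ e a (h : a + e = C.c k i), C.toRootedMap.rot.SameCycle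
      (C.dart (up k i a) ⟨hk, hi, by omega⟩) (C.dart (right k i) ⟨h0, hk, hi⟩) := by
  intro e
  induction e with
  | zero =>
    intro a h
    refine sameCycle_of_rotFun ?_
    simp only [rotFun]
    rw [if_neg (by omega)]
  | succ e ih =>
    intro a h
    refine (sameCycle_of_rotFun ?_).trans (ih (a + 1) (by omega))
    simp only [rotFun]
    rw [if_pos (by omega), if_neg (by omega)]

theorem sameCycle_root : ∀ a (h : a < C.c 0 0), C.toRootedMap.rot.SameCycle C.toRootedMap.root
    (C.dart (up 0 0 a) ⟨below_zero, one_pos, Or.inl h⟩) := by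
  intro a
  induction a with
  | zero => intro h; exact Equiv.Perm.SameCycle.refl _ _
  | succ a ih =>
    intro h
    refine (ih (by omega)).trans (sameCycle_of_rotFun ?_)
    simp only [rotFun]
    rw [if_pos (by omega), if_neg (by omega)]

/-- A reversed tree edge directly follows `right` in the rotation, and a reversed extra edge
directly follows the reversed first edge of the next vertex. This is the pattern of
`strip_induction`. -/
theorem sameCycle_down {k : ℕ} (hk : C.Below (k + 1)) : ∀ i < C.n k,
    ∀ a ≤ C.c k i, ∀ h : C.Ok (down k i a),
      C.toRootedMap.rot.SameCycle (C.dart (down k i a) h)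
        (C.dart (right (k + 1) (C.idx (down k i a))) ⟨by omega, hk, idx_lt _ h⟩) := by
  refine strip_induction (C.pos (k + 1)) _ ?_ ?_
  · intro i hi a ha h
    refine (sameCycle_of_rotFun ?_).symm
    rw [idx_down_of_lt hi ha]
    simp only [rotFun, Nat.add_sub_cancel]
    rw [parentIdx_childSum_add hi ha, siblingIdx_childSum_add hi ha]
  · intro i hi hs h
    have h0 : 0 < k := by have := h.2.2; omega
    have h' : C.Ok (down k (cycSucc (C.n k) i) 0) := ⟨h.1, cycSucc_lt hi, by omega⟩
    have h1 := hs h'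
    have h2 : C.toRootedMap.rot.SameCycle (C.dart _ h') (C.dart _ h) := by
      refine sameCycle_of_rotFun ?_
      simp only [rotFun]
      rw [if_neg (by omega), cycPred_cycSucc hi]
    simp only [idx_down_last hi]
    exact h2.symm.trans h1

/-- Since `level` and `idx` are constant around a vertex, this shows that they classify the vertices
between the root and the cut, with `right` as a representative dart. -/
theorem sameCycle_right (d : StripDart) (h : C.Ok d) (h0 : 0 < level d) (hb : C.Below (level d)) :
    C.toRootedMap.rot.SameCycle (C.dart d h)
      (C.dart (right (level d) (C.idx d)) ⟨h0, hb, idx_lt _ h⟩) := by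
  cases d with
  | up k i a =>
    have := h.2.2
    exact sameCycle_up_right h0 hb h.2.1 (C.c k i - a) a (by change a + (C.c k i - a) = C.c k i; omega)
  | right k i => exact Equiv.Perm.SameCycle.refl _ _
  | left k i =>
    have hi := cycSucc_lt h.2.2
    have h' : C.Ok (up k (cycSucc (C.n k) i) 0) := ⟨hb, hi, by change 0 < k at h0; omega⟩
    exact (sameCycle_of_rotFun (h' := h') rfl).trans
      (sameCycle_up_right h0 hb hi _ 0 (zero_add _))
  | down k i a =>
    have := h.2.2
    exact sameCycle_down hb i h.2.1 a
      (by omega) h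

theorem connected_and_ht_eq_level :
    C.toRootedMap.graph.Connected ∧ ∀ d, C.toRootedMap.ht d = level d.1 := by
  refine RootedMap.connected_and_ht_eq (G := C.toRootedMap) (fun d => level d.1)
    (fun d => level_rotFun d.1 d.2) (fun d => level_flipFun_le d.1) ?_ ?_
  · rintro ⟨d, hd⟩
    constructor
    · intro h
      cases d with
      | up k i a =>
        obtain rfl : k = 0 := h
        obtain ⟨hk, hi, ha⟩ := hd
        obtain rfl : i = 0 := by rw [n_zero] at hi; omega
        exact sameCycle_root a (by omega)
      | down k i a => exact absurd h (Nat.succ_ne_zero k)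
      | right k i => exact absurd h hd.1.ne'
      | left k i => exact absurd h hd.1.ne'
    · intro h
      exact (RootedMap.eq_of_rot_invariant (G := C.toRootedMap) (ℓ := fun d => level d.1)
        (fun d => level_rotFun d.1 d.2) h).symm
  · rintro ⟨d, hd⟩ h0
    -- The dart after `right` is the tree edge to the parent, which leads down. At the height of the
    -- cut only `down` darts start, and they lead down themselves.
    have key : ∀ hb : C.Below (level d), ∃ d' : C.toRootedMap.Dart,
        C.toRootedMap.rot.SameCycle ⟨d, hd⟩ d' ∧
          level (C.toRootedMap.flip d').1 < level d := by
      intro hb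
      refine ⟨C.toRootedMap.rot (C.dart (right (level d) (C.idx d)) ⟨h0, hb, idx_lt _ hd⟩),
        Equiv.Perm.sameCycle_apply_right.2 (sameCycle_right d hd h0 hb), ?_⟩
      change level d - 1 < level d
      exact Nat.sub_lt h0 one_pos
    cases d with
    | up k i a => exact key hd.1
    | down k i a => exact ⟨⟨down k i a, hd⟩, Equiv.Perm.SameCycle.refl _ _, Nat.lt_succ_self k⟩
    | right k i => exact key hd.2.1
    | left k i => exact key hd.2.1

theorem ht_eq (d : C.toRootedMap.Dart) : C.toRootedMap.ht d = level d.1 :=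
  connected_and_ht_eq_level.2 d

theorem ht_dart {d : StripDart} (h : C.Ok d) : C.toRootedMap.ht (C.dart d h) = level d :=
  ht_eq (C.dart d h)

theorem ht_flip_dart {d : StripDart} (h : C.Ok d) :
    C.toRootedMap.ht (C.toRootedMap.flip (C.dart d h)) = level (flipFun d) :=
  ht_eq _

theorem exists_dart (d : C.toRootedMap.Dart) : ∃ d' h, d = C.dart d' h := ⟨d.1, d.2, rfl⟩

theorem idx_eq_of_sameCycle {d d' : C.toRootedMap.Dart} (h : C.toRootedMap.rot.SameCycle d d') :
    C.idx d.1 = C.idx d'.1 :=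
  RootedMap.eq_of_rot_invariant (G := C.toRootedMap) (ℓ := fun d => C.idx d.1)
    (fun d => idx_rotFun d.1 d.2) h

theorem level_eq_of_sameCycle {d d' : C.toRootedMap.Dart} (h : C.toRootedMap.rot.SameCycle d d') :
    level d.1 = level d'.1 :=
  RootedMap.eq_of_rot_invariant (G := C.toRootedMap) (ℓ := fun d => level d.1)
    (fun d => level_rotFun d.1 d.2) h

theorem faceDegree_eq_three {d : C.toRootedMap.Dart} (hd : ¬ C.IsExt d.1) :
    C.toRootedMap.faceDegree d = 3 := by
  refine Function.minimalPeriod_eq_prime (p := 3) ?_ ?_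
  · exact Subtype.ext (faceFun_faceFun_faceFun d.2 hd)
  · exact fun h => faceFun_ne d.1 (congrArg Subtype.val h)

end LayerCode

/-! ### Local finiteness and cycles -/

namespace LayerCode

open StripDart

variable {C : LayerCode}

theorem finite_level (k : ℕ) : {d : C.toRootedMap.Dart | level d.1 = k}.Finite := by
  have hbox : ∀ m : ℕ, {d : StripDart | ∃ i < C.n m, ∃ a ≤ C.c m i, d = up m i a ∨ d = down m i a ∨
      d = right m i ∨ d = left m i}.Finite := by
    intro m
    have : {d : StripDart | ∃ i < C.n m, ∃ a ≤ C.c m i, d = up m i a ∨ d = down m i a ∨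
        d = right m i ∨ d = left m i} ⊆ ⋃ i ∈ Set.Iio (C.n m), ⋃ a ∈ Set.Iic (C.c m i),
          {up m i a, down m i a, right m i, left m i} := by
      rintro d ⟨i, hi, a, ha, hd⟩
      simp only [Set.mem_iUnion]
      exact ⟨i, hi, a, ha, hd⟩
    refine Set.Finite.subset ?_ this
    refine (Set.finite_Iio _).biUnion fun i _ => (Set.finite_Iic _).biUnion fun a _ => ?_
    exact Set.toFinite _
  refine Set.Finite.of_finite_image (f := Subtype.val) ?_ Subtype.val_injective.injOn
  refine ((hbox k).union (hbox (k - 1))).subset ?_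
  rintro _ ⟨⟨d, hd⟩, h, rfl⟩
  cases d with
  | up m i a => obtain rfl : m = k := h
                exact Or.inl ⟨i, hd.2.1, a, by have := hd.2.2; omega, by simp⟩
  | down m i a => obtain rfl : m + 1 = k := h
                  exact Or.inr ⟨i, hd.2.1, a, by have := hd.2.2; simpa using by omega, by simp⟩
  | right m i => obtain rfl : m = k := h
                 exact Or.inl ⟨i, hd.2.2, 0, Nat.zero_le _, by simp⟩
  | left m i => obtain rfl : m = k := h
                exact Or.inl ⟨i, hd.2.2, 0, Nat.zero_le _, by simp⟩

theorem locallyFinite : C.toRootedMap.LocallyFinite := by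
  intro v
  obtain ⟨d, rfl⟩ := Quotient.exists_rep v
  refine (finite_level (level d.1)).subset fun e he => ?_
  exact level_eq_of_sameCycle (RootedMap.vert_eq_iff.1 he)

theorem noRootLoop : C.toRootedMap.NoRootLoop := by
  intro d h0
  obtain ⟨d, hd, rfl⟩ := exists_dart d
  rw [ht_dart] at h0
  rw [ht_flip_dart]
  cases d with
  | up k i a => exact Nat.succ_ne_zero k
  | down k i a => exact absurd h0 (Nat.succ_ne_zero k)
  | right k i => exact absurd h0 hd.1.ne'
  | left k i => exact absurd h0 hd.1.ne'

theorem cycleAt {k : ℕ} (h0 : 0 < k) (hk : C.Below k) : C.toRootedMap.CycleAt k := by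
  have hn := C.pos k
  have : NeZero (C.n k) := ⟨hn.ne'⟩
  refine ⟨C.n k, hn, fun i => C.dart (right k i.val) ⟨h0, hk, ZMod.val_lt i⟩, ⟨?_, ?_, ?_⟩, ?_,
    ⟨?_, ?_, ?_⟩⟩
  · intro i _
    exact ht_eq (C.dart _ _)
  · intro i _ j _ hij
    exact ZMod.val_injective _ (idx_eq_of_sameCycle (RootedMap.vert_eq_iff.1 hij))
  · intro v hv
    obtain ⟨⟨d, hd⟩, rfl⟩ := Quotient.exists_rep v
    have hl : level d = k := (ht_eq ⟨d, hd⟩).symm.trans hv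
    subst hl
    refine ⟨(C.idx d : ZMod (C.n (level d))), trivial, ?_⟩
    refine Eq.trans ?_ (RootedMap.vert_eq_iff.2 (sameCycle_right d hd h0 hk)).symm
    simp only [ZMod.val_cast_of_lt (idx_lt d hd)]
  · intro i
    refine RootedMap.vert_eq_iff.2 ((sameCycle_right (left k i.val) ⟨h0, hk, ZMod.val_lt i⟩ h0 hk).trans ?_)
    have : C.idx (left k i.val) = (i + 1).val := by
      have hi := ZMod.val_lt i
      have h1 : (i + 1).val = (i.val + 1) % C.n k := by
        rw [ZMod.val_add, ZMod.val_one_eq_one_mod, Nat.add_mod_mod]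
      rw [h1]
      simp only [idx, cycSucc]
      split_ifs with h
      · exact (Nat.mod_eq_of_lt h).symm
      · have : i.val + 1 = C.n k := by omega
        rw [this, Nat.mod_self]
    change C.toRootedMap.rot.SameCycle (C.dart (right k (C.idx (left k i.val))) _) _
    simp only [this]
    exact Equiv.Perm.SameCycle.refl _ _
  · intro i _
    exact ⟨_, rfl, ht_eq (C.dart _ _), ht_eq (C.toRootedMap.flip (C.dart _ _))⟩
  · intro i _ j _ hij
    rcases RootedMap.edge_eq_iff.1 hij with h | h
    · have := congrArg Subtype.val h
      simp only [dart, right.injEq, true_and] at this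
      exact (ZMod.val_injective _ this).symm
    · have := congrArg Subtype.val h
      exact absurd this (by rw [coe_flip]; simp [dart, flipFun])
  · rintro x ⟨d, rfl, h1, h2⟩
    obtain ⟨d, hd, rfl⟩ := exists_dart d
    rw [ht_dart] at h1
    rw [ht_flip_dart] at h2
    cases d with
    | up m i a => simp only [flipFun, level] at h1 h2; omega
    | down m i a => simp only [flipFun, level] at h1 h2; omega
    | right m i =>
      obtain rfl : m = k := h1
      refine ⟨(i : ZMod (C.n m)), trivial, ?_⟩
      simp only [ZMod.val_cast_of_lt hd.2.2]
    | left m i =>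
      obtain rfl : m = k := h1
      refine ⟨(i : ZMod (C.n m)), trivial, ?_⟩
      simp only [ZMod.val_cast_of_lt hd.2.2]
      exact RootedMap.edge_eq_iff.2 (Or.inr rfl)

/-! #### Planarity -/

open Classical in
/-- Extension of a cochain by zero. -/
noncomputable def extend (θ : C.toRootedMap.Dart → ℤ) (d : StripDart) : ℤ :=
  if h : C.Ok d then θ ⟨d, h⟩ else 0

theorem extend_of_ok {θ : C.toRootedMap.Dart → ℤ} {d : StripDart} (h : C.Ok d) :
    extend θ d = θ ⟨d, h⟩ := dif_pos h

/-- The potential of a closed cochain, obtained by summing it along the branches of the tree. -/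
noncomputable def potential (θ : C.toRootedMap.Dart → ℤ) : ℕ → ℕ → ℤ
  | 0, _ => 0
  | k + 1, j => potential θ k (parentIdx (C.c k) (C.n k) j) +
      extend θ (up k (parentIdx (C.c k) (C.n k) j) (siblingIdx (C.c k) (C.n k) j))

/-- The potential makes the cochain exact on tree edges by construction. The triangle above `right k
i` carries exactness from the first edge of the next vertex to the extra edge of the `i`-th, and the
triangle below a horizontal edge carries it from the two vertical sides to that edge. So exactness
climbs the tree strip by strip. -/
theorem planar : C.toRootedMap.Planar := by
  intro θ hflip hface
  have hf : ∀ d, C.Ok d → extend θ (flipFun d) = - extend θ d := fun d hd => by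
    rw [extend_of_ok hd, extend_of_ok (ok_flipFun d hd)]
    exact hflip ⟨d, hd⟩
  have htri : ∀ d, C.Ok d → ¬ C.IsExt d →
      extend θ d + extend θ (C.faceFun d) + extend θ (C.faceFun (C.faceFun d)) = 0 := by
    intro d hd he
    have := hface (C.dart d hd)
    rw [faceDegree_eq_three (d := C.dart d hd) he] at this
    simp only [Finset.sum_range_succ, Finset.sum_range_zero, zero_add, pow_zero, pow_one, pow_two]
      at this
    rw [extend_of_ok hd, extend_of_ok (ok_faceFun hd), extend_of_ok (ok_faceFun (ok_faceFun hd))]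
    exact this
  let P : StripDart → ℤ := fun d => potential θ (level d) (C.idx d)
  have hP : ∀ d, C.Ok d → P (C.rotFun d) = P d := fun d hd => by
    simp only [P, level_rotFun d hd, idx_rotFun d hd]
  -- Exactness on the upward edges from height `k`, given exactness on the horizontal edges at
  -- height `k`; the induction `hH` then passes to height `k + 1`.
  have hV : ∀ k, (∀ i, C.Ok (right k i) → extend θ (right k i) = P (left k i) - P (right k i)) →
      ∀ i < C.n k, ∀ a ≤ C.c k i, C.Ok (up k i a) →
        extend θ (up k i a) = P (down k i a) - P (up k i a) := by
    intro k hH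
    refine strip_induction (C.pos (k + 1)) _ ?_ ?_
    · intro i hi a ha h
      change _ = potential θ (k + 1) (C.idx (down k i a)) - potential θ k i
      rw [idx_down_of_lt hi ha, potential, parentIdx_childSum_add hi ha, siblingIdx_childSum_add hi ha]
      ring
    · intro i hi hs h
      have h0 : 0 < k := by have := h.2.2; omega
      have h' : C.Ok (up k (cycSucc (C.n k) i) 0) := ⟨h.1, cycSucc_lt hi, by omega⟩
      have hr : C.Ok (right k i) := ⟨h0, h.1, hi⟩
      have h1 := hs h'
      have h2 := hH i hr
      have h3 := htri _ hr id
      rw [faceFun_right, faceFun_up_zero h0, cycPred_cycSucc hi] at h3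
      have h4 := hf _ h
      simp only [flipFun] at h4
      have h5 : P (down k i (C.c k i)) = P (down k (cycSucc (C.n k) i) 0) := by
        simp only [P, level, idx_down_last hi]
      have h6 : P (up k (cycSucc (C.n k) i) 0) = P (left k i) := rfl
      have h7 : P (up k i (C.c k i)) = P (right k i) := rfl
      linarith
  have hH : ∀ k, ∀ i, C.Ok (right k i) →
      extend θ (right k i) = P (left k i) - P (right k i) := by
    intro k
    induction k with
    | zero => intro i h; exact absurd h.1 (lt_irrefl 0)
    | succ k ih =>
      intro j hj
      obtain ⟨k', i, a, hk', hi, ha, rfl⟩ := exists_cell hj.1 hj.2.2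
      obtain rfl : k = k' := by omega
      have ht : k + 1 ≠ C.top := by have := hj.2.1; unfold Below at this; omega
      have hl : C.Ok (left (k + 1) (childSum (C.c k) i + a)) := hj
      have h3 := htri _ hl id
      have e1 := faceFun_left hi ha
      have e2 := faceFun_down (C := C) ha
      have e3 := faceFun_nextUp hi ha ht
      have hd : C.Ok (down k i a) := by rw [← e1]; exact ok_faceFun hl
      have hu : C.Ok (C.nextUp k i a) := by rw [← e2]; exact ok_faceFun hd
      rw [e1, e2] at h3
      have h4 := hf _ hj
      simp only [flipFun] at h4
      have h5 := hf _ hd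
      simp only [flipFun] at h5
      have h6 := hV k ih i hi a ha.le hd
      have h7 : extend θ (C.nextUp k i a) = P (flipFun (C.nextUp k i a)) - P (C.nextUp k i a) := by
        unfold nextUp at hu ⊢
        split_ifs at hu ⊢ with h
        · exact hV 0 (by obtain ⟨rfl, -⟩ := h; exact ih) 0 one_pos 0 (Nat.zero_le _) hu
        · exact hV k ih i hi _ ha hu
      have h8 : P (left (k + 1) (childSum (C.c k) i + a)) = P (flipFun (C.nextUp k i a)) := by
        rw [← e3]; exact hP _ (ok_flipFun _ hu)
      have h9 : P (C.nextUp k i a) = P (up k i a) := by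
        rw [← e2]; exact hP _ hd
      have h10 : P (down k i a) = P (right (k + 1) (childSum (C.c k) i + a)) := by
        rw [← e1]; exact hP _ hj
      linarith
  let p : C.toRootedMap.Vertex → ℤ := Quotient.lift (fun d => P d.1) fun a b h =>
    RootedMap.eq_of_rot_invariant (G := C.toRootedMap) (ℓ := fun d => P d.1)
      (fun d => hP d.1 d.2) h
  have key : ∀ d, C.Ok d → extend θ d = P (flipFun d) - P d := by
    intro d hd
    cases d with
    | up k i a =>
      exact hV k (hH k) i hd.2.1 a (by have := hd.2.2; omega) hd
    | down k i a =>
      have := hV k (hH k) i hd.2.1 a (by have := hd.2.2; omega) hd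
      have h2 := hf _ hd
      simp only [flipFun] at h2 ⊢
      linarith
    | right k i => exact hH k i hd
    | left k i =>
      have := hH k i hd
      have h2 := hf _ hd
      simp only [flipFun] at h2 ⊢
      linarith
  refine ⟨p, fun d => ?_⟩
  exact (extend_of_ok (θ := θ) d.2).symm.trans (key d.1 d.2)

theorem isInfiniteCT (h : C.top = 0) : C.toRootedMap.IsInfiniteCT := by
  refine ⟨connected_and_ht_eq_level.1, locallyFinite, planar, noRootLoop, fun d => ?_,
    fun k hk => cycleAt hk (Or.inl h)⟩
  refine faceDegree_eq_three fun he => ?_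
  obtain ⟨d, hd⟩ := d
  cases d with
  | up k i a => have := he.1; omega
  | down k i a => have := he.1; omega
  | right k i => exact he
  | left k i => exact he

end LayerCode

namespace LayerCode

open StripDart

variable {C : LayerCode}

/-! #### The exterior face -/

theorem isExt_faceFun_of_isExt {d : StripDart} (h : C.IsExt d) : C.IsExt (C.faceFun d) := by
  have h2 := C.top_ne
  cases d with
  | up k i a =>
    obtain ⟨ht, rfl⟩ := h
    simp only [faceFun, flipFun, rotFun]
    rw [if_pos ht]
    exact ⟨ht, rfl⟩
  | down k i a =>
    obtain ⟨ht, rfl⟩ := h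
    have := C.top_eq k ht i
    rw [faceFun_down (by omega), nextUp, if_neg (by omega)]
    exact ⟨ht, rfl⟩
  | right k i => exact h.elim
  | left k i => exact h.elim

theorem isExt_faceFun {d : StripDart} (hd : C.Ok d) : C.IsExt (C.faceFun d) = C.IsExt d := by
  refine propext ⟨fun h => ?_, isExt_faceFun_of_isExt⟩
  -- A dart off the exterior face returns to itself after three steps, but the exterior face is
  -- never left once it is reached.
  by_contra he
  have := isExt_faceFun_of_isExt (isExt_faceFun_of_isExt h)
  rw [faceFun_faceFun_faceFun hd he] at this
  exact he this

theorem face_eq_iff {G : RootedMap} {a b : G.Dart} :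
    G.face a = G.face b ↔ G.facePerm.SameCycle a b := Quotient.eq

theorem isExt_eq_of_face_eq {a b : C.toRootedMap.Dart}
    (h : C.toRootedMap.face a = C.toRootedMap.face b) : C.IsExt a.1 = C.IsExt b.1 :=
  RootedMap.eq_of_invariant (σ := C.toRootedMap.facePerm) (ℓ := fun d => C.IsExt d.1)
    (fun d => isExt_faceFun d.2) (face_eq_iff.1 h)

theorem sameCycle_of_faceFun {d d' : StripDart} {h : C.Ok d} {h' : C.Ok d'}
    (e : C.faceFun d = d') : C.toRootedMap.facePerm.SameCycle (C.dart d h) (C.dart d' h') :=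
  ⟨1, by rw [zpow_one]; exact Subtype.ext e⟩

theorem ok_ext {k i a : ℕ} (ht : k + 1 = C.top) (hi : i < C.n k) (ha : a ≤ 1) :
    C.Ok (down k i a) := by
  have h1 := C.top_eq k ht i
  have h2 := C.top_ne
  exact ⟨Or.inr (by omega), hi, by omega⟩

/-- The boundary alternates between `down k i 0`, `up k i 1`, `down k (i + 1) 0` and so on, so all
exterior darts lie on a single face. -/
theorem face_ext {k : ℕ} (ht : k + 1 = C.top) : ∀ i (hi : i < C.n k),
    C.toRootedMap.facePerm.SameCycle (C.dart (down k 0 0) (ok_ext ht (C.pos k) zero_le_one))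
      (C.dart (down k i 0) (ok_ext ht hi zero_le_one)) ∧
    C.toRootedMap.facePerm.SameCycle (C.dart (down k 0 0) (ok_ext ht (C.pos k) zero_le_one))
      (C.dart (up k i 1) (ok_ext ht hi le_rfl)) := by
  have h2 := C.top_ne
  have hstep : ∀ i (hi : i < C.n k), C.toRootedMap.facePerm.SameCycle
      (C.dart (down k i 0) (ok_ext ht hi zero_le_one)) (C.dart (up k i 1) (ok_ext ht hi le_rfl)) := by
    intro i hi
    have h1 := C.top_eq k ht i
    refine sameCycle_of_faceFun ?_
    rw [faceFun_down (by omega), nextUp, if_neg (by omega)]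
  intro i
  induction i with
  | zero => exact fun hi => ⟨Equiv.Perm.SameCycle.refl _ _, hstep 0 hi⟩
  | succ i ih =>
    intro hi
    have hs := (ih (by omega)).2.trans (sameCycle_of_faceFun (d' := down k (i + 1) 0)
      (h' := ok_ext ht hi zero_le_one) (by
        simp only [faceFun, flipFun, rotFun]
        rw [if_pos ht, cycSucc, if_pos hi]))
    exact ⟨hs, hs.trans (hstep _ hi)⟩

theorem face_eq_ext_iff {k : ℕ} (ht : k + 1 = C.top) (d : C.toRootedMap.Dart) :
    C.toRootedMap.face d =
      C.toRootedMap.face (C.dart (down k 0 0) (ok_ext ht (C.pos k) zero_le_one)) ↔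
    C.IsExt d.1 := by
  constructor
  · intro h
    rw [isExt_eq_of_face_eq h]
    exact ⟨ht, rfl⟩
  · obtain ⟨d, hd, rfl⟩ := exists_dart d
    intro h
    refine (face_eq_iff.2 ?_).symm
    cases d with
    | up m i a =>
      obtain ⟨hm, rfl⟩ := h
      obtain rfl : m = k := by omega
      exact (face_ext ht i hd.2.1).2
    | down m i a =>
      obtain ⟨hm, rfl⟩ := h
      obtain rfl : m = k := by omega
      exact (face_ext ht i hd.2.1).1
    | right m i => exact h.elim
    | left m i => exact h.elim

theorem level_le (h0 : C.top ≠ 0) {d : StripDart} (hd : C.Ok d) : level d ≤ C.top := by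
  cases d with
  | up k i a => have := hd.1; unfold Below at this; simp only [level]; omega
  | down k i a => have := hd.1; unfold Below at this; simp only [level]; omega
  | right k i => have := hd.2.1; unfold Below at this; simp only [level]; omega
  | left k i => have := hd.2.1; unfold Below at this; simp only [level]; omega

theorem isFiniteCT (h0 : C.top ≠ 0) : C.toRootedMap.IsFiniteCT C.top := by
  have h1 := C.top_ne
  obtain ⟨k, ht⟩ : ∃ k, k + 1 = C.top := ⟨C.top - 1, by omega⟩
  refine ⟨by omega, connected_and_ht_eq_level.1, locallyFinite, planar, noRootLoop,
    fun d => by rw [ht_eq]; exact level_le h0 d.2, fun m hm hlt => cycleAt hm (Or.inr hlt),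
    C.toRootedMap.face (C.dart (down k 0 0) (ok_ext ht (C.pos k) zero_le_one)),
    fun d hd => faceDegree_eq_three fun h => hd ((face_eq_ext_iff ht d).2 h), ?_, ?_, ?_⟩
  · intro d hd
    rw [face_eq_ext_iff ht] at hd
    obtain ⟨d, hok, rfl⟩ := exists_dart d
    rw [ht_dart, ht_flip_dart]
    cases d with
    | up m i a =>
      have := hd.1
      right; simp only [level, flipFun]; omega
    | down m i a =>
      have := hd.1
      left; simp only [level, flipFun]; omega
    | right m i => exact hd.elim
    | left m i => exact hd.elim
  · intro d hd
    obtain ⟨d, hok, rfl⟩ := exists_dart d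
    rw [ht_dart] at hd
    rw [ht_flip_dart]
    cases d with
    | up m i a => have := hok.1; unfold Below at this; simp only [level] at hd; omega
    | right m i => have := hok.2.1; unfold Below at this; simp only [level] at hd; omega
    | left m i => have := hok.2.1; unfold Below at this; simp only [level] at hd; omega
    | down m i a =>
      obtain rfl : m = k := by simp only [level] at hd; omega
      have hc := fun i => C.top_eq m ht i
      have hi := hok.2.1
      have ha := hok.2.2
      rw [hc] at ha
      have e1 : ∀ i, C.rotFun (down m i 0) = down m (cycPred (C.n m) i) 1 := fun i => by
        simp only [rotFun]
        rw [if_neg (by omega), hc]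
      have e2 : ∀ i, C.rotFun (down m i 1) = down m (cycSucc (C.n m) i) 0 := fun i => by
        simp only [rotFun]
        rw [if_pos ht]
      rcases (show a = 0 ∨ a = 1 by omega) with rfl | rfl
      · rw [rot_dart (e1 i), rot_dart (e2 _)]
        refine ⟨fun h => ?_, ?_, by simp only [flipFun, level]; omega, ?_⟩
        · simpa [dart] using congrArg Subtype.val h
        · exact Subtype.ext (by simp only [dart, cycSucc_cycPred hi])
        · exact (iff_congr (face_eq_ext_iff ht _) (not_congr (face_eq_ext_iff ht _))).2
            ⟨fun _ h => one_ne_zero h.2, fun _ => ⟨ht, rfl⟩⟩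
      · rw [rot_dart (e2 i), rot_dart (e1 _)]
        refine ⟨fun h => ?_, ?_, by simp only [flipFun, level]; omega, ?_⟩
        · simpa [dart] using congrArg Subtype.val h
        · exact Subtype.ext (by simp only [dart, cycPred_cycSucc hi])
        · exact (iff_congr (face_eq_ext_iff ht _) (not_congr (face_eq_ext_iff ht _))).2
            ⟨fun h => absurd h.2 one_ne_zero, fun h => absurd ⟨ht, rfl⟩ h⟩
  -- The triangle on the side of `right` has its apex at height `top`; the one on the side of `left`
  -- has its third vertex one level below the edge.
  · have key : ∀ i (hr : C.Ok (right k i)),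
        C.toRootedMap.ht (C.toRootedMap.flip (C.toRootedMap.facePerm (C.dart (right k i) hr))) =
          C.top ∧
        C.toRootedMap.ht (C.toRootedMap.flip (C.toRootedMap.facePerm (C.dart (left k i) hr))) ≠
          C.top := by
      intro i hr
      obtain ⟨k', i', a, rfl, hi, ha, rfl⟩ := exists_cell hr.1 hr.2.2
      refine ⟨(ht_eq _).trans ht, fun h => ?_⟩
      rw [ht_eq, coe_flip, coe_facePerm] at h
      simp only [dart] at h
      rw [faceFun_left hi ha] at h
      simp only [flipFun, level] at h
      omega
    intro d hd hf
    obtain ⟨d, hok, rfl⟩ := exists_dart d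
    rw [ht_dart] at hd
    rw [ht_flip_dart] at hf
    cases d with
    | up m i a => simp only [flipFun, level] at hd hf; omega
    | down m i a => simp only [flipFun, level] at hd hf; omega
    | right m i =>
      obtain rfl : m = k := by simp only [level] at hd; omega
      refine ⟨_, ⟨Or.inl rfl, (key i hok).1⟩, ?_⟩
      rintro e ⟨rfl | rfl, he⟩
      · rfl
      · exact absurd he (key i hok).2
    | left m i =>
      obtain rfl : m = k := by simp only [level] at hd; omega
      refine ⟨_, ⟨Or.inr rfl, (key i hok).1⟩, ?_⟩
      rintro e ⟨rfl | rfl, he⟩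
      · exact absurd he (key i hok).2
      · rfl

theorem isCT : C.toRootedMap.IsCT := by
  by_cases h : C.top = 0
  · exact Or.inl (isInfiniteCT h)
  · exact Or.inr ⟨_, isFiniteCT h⟩

/-! #### The area -/

def IsHorizontal : StripDart → Prop
  | up _ _ _ => False
  | down _ _ _ => False
  | right _ _ => True
  | left _ _ => True

theorem not_isExt_of_isHorizontal {d : StripDart} (h : IsHorizontal d) : ¬ C.IsExt d := by
  cases d <;> first | exact id | exact h.elim

/-- Upward and downward darts alternate along the exterior face, so it is impossible to return there
after three steps. -/
theorem faceDegree_eq_three_iff {d : C.toRootedMap.Dart} :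
    C.toRootedMap.faceDegree d = 3 ↔ ¬ C.IsExt d.1 := by
  refine ⟨fun h he => ?_, faceDegree_eq_three⟩
  have h3 : C.faceFun (C.faceFun (C.faceFun d.1)) = d.1 := by
    have := Function.isPeriodicPt_minimalPeriod C.toRootedMap.facePerm d
    rw [show Function.minimalPeriod C.toRootedMap.facePerm d = 3 from h] at this
    exact congrArg Subtype.val this
  have h2 := C.top_ne
  obtain ⟨d, hok⟩ := d
  simp only at h3 he
  cases d with
  | up k i a =>
    obtain ⟨ht, rfl⟩ := he
    have hc := fun i => C.top_eq k ht i
    have e1 : ∀ i, C.faceFun (up k i 1) = down k (cycSucc (C.n k) i) 0 := fun i => by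
      simp only [faceFun, flipFun, rotFun]
      rw [if_pos ht]
    have e2 : ∀ i, C.faceFun (down k i 0) = up k i 1 := fun i => by
      rw [faceFun_down (by rw [hc]; exact one_pos), nextUp, if_neg (by omega)]
    rw [e1, e2, e1] at h3
    simp at h3
  | down k i a =>
    obtain ⟨ht, rfl⟩ := he
    have hc := fun i => C.top_eq k ht i
    have e1 : ∀ i, C.faceFun (up k i 1) = down k (cycSucc (C.n k) i) 0 := fun i => by
      simp only [faceFun, flipFun, rotFun]
      rw [if_pos ht]
    have e2 : ∀ i, C.faceFun (down k i 0) = up k i 1 := fun i => by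
      rw [faceFun_down (by rw [hc]; exact one_pos), nextUp, if_neg (by omega)]
    rw [e2, e1, e2] at h3
    simp at h3
  | right k i => exact he
  | left k i => exact he

theorem isHorizontal_face {d : StripDart} (h : IsHorizontal d) :
    ¬ IsHorizontal (C.faceFun d) ∧ (C.Ok d → ¬ IsHorizontal (C.faceFun (C.faceFun d))) := by
  cases d with
  | up k i a => exact h.elim
  | down k i a => exact h.elim
  | right k i =>
    refine ⟨id, fun hd => ?_⟩
    rw [faceFun_right, faceFun_up_zero hd.1]
    exact id
  | left k i =>
    refine ⟨id, fun hd => ?_⟩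
    obtain ⟨k', i', a, rfl, hi, ha, rfl⟩ := exists_cell hd.1 hd.2.2
    rw [faceFun_left hi ha, faceFun_down ha, nextUp]
    split_ifs <;> exact id

/-- The face permutation has order three at a horizontal dart, and the two other darts of the
triangle are vertical. -/
theorem eq_of_face_eq_of_isHorizontal {a b : C.toRootedMap.Dart} (ha : IsHorizontal a.1)
    (hb : IsHorizontal b.1) (h : C.toRootedMap.face a = C.toRootedMap.face b) : a = b := by
  obtain ⟨z, hz⟩ := face_eq_iff.1 h
  have h3 : (C.toRootedMap.facePerm ^ (3 : ℤ)) a = a :=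
    Subtype.ext (faceFun_faceFun_faceFun a.2 (not_isExt_of_isHorizontal ha))
  have hr : (C.toRootedMap.facePerm ^ (z % 3)) a = b := by
    rw [← hz]
    conv_rhs => rw [← Int.emod_add_mul_ediv z 3, zpow_add, zpow_mul, Equiv.Perm.mul_apply,
      Equiv.Perm.zpow_apply_eq_self_of_apply_eq_self h3]
  have hz0 := Int.emod_nonneg z (by norm_num : (3 : ℤ) ≠ 0)
  have hz3 := Int.emod_lt_of_pos z (by norm_num : (0 : ℤ) < 3)
  obtain ⟨h1, h2⟩ := isHorizontal_face (C := C) ha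
  rcases (show z % 3 = 0 ∨ z % 3 = 1 ∨ z % 3 = 2 by omega) with e | e | e <;> rw [e] at hr
  · exact hr
  · rw [← hr] at hb
    exact absurd hb h1
  · rw [← hr] at hb
    exact absurd hb (h2 a.2)

/-- Triangles correspond to horizontal darts, one each, and every vertex at a height from `1` to
`top - 1` contributes a pair `right`, `left`. -/
theorem area_eq (h0 : C.top ≠ 0) :
    C.toRootedMap.area = 2 * ∑ k ∈ Finset.Ico 1 C.top, C.n k := by
  let F := ((Finset.Ico 1 C.top).sigma fun k => Finset.range (C.n k)) ×ˢ (Finset.univ : Finset Bool)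
  let g : (Σ _ : ℕ, ℕ) × Bool → StripDart := fun p => bif p.2 then right p.1.1 p.1.2 else left p.1.1 p.1.2
  have hg : Function.Injective g := by
    rintro ⟨⟨k, i⟩, b⟩ ⟨⟨k', i'⟩, b'⟩ h
    cases b <;> cases b' <;> simp_all [g]
  have hS : {x : C.toRootedMap.Face | ∃ d, C.toRootedMap.face d = x ∧
      C.toRootedMap.faceDegree d = 3} =
      C.toRootedMap.face '' {d : C.toRootedMap.Dart | IsHorizontal d.1} := by
    ext x
    constructor
    · rintro ⟨d, rfl, hd⟩
      rw [faceDegree_eq_three_iff] at hd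
      obtain ⟨d, hok, rfl⟩ := exists_dart d
      rcases triangle_cases hok hd with ⟨k, i, h0, hk, hi, h⟩ | ⟨k, i, a, hk, hi, ha, ht, h⟩
      · have hr : C.Ok (right k i) := ⟨h0, hk, hi⟩
        refine ⟨C.dart _ hr, trivial, face_eq_iff.2 ?_⟩
        have e2 : C.faceFun (C.faceFun (right k i)) = down k i (C.c k i) := by
          rw [faceFun_right, faceFun_up_zero h0, cycPred_cycSucc hi]
        rcases h with rfl | rfl | rfl
        · exact ⟨0, rfl⟩
        · exact ⟨1, rfl⟩
        · exact ⟨2, Subtype.ext e2⟩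
      · have hr : C.Ok (left (k + 1) (childSum (C.c k) i + a)) :=
          ⟨by omega, hk, childSum_add_lt hi ha⟩
        refine ⟨C.dart _ hr, trivial, face_eq_iff.2 ?_⟩
        have e1 := faceFun_left hi ha
        have e2 : C.faceFun (C.faceFun (left (k + 1) (childSum (C.c k) i + a))) = C.nextUp k i a := by
          rw [e1, faceFun_down ha]
        rcases h with rfl | rfl | rfl
        · exact ⟨0, rfl⟩
        · exact ⟨1, Subtype.ext e1⟩
        · exact ⟨2, Subtype.ext e2⟩
    · rintro ⟨d, hd, rfl⟩
      exact ⟨d, rfl, faceDegree_eq_three (not_isExt_of_isHorizontal hd)⟩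
  have hT : Subtype.val '' {d : C.toRootedMap.Dart | IsHorizontal d.1} = g '' (F : Set _) := by
    ext d
    constructor
    · rintro ⟨⟨d, hok⟩, hd, rfl⟩
      cases d with
      | up k i a => exact hd.elim
      | down k i a => exact hd.elim
      | right k i =>
        refine ⟨⟨⟨k, i⟩, true⟩, ?_, rfl⟩
        obtain ⟨h1, h2, h3⟩ := hok
        simp [F]; unfold Below at h2; omega
      | left k i =>
        refine ⟨⟨⟨k, i⟩, false⟩, ?_, rfl⟩
        obtain ⟨h1, h2, h3⟩ := hok
        simp [F]; unfold Below at h2; omega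
    · rintro ⟨⟨⟨k, i⟩, b⟩, hp, rfl⟩
      simp [F] at hp
      have hok : C.Ok (right k i) := ⟨by omega, Or.inr (by omega), hp.2⟩
      cases b
      · exact ⟨C.dart (left k i) hok, trivial, rfl⟩
      · exact ⟨C.dart (right k i) hok, trivial, rfl⟩
  have hinj : Set.InjOn C.toRootedMap.face {d : C.toRootedMap.Dart | IsHorizontal d.1} :=
    fun a ha b hb h => eq_of_face_eq_of_isHorizontal ha hb h
  calc C.toRootedMap.area = (C.toRootedMap.face '' {d | IsHorizontal d.1}).ncard :=
        congrArg Set.ncard hS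
    _ = {d : C.toRootedMap.Dart | IsHorizontal d.1}.ncard := hinj.ncard_image
    _ = (Subtype.val '' {d : C.toRootedMap.Dart | IsHorizontal d.1}).ncard :=
        (Set.ncard_image_of_injective _ Subtype.val_injective).symm
    _ = 2 * ∑ k ∈ Finset.Ico 1 C.top, C.n k := by
        rw [hT, Set.ncard_image_of_injective _ hg, Set.ncard_coe_finset, Finset.card_product,
          Finset.card_sigma]
        simp [mul_comm]

end LayerCode

/-! ### The cyclic order at a vertex -/

namespace RootedMap

variable {G H : RootedMap}

theorem LocallyFinite.minimalPeriod_pos (hG : G.LocallyFinite) (d : G.Dart) :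
    0 < Function.minimalPeriod G.rot d := by
  have hmem : ∀ m : ℕ, (G.rot ^ m) d ∈ {e | G.vert e = G.vert d} := by
    intro m
    induction m with
    | zero => exact rfl
    | succ m ih =>
      rw [pow_succ', Equiv.Perm.mul_apply]
      exact (vert_rot _).trans ih
  obtain ⟨m, n, hmn, h⟩ := (hG (G.vert d)).exists_lt_map_eq_of_forall_mem hmem
  refine Function.IsPeriodicPt.minimalPeriod_pos (n := n - m) (by omega) ?_
  have : (G.rot ^ m) ((G.rot ^ (n - m)) d) = (G.rot ^ m) d := by
    rw [← Equiv.Perm.mul_apply, ← pow_add, Nat.add_sub_cancel' hmn.le, h]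
  have := (G.rot ^ m).injective this
  rwa [Equiv.Perm.iterate_eq_pow _ _ |>.symm] at this

theorem pow_mod_minimalPeriod (σ : Equiv.Perm G.Dart) (d : G.Dart) (n : ℕ) :
    (σ ^ (n % Function.minimalPeriod σ d)) d = (σ ^ n) d := by
  rw [← Equiv.Perm.iterate_eq_pow, ← Equiv.Perm.iterate_eq_pow,
    Function.iterate_mod_minimalPeriod_eq]

theorem pow_eq_pow_iff {σ : Equiv.Perm G.Dart} {d : G.Dart}
    (hp : 0 < Function.minimalPeriod σ d) (m n : ℕ) : (σ ^ m) d = (σ ^ n) d ↔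
      m % Function.minimalPeriod σ d = n % Function.minimalPeriod σ d := by
  rw [← pow_mod_minimalPeriod σ d m, ← pow_mod_minimalPeriod σ d n,
    ← Equiv.Perm.iterate_eq_pow, ← Equiv.Perm.iterate_eq_pow]
  exact Function.iterate_eq_iterate_iff_of_lt_minimalPeriod (Nat.mod_lt _ hp) (Nat.mod_lt _ hp)

theorem exists_pow_of_sameCycle {σ : Equiv.Perm G.Dart} {d e : G.Dart}
    (hp : 0 < Function.minimalPeriod σ d) (h : σ.SameCycle d e) :
    ∃ n < Function.minimalPeriod σ d, (σ ^ n) d = e := by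
  obtain ⟨z, rfl⟩ := h
  have hP : (σ ^ ((Function.minimalPeriod σ d : ℕ) : ℤ)) d = d := by
    rw [zpow_natCast, ← Equiv.Perm.iterate_eq_pow]
    exact Function.isPeriodicPt_minimalPeriod σ d
  have hz0 := Int.emod_nonneg z (by omega : (Function.minimalPeriod σ d : ℤ) ≠ 0)
  have hz3 := Int.emod_lt_of_pos z (by omega : (0 : ℤ) < Function.minimalPeriod σ d)
  refine ⟨(z % Function.minimalPeriod σ d).toNat, by omega, ?_⟩
  rw [← zpow_natCast, Int.toNat_of_nonneg hz0]
  conv_rhs => rw [← Int.emod_add_mul_ediv z (Function.minimalPeriod σ d), zpow_add, zpow_mul,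
      Equiv.Perm.mul_apply, Equiv.Perm.zpow_apply_eq_self_of_apply_eq_self hP]

theorem minimalPeriod_pow_apply {σ : Equiv.Perm G.Dart} {d : G.Dart}
    (hp : 0 < Function.minimalPeriod σ d) (n : ℕ) :
    Function.minimalPeriod σ ((σ ^ n) d) = Function.minimalPeriod σ d := by
  rw [← Equiv.Perm.iterate_eq_pow]
  exact Function.minimalPeriod_apply_iterate (Function.minimalPeriod_pos_iff_mem_periodicPts.1 hp) n

/-- The cyclic order in terms of the number of turns from a fixed dart. -/
theorem inOrder_pow_iff {d : G.Dart} {α β γ : ℕ} (hα : α < Function.minimalPeriod G.rot d)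
    (hβ : β < Function.minimalPeriod G.rot d) (hγ : γ < Function.minimalPeriod G.rot d) :
    G.InOrder ((G.rot ^ α) d) ((G.rot ^ β) d) ((G.rot ^ γ) d) ↔
      (α ≤ β ∧ β ≤ γ) ∨ (β ≤ γ ∧ γ < α) ∨ (γ < α ∧ α ≤ β) := by
  have hp : 0 < Function.minimalPeriod G.rot d := by omega
  unfold InOrder
  simp only [minimalPeriod_pow_apply hp, ← Equiv.Perm.mul_apply, ← pow_add, pow_eq_pow_iff hp]
  generalize Function.minimalPeriod G.rot d = P at *
  have key : ∀ m δ, m < P → δ < P → ((m + α) % P = δ % P ↔ m + α = δ ∨ m + α = δ + P) := by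
    intro m δ hm hδ
    rw [Nat.mod_eq_of_lt hδ]
    rcases lt_or_ge (m + α) P with h | h
    · rw [Nat.mod_eq_of_lt h]; omega
    · rw [Nat.mod_eq_sub_mod h, Nat.mod_eq_of_lt (by omega)]; omega
  constructor
  · rintro ⟨m, n, hmn, hn, h1, h2⟩
    rw [key _ _ (by omega) hβ] at h1
    rw [key _ _ hn hγ] at h2
    omega
  · intro h
    -- The numbers of turns leading from `α` to `β` and to `γ`, reduced modulo the period `P`.
    refine ⟨if α ≤ β then β - α else β + P - α, if α ≤ γ then γ - α else γ + P - α, ?_, ?_, ?_, ?_⟩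
    · split_ifs <;> omega
    · split_ifs <;> omega
    · rw [key _ _ (by split_ifs <;> omega) hβ]; split_ifs <;> omega
    · rw [key _ _ (by split_ifs <;> omega) hγ]; split_ifs <;> omega

theorem InOrder.sameCycle {a b c : G.Dart} (h : G.InOrder a b c) :
    G.rot.SameCycle a b ∧ G.rot.SameCycle a c := by
  obtain ⟨m, n, -, -, rfl, rfl⟩ := h
  exact ⟨⟨m, by simp⟩, ⟨n, by simp⟩⟩

theorem inOrder_self_iff (hG : G.LocallyFinite) {a c : G.Dart} :
    G.InOrder a c c ↔ G.rot.SameCycle a c := by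
  refine ⟨fun h => h.sameCycle.1, fun h => ?_⟩
  obtain ⟨n, hn, rfl⟩ := exists_pow_of_sameCycle (hG.minimalPeriod_pos a) h
  exact ⟨n, n, le_rfl, hn, rfl, rfl⟩

/-- The rotation can be recovered from the cyclic order. -/
theorem eq_rot_iff (hG : G.LocallyFinite) {a b : G.Dart} : b = G.rot a ↔
    G.InOrder a b b ∧ (∀ c, G.InOrder a c c → c ≠ a → G.InOrder a b c) ∧
      (b = a → ∀ c, G.InOrder a c c → c = a) := by
  have hp := hG.minimalPeriod_pos a
  have h1 : (G.rot ^ 1) a = G.rot a := by rw [pow_one]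
  constructor
  · rintro rfl
    refine ⟨(inOrder_self_iff hG).2 ⟨1, rfl⟩, ?_, ?_⟩
    · rintro c ⟨n, n', hnn, hn, rfl, -⟩ hc
      have h0 : n ≠ 0 := fun h => hc (by rw [h]; rfl)
      exact ⟨1, n, by omega, by omega, h1, rfl⟩
    · rintro h c ⟨n, n', hnn, hn, rfl, -⟩
      have : Function.minimalPeriod G.rot a = 1 :=
        Function.minimalPeriod_eq_one_iff_isFixedPt.2 h
      obtain rfl : n = 0 := by omega
      rfl
  · rintro ⟨⟨m, m₁, hmm, hm, hb, -⟩, h2, h3⟩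
    by_cases hP : Function.minimalPeriod G.rot a = 1
    · have : G.rot a = a := Function.minimalPeriod_eq_one_iff_isFixedPt.1 hP
      obtain rfl : m = 0 := by omega
      rw [this, ← hb]; rfl
    · have hne : G.rot a ≠ a := fun h => hP (Function.minimalPeriod_eq_one_iff_isFixedPt.2 h)
      have hself := (inOrder_self_iff hG).2 (⟨1, rfl⟩ : G.rot.SameCycle a (G.rot a))
      obtain ⟨m', n', hmn, hn', hb', hc⟩ := h2 _ hself hne
      rw [← h1, pow_eq_pow_iff hp, Nat.mod_eq_of_lt hn', Nat.mod_eq_of_lt (by omega)] at hc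
      have : m' ≠ 0 := by
        rintro rfl
        exact hne (h3 hb'.symm _ hself)
      obtain rfl : m' = 1 := by omega
      rw [← hb', h1]

/-! ### Isomorphisms and balls -/

theorem sameCycle_map {α β : Type*} {σ : Equiv.Perm α} {τ : Equiv.Perm β} {f : α → β}
    (hf : ∀ d, f (σ d) = τ (f d)) {a b : α} (h : σ.SameCycle a b) : τ.SameCycle (f a) (f b) := by
  have := eq_of_invariant (ℓ := fun b => τ.SameCycle (f a) (f b)) (fun d => by
    rw [hf, Equiv.Perm.sameCycle_apply_right]) h
  exact this.mp (Equiv.Perm.SameCycle.refl _ _)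

theorem map_pow {α β : Type*} {σ : Equiv.Perm α} {τ : Equiv.Perm β} {f : α → β}
    (hf : ∀ d, f (σ d) = τ (f d)) (n : ℕ) (a : α) : f ((σ ^ n) a) = (τ ^ n) (f a) := by
  induction n generalizing a with
  | zero => rfl
  | succ n ih => rw [pow_succ, pow_succ, Equiv.Perm.mul_apply, Equiv.Perm.mul_apply, ih, hf]

theorem minimalPeriod_map {α β : Type*} {σ : Equiv.Perm α} {τ : Equiv.Perm β} {f : α → β}
    (hf : ∀ d, f (σ d) = τ (f d)) (hi : Function.Injective f) (a : α) :
    Function.minimalPeriod σ a = Function.minimalPeriod τ (f a) := by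
  refine Function.minimalPeriod_eq_minimalPeriod_iff.2 fun n => ?_
  unfold Function.IsPeriodicPt Function.IsFixedPt
  rw [Equiv.Perm.iterate_eq_pow, Equiv.Perm.iterate_eq_pow, ← map_pow hf, hi.eq_iff]

theorem Iso.symm (h : Iso G H) : Iso H G := by
  obtain ⟨f, h1, h2, h3⟩ := h
  refine ⟨f.symm, by rw [← h1]; simp, fun d => ?_, fun d => ?_⟩
  · apply f.injective; simp [h2]
  · apply f.injective; simp [h3]

theorem ht_map (hG : G.graph.Connected) (f : G.Dart ≃ H.Dart) (h1 : f G.root = H.root)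
    (h2 : ∀ d, f (G.rot d) = H.rot (f d)) (h3 : ∀ d, f (G.flip d) = H.flip (f d)) :
    H.graph.Connected ∧ ∀ d, H.ht (f d) = G.ht d := by
  have h2' : ∀ d, f.symm (H.rot d) = G.rot (f.symm d) := fun d => by apply f.injective; simp [h2]
  have h3' : ∀ d, f.symm (H.flip d) = G.flip (f.symm d) := fun d => by apply f.injective; simp [h3]
  have key := connected_and_ht_eq (G := H) (fun d => G.ht (f.symm d))
    (fun d => by rw [h2', ht_rot]) (fun d => by rw [h3']; exact ht_flip_le hG _)
    (fun d => by
      rw [ht_eq_zero_iff hG]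
      constructor
      · intro h
        have := sameCycle_map h2 h
        rwa [h1, Equiv.apply_symm_apply] at this
      · intro h
        have := sameCycle_map h2' h
        rwa [← h1, Equiv.symm_apply_apply] at this)
    (fun d hd => by
      obtain ⟨e, he, hlt⟩ := exists_lower hG _ hd
      refine ⟨f e, ?_, ?_⟩
      · have := sameCycle_map h2 he
        rwa [Equiv.apply_symm_apply] at this
      · rw [h3', Equiv.symm_apply_apply]; omega)
  exact ⟨key.1, fun d => by rw [key.2, Equiv.symm_apply_apply]⟩

theorem Iso.sameBall (hG : G.graph.Connected) (h : Iso G H) (R : ℕ) : SameBall R G H := by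
  obtain ⟨f, h1, h2, h3⟩ := h
  have hh := (ht_map hG f h1 h2 h3).2
  have hmem : ∀ d, d ∈ G.ballDarts R ↔ f d ∈ H.ballDarts R := fun d => by
    simp only [ballDarts, Set.mem_ofPred_eq, ← h3, hh]
  refine ⟨f.subtypeEquiv hmem, fun a b => ?_, fun a b c => ?_, fun a => ?_, fun a => ?_⟩
  · simp [← h3]
  · simp only [Equiv.subtypeEquiv_apply, InOrder, ← minimalPeriod_map h2 f.injective,
      ← map_pow h2, f.injective.eq_iff]
  · simp [← h1]
  · simp [hh]

theorem Iso.area_eq (h : Iso G H) : G.area = H.area := by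
  obtain ⟨f, h1, h2, h3⟩ := h
  have h4 : ∀ d, f (G.facePerm d) = H.facePerm (f d) := fun d => by
    rw [facePerm_apply, facePerm_apply, h2, h3]
  have h4' : ∀ d, f.symm (H.facePerm d) = G.facePerm (f.symm d) := fun d => by
    apply f.injective; simp [h4]
  let φ : G.Face → H.Face := Quotient.map f fun a b h => sameCycle_map h4 h
  have hφ : ∀ d, φ (G.face d) = H.face (f d) := fun d => rfl
  have hinj : Function.Injective φ := by
    intro x y
    obtain ⟨a, rfl⟩ := Quotient.exists_rep x
    obtain ⟨b, rfl⟩ := Quotient.exists_rep y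
    intro h
    have h' := sameCycle_map h4' (LayerCode.face_eq_iff.1 h)
    rw [Equiv.symm_apply_apply, Equiv.symm_apply_apply] at h'
    exact LayerCode.face_eq_iff.2 h'
  unfold area
  rw [← Set.ncard_image_of_injective _ hinj]
  congr 1
  ext x
  constructor
  · rintro ⟨_, ⟨d, rfl, hd⟩, rfl⟩
    exact ⟨f d, rfl, (minimalPeriod_map h4 f.injective d).symm.trans hd⟩
  · rintro ⟨d, rfl, hd⟩
    refine ⟨G.face (f.symm d), ⟨f.symm d, rfl, ?_⟩, ?_⟩
    · exact (minimalPeriod_map h4 f.injective _).trans (by rwa [Equiv.apply_symm_apply])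
    · rw [hφ, Equiv.apply_symm_apply]

theorem SameBall.ballSize_eq {R : ℕ} (h : SameBall R G H) : G.ballSize R = H.ballSize R := by
  obtain ⟨f, h1, -, -, -⟩ := h
  have hfl : ∀ (J : RootedMap) (a : J.ballDarts R), J.flip a ∈ J.ballDarts R :=
    fun J a => ⟨a.2.2, by rw [J.flip_flip]; exact a.2.1⟩
  have hflip : ∀ a : G.ballDarts R, H.flip (f a) = f ⟨G.flip a, hfl G a⟩ := fun a =>
    (h1 a ⟨G.flip a, hfl G a⟩).1 rfl
  have hedge : ∀ a b : G.ballDarts R, G.edge a = G.edge b ↔ H.edge (f a) = H.edge (f b) := by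
    intro a b
    rw [edge_eq_iff, edge_eq_iff, hflip]
    refine or_congr ?_ ?_
    · rw [Subtype.coe_inj, Subtype.coe_inj, f.injective.eq_iff]
    · rw [Subtype.coe_inj, f.injective.eq_iff, Subtype.ext_iff]
  have hsec : ∀ x : G.edge '' G.ballDarts R, ∃ a : G.ballDarts R, G.edge a = x := by
    rintro ⟨_, a, ha, rfl⟩
    exact ⟨⟨a, ha⟩, rfl⟩
  choose s hs using hsec
  unfold ballSize
  refine Set.ncard_congr (fun x hx => H.edge (f (s ⟨x, hx⟩))) ?_ ?_ ?_
  · intro x hx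
    exact ⟨_, (f _).2, rfl⟩
  · intro x y hx hy h
    have := (hedge _ _).2 h
    rwa [hs, hs] at this
  · rintro _ ⟨b, hb, rfl⟩
    refine ⟨G.edge (f.symm ⟨b, hb⟩), ⟨_, (f.symm ⟨b, hb⟩).2, rfl⟩, ?_⟩
    have := (hedge _ _).1 (hs ⟨G.edge (f.symm ⟨b, hb⟩), ⟨_, (f.symm ⟨b, hb⟩).2, rfl⟩⟩)
    rw [this, Equiv.apply_symm_apply]

/-- The ball of radius `R` reaches the height `R`. -/
def ReachesHeight (G : RootedMap) (R : ℕ) : Prop := ∃ d ∈ G.ballDarts R, G.ht d = R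

theorem SameBall.reachesHeight {R : ℕ} (h : SameBall R G H) (hG : G.ReachesHeight R) :
    H.ReachesHeight R := by
  obtain ⟨f, -, -, -, h4⟩ := h
  obtain ⟨d, hd, hR⟩ := hG
  exact ⟨f ⟨d, hd⟩, (f ⟨d, hd⟩).2, (h4 ⟨d, hd⟩).symm.trans hR⟩

theorem exists_ht_eq (hc : G.graph.Connected) {m : ℕ} (hm : 0 < m) (d : G.Dart) (hd : m ≤ G.ht d) :
    ∃ e, G.ht e = m ∧ G.ht (G.flip e) + 1 = m := by
  induction hn : G.ht d using Nat.strong_induction_on generalizing d with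
  | _ n ih =>
    obtain ⟨e, he, hlt⟩ := exists_lower hc d (by omega)
    rcases hd.lt_or_eq with h | h
    · exact ih _ (by omega) (G.flip e) (by omega) rfl
    · exact ⟨e, by rw [h]; exact (ht_eq_of_vert_eq (vert_eq_iff.2 he)).symm, by omega⟩

theorem reachesHeight_of_le (hc : G.graph.Connected) {R : ℕ} (hR : 0 < R) (d : G.Dart)
    (hd : R ≤ G.ht d) : G.ReachesHeight R := by
  obtain ⟨e, he, hf⟩ := exists_ht_eq hc hR d hd
  exact ⟨e, ⟨he.le, by omega⟩, he⟩

theorem IsInfiniteCT.reachesHeight (hG : G.IsInfiniteCT) {R : ℕ} (hR : 0 < R) :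
    G.ReachesHeight R := by
  obtain ⟨n, hn, e, h1, -, h3⟩ := hG.2.2.2.2.2 R hR
  obtain ⟨d, hd, h4, h5⟩ := h3.1 (Set.mem_univ 0)
  exact ⟨d, ⟨h4.le, h5.le⟩, h4⟩

theorem IsFiniteCT.not_reachesHeight {K R : ℕ} (hG : G.IsFiniteCT K) (hR : K < R) :
    ¬ G.ReachesHeight R := by
  rintro ⟨d, -, h⟩
  have := hG.2.2.2.2.2.1 d
  omega

theorem IsCT.connected (hG : G.IsCT) : G.graph.Connected := by
  rcases hG with h | ⟨K, h⟩
  · exact h.1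
  · exact h.2.1

theorem IsCT.locallyFinite (hG : G.IsCT) : G.LocallyFinite := by
  rcases hG with h | ⟨K, h⟩
  · exact h.2.1
  · exact h.2.2.1

/-- An infinite triangulation has a cycle at every positive height, a finite one has nothing above
its own height. In this form infiniteness is a condition on balls, which makes it measurable. -/
theorem IsCT.isInfiniteCT_iff (hG : G.IsCT) : G.IsInfiniteCT ↔ ∀ R, 0 < R → G.ReachesHeight R := by
  refine ⟨fun h R hR => h.reachesHeight hR, fun h => ?_⟩
  rcases hG with hG | ⟨K, hG⟩
  · exact hG
  · exact absurd (h (K + 1) (by omega)) (hG.not_reachesHeight (Nat.lt_succ_self K))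

/-- A map is determined by a ball which does not reach its own radius. -/
theorem SameBall.iso {R : ℕ} (h : SameBall R G H) (hR : 0 < R) (hG : G.graph.Connected)
    (hH : H.graph.Connected) (hG' : G.LocallyFinite) (hH' : H.LocallyFinite)
    (hr : ¬ G.ReachesHeight R) : Iso G H := by
  -- A dart of height at least `R` would yield, on the way down to the root, an edge between the
  -- heights `R` and `R - 1`, which belongs to the ball. So the ball is the whole map, and
  -- `eq_rot_iff` recovers its rotation from the cyclic order.
  have all : ∀ (J : RootedMap), J.graph.Connected → ¬ J.ReachesHeight R → ∀ d, d ∈ J.ballDarts R := by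
    intro J hJ hJr
    have : ∀ d, J.ht d < R := fun d => by
      by_contra hd
      exact hJr (reachesHeight_of_le hJ hR d (not_lt.1 hd))
    exact fun d => ⟨(this _).le, (this _).le⟩
  have hrH : ¬ H.ReachesHeight R := fun hh => hr (h.symm.reachesHeight hh)
  have hGall := all G hG hr
  have hHall := all H hH hrH
  obtain ⟨f, h1, h2, h3, -⟩ := h
  let φ : G.Dart ≃ H.Dart :=
    ((Equiv.subtypeUnivEquiv hGall).symm.trans f).trans (Equiv.subtypeUnivEquiv hHall)
  have hφ : ∀ d, φ d = f ⟨d, hGall d⟩ := fun d => rfl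
  have hin : ∀ a b c, G.InOrder a b c ↔ H.InOrder (φ a) (φ b) (φ c) := fun a b c =>
    h2 ⟨a, hGall a⟩ ⟨b, hGall b⟩ ⟨c, hGall c⟩
  refine ⟨φ, (h3 ⟨G.root, hGall _⟩).1 rfl, fun d => ?_, fun d => ?_⟩
  · rw [eq_rot_iff hH']
    obtain ⟨k1, k2, k3⟩ := (eq_rot_iff hG' (a := d)).1 rfl
    refine ⟨(hin _ _ _).1 k1, fun c hc hne => ?_, fun he c hc => ?_⟩
    · obtain ⟨c, rfl⟩ := φ.surjective c
      exact (hin _ _ _).1 (k2 c ((hin _ _ _).2 hc) fun h => hne (congrArg φ h))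
    · obtain ⟨c, rfl⟩ := φ.surjective c
      exact congrArg φ (k3 (φ.injective he) c ((hin _ _ _).2 hc))
  · exact ((h1 ⟨d, hGall d⟩ ⟨G.flip d, hGall _⟩).1 rfl).symm

end RootedMap

/-! ### Balls are determined by the lowest levels of the tree -/

namespace LayerCode

open StripDart

variable {C D : LayerCode} {R : ℕ}

/-- The trees agree below height `R`, and none of them is cut there. -/
def Agree (R : ℕ) (C D : LayerCode) : Prop :=
  (∀ k < R, ∀ i < C.n k, C.c k i = D.c k i) ∧ C.Below R ∧ D.Below R

theorem Agree.n_eq (h : Agree R C D) {k : ℕ} (hk : k ≤ R) : C.n k = D.n k :=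
  levelSize_congr h.1 k hk

theorem Agree.symm (h : Agree R C D) : Agree R D C :=
  ⟨fun k hk i hi => (h.1 k hk i (by rwa [h.n_eq hk.le])).symm, h.2.2, h.2.1⟩

def InBall (R : ℕ) (d : StripDart) : Prop := level d ≤ R ∧ level (flipFun d) ≤ R

theorem Agree.ok (h : Agree R C D) {d : StripDart} (hd : InBall R d) (hok : C.Ok d) : D.Ok d := by
  have hb : ∀ k ≤ R, D.Below k := fun k hk => by have := h.2.2; unfold Below at *; omega
  obtain ⟨h1, h2⟩ := hd
  cases d with
  | up k i a =>
    simp only [level, flipFun] at h1 h2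
    refine ⟨hb k h1, by rw [← h.n_eq h1]; exact hok.2.1, ?_⟩
    rw [← h.1 k h2 i hok.2.1]; exact hok.2.2
  | down k i a =>
    simp only [level, flipFun] at h1 h2
    refine ⟨hb k h2, by rw [← h.n_eq h2]; exact hok.2.1, ?_⟩
    rw [← h.1 k h1 i hok.2.1]; exact hok.2.2
  | right k i => exact ⟨hok.1, hb k h1, (h.n_eq (k := k) h1) ▸ hok.2.2⟩
  | left k i => exact ⟨hok.1, hb k h1, (h.n_eq (k := k) h1) ▸ hok.2.2⟩

theorem Agree.idx_eq (h : Agree R C D) {d : StripDart} (hd : InBall R d) (hok : C.Ok d) :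
    C.idx d = D.idx d := by
  obtain ⟨h1, h2⟩ := hd
  cases d with
  | up k i a => rfl
  | down k i a =>
    simp only [level, flipFun] at h1 h2
    simp only [idx, h.n_eq h1, childSum_congr (h.1 k h1) hok.2.1.le]
  | right k i => rfl
  | left k i =>
    simp only [level] at h1
    simp only [idx, h.n_eq h1]

theorem Agree.rotFun_eq (h : Agree R C D) {d : StripDart} (hd : InBall R d) (hok : C.Ok d)
    (hl : ∀ i, d ≠ left R i) : C.rotFun d = D.rotFun d := by
  obtain ⟨h1, h2⟩ := hd
  cases d with
  | up k i a =>
    simp only [level, flipFun] at h1 h2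
    simp only [rotFun, h.1 k h2 i hok.2.1, h.1 0 (by omega) 0 one_pos]
  | down k i a =>
    simp only [level, flipFun] at h1 h2
    cases a with
    | zero =>
      simp only [rotFun, h.1 0 (by omega) 0 one_pos, ← h.n_eq h2,
        h.1 k h1 _ (cycPred_lt hok.2.1)]
    | succ a =>
      have hC := h.2.1
      have hD := h.2.2
      unfold Below at hC hD
      simp only [rotFun]
      rw [if_neg (by omega), if_neg (by omega), childSum_congr (h.1 k h1) hok.2.1.le]
  | right k i =>
    simp only [level] at h1
    have hk := hok.1
    have := parentIdx_congr (h.1 (k - 1) (by omega)) (lt_childSum_of_ok hk hok.2.2)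
    simp only [rotFun, ← h.n_eq (k := k - 1) (by omega), this]
  | left k i =>
    simp only [level] at h1
    simp only [rotFun, h.n_eq h1]

/-- At a vertex of height `R` the darts of the ball are `right`, the downward darts and `left`; they
are consecutive, and the upward darts leave the ball. So the ball is entered at `right R i` only. -/
theorem inBall_of_rotFun {d : StripDart} (hok : C.Ok d) (hd : InBall R (C.rotFun d))
    (hr : ∀ i, C.rotFun d ≠ right R i) : InBall R d ∧ ∀ i, d ≠ left R i := by
  have hlev := level_rotFun d hok
  obtain ⟨h1, h2⟩ := hd
  rw [hlev] at h1
  cases d with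
  | up k i a =>
    refine ⟨⟨h1, ?_⟩, by simp⟩
    simp only [level, flipFun, rotFun] at *
    split_ifs at * with h3 h4
    · obtain ⟨rfl, -⟩ := h4; exact h2
    · exact h2
    · have : k ≠ R := fun e => hr i (by rw [e])
      omega
  | down k i a =>
    simp only [level] at h1
    exact ⟨⟨h1, by simp only [level, flipFun]; omega⟩, by simp⟩
  | right k i => exact ⟨⟨h1, h1⟩, by simp⟩
  | left k i =>
    refine ⟨⟨h1, h1⟩, fun j hj => ?_⟩
    simp only [left.injEq] at hj
    simp only [rotFun, flipFun, level] at h2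
    omega

variable (C) in
/-- The distinguished dart at the initial vertex of `d`. -/
def base (d : StripDart) : StripDart :=
  if level d = 0 then up 0 0 0 else right (level d) (C.idx d)

theorem ok_base (hR : C.Below R) {d : StripDart} (hok : C.Ok d) (hd : level d ≤ R) :
    C.Ok (C.base d) := by
  unfold base
  split_ifs with h
  · exact ⟨below_zero, one_pos, Or.inl c_zero_pos⟩
  · exact ⟨by omega, by unfold Below at *; omega, idx_lt d hok⟩

theorem sameCycle_base (hR : C.Below R) {d : StripDart} (hok : C.Ok d) (hd : level d ≤ R) :
    C.toRootedMap.rot.SameCycle (C.dart (C.base d) (ok_base hR hok hd)) (C.dart d hok) := by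
  by_cases h : level d = 0
  · have h1 : C.toRootedMap.ht (C.dart d hok) = 0 := (ht_dart hok).trans h
    have h2 := (RootedMap.ht_eq_zero_iff connected_and_ht_eq_level.1 _).1 h1
    have h3 : C.dart (C.base d) (ok_base hR hok hd) = C.toRootedMap.root := Subtype.ext (if_pos h)
    rwa [h3]
  · have h1 := sameCycle_right d hok (by omega) (by unfold Below at *; omega)
    have h3 : C.dart (C.base d) (ok_base hR hok hd) = C.dart (right (level d) (C.idx d))
      ⟨by omega, by unfold Below at *; omega, idx_lt d hok⟩ := Subtype.ext (if_neg h)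
    rw [h3]
    exact h1.symm

theorem Agree.base_eq (h : Agree R C D) {d : StripDart} (hd : InBall R d) (hok : C.Ok d) :
    C.base d = D.base d := by
  unfold base; rw [h.idx_eq hd hok]

/-- The base dart opens the arc of ball darts at its vertex. All darts between it and a dart of the
ball therefore lie in the ball, where the two rotations coincide. -/
theorem Agree.pow_eq (h : Agree R C D) {d : StripDart} (hok : C.Ok d) (hokD : D.Ok d)
    (hd : d = up 0 0 0 ∨ ∃ k i, d = right k i) : ∀ m,
    m < Function.minimalPeriod C.toRootedMap.rot (C.dart d hok) →
    InBall R ((C.toRootedMap.rot ^ m) (C.dart d hok)).1 → ∀ j ≤ m,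
      ((C.toRootedMap.rot ^ j) (C.dart d hok)).1 = ((D.toRootedMap.rot ^ j) (D.dart d hokD)).1 := by
  intro m
  induction m with
  | zero =>
    intro _ _ j hj
    obtain rfl : j = 0 := by omega
    rfl
  | succ m ih =>
    intro hm hb j hj
    have hs : ∀ (E : LayerCode) (e : E.toRootedMap.Dart),
        ((E.toRootedMap.rot ^ (m + 1)) e).1 = E.rotFun ((E.toRootedMap.rot ^ m) e).1 :=
      fun E e => by rw [pow_succ']; rfl
    set x := (C.toRootedMap.rot ^ m) (C.dart d hok) with hx
    rw [hs, ← hx] at hb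
    -- Height and position are constant around a vertex, so reaching a dart `right R i` would mean
    -- returning to the starting dart before the period is over.
    have hr : ∀ i, C.rotFun x.1 ≠ right R i := by
      intro i he
      have hsc : C.toRootedMap.rot.SameCycle (C.dart d hok)
          ((C.toRootedMap.rot ^ (m + 1)) (C.dart d hok)) := ⟨(m + 1 : ℕ), by rw [zpow_natCast]⟩
      have e1 := level_eq_of_sameCycle hsc
      have e2 := idx_eq_of_sameCycle hsc
      rw [hs, ← hx, he] at e1 e2
      have hR : 0 < R := by
        have := ok_rotFun x.1 x.2
        rw [he] at this
        exact this.1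
      rcases hd with rfl | ⟨k, i', rfl⟩
      · exact hR.ne e1
      · obtain rfl : k = R := e1
        obtain rfl : i' = i := e2
        have : (C.toRootedMap.rot ^ (m + 1)) (C.dart (right k i') hok) = C.dart (right k i') hok :=
          Subtype.ext (by rw [hs, ← hx, he]; rfl)
        rw [← Equiv.Perm.iterate_eq_pow] at this
        exact Function.not_isPeriodicPt_of_pos_of_lt_minimalPeriod (Nat.succ_ne_zero m) hm this
    obtain ⟨hbx, hl⟩ := inBall_of_rotFun x.2 hb hr
    have ihm := ih (by omega) hbx
    rcases hj.lt_or_eq with hlt | rfl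
    · exact ihm j (by omega)
    · rw [hs, hs, ← ihm m le_rfl, ← hx]
      exact h.rotFun_eq hbx x.2 hl

theorem Agree.exists_pow (h : Agree R C D) {d : StripDart} (hd : InBall R d) (hok : C.Ok d)
    (hokD : D.Ok d) : ∃ m,
      m < Function.minimalPeriod C.toRootedMap.rot (C.dart (C.base d) (ok_base h.2.1 hok hd.1)) ∧
      m < Function.minimalPeriod D.toRootedMap.rot (D.dart (D.base d) (ok_base h.2.2 hokD hd.1)) ∧
      (C.toRootedMap.rot ^ m) (C.dart (C.base d) (ok_base h.2.1 hok hd.1)) = C.dart d hok ∧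
      (D.toRootedMap.rot ^ m) (D.dart (D.base d) (ok_base h.2.2 hokD hd.1)) = D.dart d hokD := by
  have hbase := h.base_eq hd hok
  have hokb := ok_base h.2.2 hokD hd.1
  obtain ⟨m, hm, he⟩ := RootedMap.exists_pow_of_sameCycle
    (locallyFinite.minimalPeriod_pos _) (sameCycle_base h.2.1 hok hd.1)
  have hpow := h.pow_eq (ok_base h.2.1 hok hd.1) (hbase ▸ hokb) (by
    unfold base; split_ifs
    · exact Or.inl rfl
    · exact Or.inr ⟨_, _, rfl⟩) m hm (by rw [he]; exact hd)
  have hD : D.dart (C.base d) (hbase ▸ hokb) = D.dart (D.base d) hokb :=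
    Subtype.ext hbase
  rw [hD] at hpow
  refine ⟨m, hm, ?_, he, ?_⟩
  -- If the period in `D` were at most `m`, then the rotation of `C`, which agrees with that of `D`
  -- up to `m` steps, would also have returned to the base dart by then, before its own period.
  · by_contra hlt
    have hpos := locallyFinite.minimalPeriod_pos (D.dart (D.base d) hokb)
    have h1 := hpow _ (not_lt.1 hlt)
    rw [← Equiv.Perm.iterate_eq_pow, ← Equiv.Perm.iterate_eq_pow,
      Function.iterate_minimalPeriod] at h1
    have h2 := Function.IsPeriodicPt.minimalPeriod_le (f := C.toRootedMap.rot) hpos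
      (Subtype.ext (h1.trans hbase.symm) : Function.IsPeriodicPt C.toRootedMap.rot _ 
        (C.dart (C.base d) (ok_base h.2.1 hok hd.1)))
    omega
  · refine Subtype.ext ((hpow m le_rfl).symm.trans ?_)
    rw [he]; rfl

theorem inBall_iff (d : C.toRootedMap.Dart) : d ∈ C.toRootedMap.ballDarts R ↔ InBall R d.1 := by
  unfold RootedMap.ballDarts InBall
  rw [Set.mem_ofPred_eq, ht_eq, ht_eq]; rfl

theorem Agree.inOrder (h : Agree R C D) {a b c : StripDart} (ha : InBall R a) (hb : InBall R b)
    (hc : InBall R c) (oa : C.Ok a) (ob : C.Ok b) (oc : C.Ok c)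
    (hin : C.toRootedMap.InOrder (C.dart a oa) (C.dart b ob) (C.dart c oc)) :
    D.toRootedMap.InOrder (D.dart a (h.ok ha oa)) (D.dart b (h.ok hb ob))
      (D.dart c (h.ok hc oc)) := by
  obtain ⟨s1, s2⟩ := hin.sameCycle
  have e1 : C.base b = C.base a := by
    unfold base
    rw [show level b = level a from (level_eq_of_sameCycle s1).symm,
      show C.idx b = C.idx a from (idx_eq_of_sameCycle s1).symm]
  have e2 : C.base c = C.base a := by
    unfold base
    rw [show level c = level a from (level_eq_of_sameCycle s2).symm,
      show C.idx c = C.idx a from (idx_eq_of_sameCycle s2).symm]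
  have f1 : D.base b = D.base a := by rw [← h.base_eq ha oa, ← h.base_eq hb ob, e1]
  have f2 : D.base c = D.base a := by rw [← h.base_eq ha oa, ← h.base_eq hc oc, e2]
  obtain ⟨α, hα, hα', h1, h1'⟩ := h.exists_pow ha oa (h.ok ha oa)
  obtain ⟨β, hβ, hβ', h2, h2'⟩ := h.exists_pow hb ob (h.ok hb ob)
  obtain ⟨γ, hγ, hγ', h3, h3'⟩ := h.exists_pow hc oc (h.ok hc oc)
  simp only [e1] at hβ h2
  simp only [e2] at hγ h3
  simp only [f1] at hβ' h2'
  simp only [f2] at hγ' h3'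
  rw [← h1, ← h2, ← h3, RootedMap.inOrder_pow_iff hα hβ hγ] at hin
  rw [← h1', ← h2', ← h3', RootedMap.inOrder_pow_iff hα' hβ' hγ']
  exact hin

/-- The ball of radius `R` is determined by the tree below height `R`. -/
theorem Agree.sameBall (h : Agree R C D) : RootedMap.SameBall R C.toRootedMap D.toRootedMap := by
  let f : ∀ {C D : LayerCode}, Agree R C D → C.toRootedMap.ballDarts R →
    D.toRootedMap.ballDarts R := fun {C D} h d =>
      ⟨D.dart d.1.1 (h.ok ((inBall_iff d.1).1 d.2) d.1.2),
        (inBall_iff _).2 ((inBall_iff d.1).1 d.2 : InBall R d.1.1)⟩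
  refine ⟨⟨f h, f h.symm, fun _ => rfl, fun _ => rfl⟩, ?_, ?_, ?_, ?_⟩
  · rintro ⟨a, ha⟩ ⟨b, hb⟩
    exact ⟨fun he => Subtype.ext (congrArg Subtype.val he : flipFun a.1 = b.1),
      fun he => Subtype.ext (congrArg Subtype.val he : flipFun a.1 = b.1)⟩
  · rintro ⟨a, ha⟩ ⟨b, hb⟩ ⟨c, hc⟩
    rw [inBall_iff] at ha hb hc
    exact ⟨fun hin => h.inOrder ha hb hc _ _ _ hin, fun hin => h.symm.inOrder ha hb hc _ _ _ hin⟩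
  · rintro ⟨a, ha⟩
    exact ⟨fun he => Subtype.ext (congrArg Subtype.val he : a.1 = up 0 0 0),
      fun he => Subtype.ext (congrArg Subtype.val he : a.1 = up 0 0 0)⟩
  · rintro ⟨a, ha⟩
    exact (ht_eq a).trans (ht_eq (D.dart a.1 (h.ok ((inBall_iff a).1 ha) a.2))).symm

/-! #### The size of balls -/

/-- The number of vertices at distance between `1` and `R` from the root. -/
def volume (C : LayerCode) (R : ℕ) : ℕ := ∑ k ∈ Finset.Icc 1 R, C.n k

theorem finite_ballDarts (R : ℕ) : (C.toRootedMap.ballDarts R).Finite := by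
  refine ((Set.finite_Iic R).biUnion fun k _ => finite_level (C := C) k).subset fun d hd => ?_
  simp only [Set.mem_iUnion]
  exact ⟨level d.1, ((inBall_iff d).1 hd).1, rfl⟩

theorem volume_le_ballSize (hR : C.Below R) : C.volume R ≤ C.toRootedMap.ballSize R := by
  classical
  let F := (Finset.Icc 1 R).sigma fun k => Finset.range (C.n k)
  have hF : ∀ p : (Σ _ : ℕ, ℕ), p ∈ F → C.Ok (right p.1 p.2) := by
    intro p hp
    simp only [F, Finset.mem_sigma, Finset.mem_Icc, Finset.mem_range] at hp
    exact ⟨by omega, by unfold Below at *; omega, hp.2⟩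
  have hcard : C.volume R = F.card := by
    rw [Finset.card_sigma]
    simp [volume]
  rw [hcard, ← Set.ncard_coe_finset]
  unfold RootedMap.ballSize
  refine Set.ncard_le_ncard_of_injOn (t := C.toRootedMap.edge '' C.toRootedMap.ballDarts R)
    (fun p => if h : C.Ok (right p.1 p.2) then
    C.toRootedMap.edge (C.dart _ h) else C.toRootedMap.edge C.toRootedMap.root) ?_ ?_
    ((finite_ballDarts R).image _)
  · intro p hp
    simp only [dif_pos (hF p hp)]
    refine ⟨_, (inBall_iff _).2 ?_, rfl⟩
    simp only [F, Finset.mem_coe, Finset.mem_sigma, Finset.mem_Icc] at hp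
    exact ⟨hp.1.2, hp.1.2⟩
  · rintro ⟨k, i⟩ hp ⟨k', i'⟩ hq h
    simp only [dif_pos (hF _ hp), dif_pos (hF _ hq)] at h
    rcases RootedMap.edge_eq_iff.1 h with e | e
    · have := congrArg Subtype.val e
      simp only [dart, right.injEq] at this
      rw [this.1, this.2]
    · have := congrArg Subtype.val e
      exact absurd this (by rw [coe_flip]; simp [dart, flipFun])

/-- At most `n k + n (k + 1)` edges lead up from height `k` (one too many is allowed at the root).
Summed over `k < R` this is at most `1 + 2 * volume ≤ 3 * volume`, and there are `volume` horizontal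
edges. -/
theorem ballSize_le_volume (hR : 0 < R) : C.toRootedMap.ballSize R ≤ 4 * C.volume R := by
  classical
  let F := (Finset.Icc 1 R).sigma fun k => Finset.range (C.n k)
  let U := (Finset.range R).sigma fun k => (Finset.range (C.n k)).sigma fun i =>
    Finset.range (C.c k i + 1)
  let g : ((Σ _ : ℕ, ℕ) ⊕ (Σ _ : ℕ, Σ _ : ℕ, ℕ)) → StripDart :=
    Sum.elim (fun p => right p.1 p.2) (fun p => up p.1 p.2.1 p.2.2)
  let W : Set C.toRootedMap.Dart := {d | d.1 ∈ (F.disjSum U).image g}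
  have hsub : C.toRootedMap.edge '' C.toRootedMap.ballDarts R ⊆ C.toRootedMap.edge '' W := by
    rintro _ ⟨d, hd, rfl⟩
    rw [inBall_iff] at hd
    have hW : ∀ (d : StripDart) (h : C.Ok d), d ∈ (F.disjSum U).image g → C.dart d h ∈ W :=
      fun d h hd => hd
    obtain ⟨d, hok, rfl⟩ := exists_dart d
    obtain ⟨h1, h2⟩ := hd
    simp only [dart] at h1 h2
    cases d with
    | up k i a =>
      refine ⟨_, hW _ hok ?_, rfl⟩
      refine Finset.mem_image.2 ⟨Sum.inr ⟨k, i, a⟩, ?_, rfl⟩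
      have := hok.2
      simp only [level, flipFun] at h1 h2
      simp [U]; omega
    | down k i a =>
      refine ⟨_, hW (up k i a) hok ?_, RootedMap.edge_eq_iff.2 (Or.inr rfl)⟩
      refine Finset.mem_image.2 ⟨Sum.inr ⟨k, i, a⟩, ?_, rfl⟩
      have := hok.2
      simp only [level, flipFun] at h1 h2
      simp [U]; omega
    | right k i =>
      refine ⟨_, hW _ hok ?_, rfl⟩
      refine Finset.mem_image.2 ⟨Sum.inl ⟨k, i⟩, ?_, rfl⟩
      have h3 := hok.1
      have h4 := hok.2.2
      simp only [level] at h1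
      simp [F]; omega
    | left k i =>
      refine ⟨_, hW (right k i) hok ?_, RootedMap.edge_eq_iff.2 (Or.inr rfl)⟩
      refine Finset.mem_image.2 ⟨Sum.inl ⟨k, i⟩, ?_, rfl⟩
      have h3 := hok.1
      have h4 := hok.2.2
      simp only [level] at h1
      simp [F]; omega
  have hWfin : W.Finite :=
    Set.Finite.preimage Subtype.val_injective.injOn (Finset.finite_toSet _)
  have hWcard : W.ncard ≤ F.card + U.card := by
    calc W.ncard = (Subtype.val '' W).ncard :=
          (Set.ncard_image_of_injective _ Subtype.val_injective).symm
      _ ≤ (((F.disjSum U).image g : Finset StripDart) : Set StripDart).ncard :=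
          Set.ncard_le_ncard (by rintro _ ⟨d, hd, rfl⟩; exact hd) (Finset.finite_toSet _)
      _ ≤ F.card + U.card := by
          rw [Set.ncard_coe_finset, ← Finset.card_disjSum]
          exact Finset.card_image_le
  have hF : F.card = C.volume R := by
    rw [Finset.card_sigma]
    simp [volume]
  have hshift : ∀ R, ∑ k ∈ Finset.range R, C.n (k + 1) = C.volume R := fun R => by
    unfold volume
    rw [Finset.range_eq_Ico, Finset.sum_Ico_add' (fun k => C.n k) 0 R 1]
    rfl
  have hle : ∑ k ∈ Finset.range R, C.n k ≤ 1 + C.volume R := by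
    obtain ⟨R, rfl⟩ : ∃ r, R = r + 1 := ⟨R - 1, by omega⟩
    rw [Finset.sum_range_succ', hshift]
    have : C.volume R ≤ C.volume (R + 1) :=
      Finset.sum_le_sum_of_subset (Finset.Icc_subset_Icc le_rfl (Nat.le_succ R))
    rw [n_zero]; omega
  have hone : 1 ≤ C.volume R := by
    have h1 : C.n 1 ≤ C.volume R :=
      Finset.single_le_sum (f := fun k => C.n k) (fun _ _ => Nat.zero_le _)
        (Finset.mem_Icc.2 ⟨le_rfl, hR⟩)
    have : 0 < C.n 1 := C.pos 1
    omega
  have hU : U.card ≤ 3 * C.volume R := by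
    have : U.card = ∑ k ∈ Finset.range R, (C.n (k + 1) + C.n k) := by
      rw [Finset.card_sigma]
      refine Finset.sum_congr rfl fun k _ => ?_
      rw [Finset.card_sigma]
      simp [Finset.sum_add_distrib, levelSize]
    rw [this, Finset.sum_add_distrib, hshift]
    omega
  have h1 := Set.ncard_le_ncard hsub (hWfin.image _)
  have h2 := Set.ncard_image_le (f := C.toRootedMap.edge) hWfin
  unfold RootedMap.ballSize
  omega

end LayerCode

/-! ### Reading the tree off a triangulation: the edges at a cycle -/

namespace RootedMap

variable {G : RootedMap}

/-- Turning around a vertex, one leaves a set of darts at that vertex through one of its exits. -/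
theorem exists_exit (hG : G.LocallyFinite) {P T : G.Dart → Prop}
    (hstep : ∀ x, P x → P (G.rot x) ∨ T (G.rot x)) {d e : G.Dart} (hd : P d)
    (hde : G.rot.SameCycle d e) (he : ¬ P e) :
    ∃ s, (∀ t ≤ s, P ((G.rot ^ t) d)) ∧ T ((G.rot ^ (s + 1)) d) := by
  classical
  obtain ⟨n, -, hn⟩ := exists_pow_of_sameCycle (hG.minimalPeriod_pos d) hde
  have hex : ∃ n, ¬ P ((G.rot ^ n) d) := ⟨n, by rwa [hn]⟩
  have hspec := Nat.find_spec hex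
  have hmin := fun m => Nat.find_min hex (m := m)
  obtain ⟨s, hs⟩ : ∃ s, Nat.find hex = s + 1 := by
    refine ⟨Nat.find hex - 1, ?_⟩
    have : Nat.find hex ≠ 0 := fun h => by rw [h] at hspec; exact hspec hd
    omega
  rw [hs] at hspec hmin
  have hall : ∀ t ≤ s, P ((G.rot ^ t) d) := fun t ht => not_not.1 (hmin t (by omega))
  refine ⟨s, hall, ?_⟩
  have := hstep _ (hall s le_rfl)
  rw [← Equiv.Perm.mul_apply, ← pow_succ'] at this
  exact this.resolve_left hspec

theorem sameCycle_pow (d : G.Dart) (m : ℕ) : G.rot.SameCycle d ((G.rot ^ m) d) := ⟨m, by simp⟩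

theorem ht_pow (m : ℕ) (d : G.Dart) : G.ht ((G.rot ^ m) d) = G.ht d :=
  ht_eq_of_vert_eq (vert_eq_iff.2 (sameCycle_pow d m).symm)

theorem ht_eq_of_sameCycle {a b : G.Dart} (h : G.rot.SameCycle a b) : G.ht a = G.ht b :=
  ht_eq_of_vert_eq (vert_eq_iff.2 h)

theorem rot_pow_succ (m : ℕ) (d : G.Dart) : (G.rot ^ (m + 1)) d = G.rot ((G.rot ^ m) d) := by
  rw [pow_succ', Equiv.Perm.mul_apply]

theorem rot_pow_add (m n : ℕ) (d : G.Dart) : (G.rot ^ (m + n)) d = (G.rot ^ m) ((G.rot ^ n) d) := by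
  rw [pow_add, Equiv.Perm.mul_apply]

theorem cyc_induction {n : ℕ} {P : ℕ → Prop} {i₀ : ℕ} (hi₀ : i₀ < n) (h0 : P i₀)
    (hs : ∀ i < n, P i → P (cycSucc n i)) : ∀ i < n, P i := by
  have h1 : ∀ d, i₀ + d < n → P (i₀ + d) := by
    intro d
    induction d with
    | zero => exact fun _ => h0
    | succ d ih =>
      intro h
      have := hs _ (by omega) (ih (by omega))
      rwa [cycSucc, if_pos (by omega)] at this
  have hz : P 0 := by
    have := hs _ (by omega) (h1 (n - 1 - i₀) (by omega))
    rwa [cycSucc, if_neg (by omega)] at this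
  intro i
  induction i with
  | zero => exact fun _ => hz
  | succ i ih =>
    intro h
    have := hs _ (by omega) (ih (by omega))
    rwa [cycSucc, if_pos h] at this

/-- The horizontal edges `R i` at height `k ≥ 1` form a cycle, traversed with the root on the
right hand side. -/
structure RightLevel (G : RootedMap) (k n : ℕ) (R : ℕ → G.Dart) : Prop where
  n_pos : 0 < n
  ht_right : ∀ i < n, G.ht (R i) = k
  ht_flip : ∀ i < n, G.ht (G.flip (R i)) = k
  uniq : ∀ i < n, ∀ j < n, G.rot.SameCycle (R i) (R j) → i = j
  cover : ∀ d, G.ht d = k → ∃ i < n, G.rot.SameCycle (R i) d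
  horizontal : ∀ d, G.ht d = k → G.ht (G.flip d) = k → ∃ i < n, d = R i ∨ d = G.flip (R i)
  ne_flip : ∀ i < n, ∀ j < n, R i ≠ G.flip (R j)
  vert_flip : ∀ i < n, G.rot.SameCycle (R (cycSucc n i)) (G.flip (R i))
  rot_right : ∀ i < n, G.ht (G.flip (G.rot (R i))) + 1 = k
  rot_down : ∀ d, G.ht d = k → G.ht (G.flip d) + 1 = k →
    G.ht (G.flip (G.rot d)) + 1 = k ∨ ∃ i < n, G.rot d = G.flip (R i)

/-- The vertical edges `u i a` between the heights `k` and `k + 1`. -/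
structure Strip (G : RootedMap) (k n : ℕ) (c : ℕ → ℕ) (R : ℕ → G.Dart) (u : ℕ → ℕ → G.Dart) :
    Prop where
  n_pos : 0 < n
  zero : k = 0 → n = 1 ∧ 0 < c 0
  ht_up : ∀ i < n, ∀ a, (a < c i ∨ a = c i ∧ 0 < k) →
    G.ht (u i a) = k ∧ G.ht (G.flip (u i a)) = k + 1
  inj : ∀ i < n, ∀ a, (a < c i ∨ a = c i ∧ 0 < k) → ∀ j < n, ∀ b, (b < c j ∨ b = c j ∧ 0 < k) →
    u i a = u j b → i = j ∧ a = b
  surj : ∀ d, G.ht d = k → G.ht (G.flip d) = k + 1 →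
    ∃ i < n, ∃ a, (a < c i ∨ a = c i ∧ 0 < k) ∧ d = u i a
  rot_child : ∀ i < n, ∀ a < c i,
    G.rot (u i a) = if k = 0 ∧ a + 1 = c 0 then u 0 0 else u i (a + 1)
  rot_last : 0 < k → ∀ i < n, G.rot (u i (c i)) = R i
  rot_left : 0 < k → ∀ i < n, G.rot (G.flip (R i)) = u (cycSucc n i) 0
  rot_flip : 0 < k → ∀ i < n, G.rot (G.flip (u (cycSucc n i) 0)) = G.flip (u i (c i))

namespace RightLevel

variable {k n : ℕ} {R : ℕ → G.Dart}

theorem left_sameCycle (h : RightLevel G k n R) {i : ℕ} (hi : i < n) :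
    G.rot.SameCycle (R i) (G.flip (R (cycPred n i))) := by
  have := h.vert_flip _ (cycPred_lt hi)
  rwa [cycSucc_cycPred hi] at this

/-- The two horizontal darts at a vertex. -/
theorem horizontal_at (h : RightLevel G k n R) {i : ℕ} (hi : i < n) {d : G.Dart}
    (hd : G.rot.SameCycle (R i) d) (hf : G.ht (G.flip d) = k) :
    d = R i ∨ d = G.flip (R (cycPred n i)) := by
  obtain ⟨j, hj, rfl | rfl⟩ := h.horizontal d ((ht_eq_of_sameCycle hd).symm.trans (h.ht_right i hi)) hf
  · rw [h.uniq i hi j hj hd]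
    exact Or.inl rfl
  · have := h.uniq _ hi _ (cycSucc_lt hj) (hd.trans (h.vert_flip j hj).symm)
    rw [this, cycPred_cycSucc hj]
    exact Or.inr rfl

/-- Turning from `R i`, one meets edges leading down and then the other horizontal edge. -/
theorem down_arc (h : RightLevel G k n R) (hG : G.LocallyFinite) {i : ℕ} (hi : i < n) :
    ∃ q, (∀ t < q, G.ht (G.flip ((G.rot ^ (t + 1)) (R i))) + 1 = k) ∧
      (G.rot ^ (q + 1)) (R i) = G.flip (R (cycPred n i)) := by
  obtain ⟨s, hs, j, hj, he⟩ := exists_exit hG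
    (P := fun d => G.ht d = k ∧ G.ht (G.flip d) + 1 = k)
    (T := fun d => ∃ j < n, d = G.flip (R j)) (fun x hx => by
      rcases h.rot_down x hx.1 hx.2 with h1 | h1
      · exact Or.inl ⟨(ht_rot x).trans hx.1, h1⟩
      · exact Or.inr h1)
    (d := G.rot (R i)) (e := R i) ⟨(ht_rot _).trans (h.ht_right i hi), h.rot_right i hi⟩
    (Equiv.Perm.sameCycle_apply_left.2 (Equiv.Perm.SameCycle.refl _ _))
    (fun hP => by
      have := h.ht_flip i hi
      omega)
  have hpow : ∀ t, (G.rot ^ t) (G.rot (R i)) = (G.rot ^ (t + 1)) (R i) := fun t => by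
    rw [pow_succ, Equiv.Perm.mul_apply]
  rw [hpow] at he
  refine ⟨s + 1, fun t ht => ?_, ?_⟩
  · rw [← hpow]; exact (hs t (by omega)).2
  · have hsc : G.rot.SameCycle (R i) (G.flip (R j)) := he ▸ sameCycle_pow _ _
    have := h.uniq _ hi _ (cycSucc_lt hj) (hsc.trans (h.vert_flip j hj).symm)
    rw [he, this, cycPred_cycSucc hj]

/-- The edge preceding an edge which leads down. -/
theorem pred_down (h : RightLevel G k n R) (hG : G.LocallyFinite) {x : G.Dart} (hx : G.ht x = k)
    (hd : G.ht (G.flip (G.rot x)) + 1 = k) :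
    G.ht (G.flip x) + 1 = k ∨ ∃ i < n, x = R i := by
  obtain ⟨i, hi, hix⟩ := h.cover x hx
  have hix' : G.rot.SameCycle (G.rot x) (R i) := Equiv.Perm.sameCycle_apply_left.2 hix.symm
  obtain ⟨q, hq, hqe⟩ := h.down_arc hG hi
  obtain ⟨s, hs, j, hj, he⟩ := exists_exit hG
    (P := fun d => G.ht d = k ∧ G.ht (G.flip d) + 1 = k)
    (T := fun d => ∃ j < n, d = G.flip (R j)) (fun x hx => by
      rcases h.rot_down x hx.1 hx.2 with h1 | h1
      · exact Or.inl ⟨(ht_rot x).trans hx.1, h1⟩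
      · exact Or.inr h1)
    (d := G.rot x) (e := R i) ⟨(ht_rot _).trans hx, hd⟩ hix'
    (fun hP => by
      have := h.ht_flip i hi
      omega)
  have hsc : G.rot.SameCycle (R i) (G.flip (R j)) :=
    he ▸ hix'.symm.trans (sameCycle_pow _ _)
  have hji := h.uniq _ hi _ (cycSucc_lt hj) (hsc.trans (h.vert_flip j hj).symm)
  have hj' : cycPred n i = j := by rw [hji, cycPred_cycSucc hj]
  rw [hj', ← he] at hqe
  -- The arcs starting at `R i` and at `rot x` end at the same left dart, so one is a final piece of
  -- the other. That the arc from `rot x` contains `R i` is excluded, since it consists of downward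
  -- darts.
  rcases le_or_gt s q with hsq | hsq
  · have e1 : (G.rot ^ (s + 1)) ((G.rot ^ (q - s)) (R i)) = (G.rot ^ (s + 1)) (G.rot x) := by
      rw [← rot_pow_add, ← hqe]
      congr 2; omega
    have e2 := (G.rot ^ (s + 1)).injective e1
    rcases Nat.eq_zero_or_pos (q - s) with h0 | h0
    · rw [h0] at e2
      have : G.ht (G.flip (G.rot x)) = k := by rw [← e2]; exact h.ht_flip i hi
      omega
    · obtain ⟨r, hr⟩ : ∃ r, q - s = r + 1 := ⟨q - s - 1, by omega⟩
      rw [hr, rot_pow_succ] at e2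
      have e3 := G.rot.injective e2
      rcases Nat.eq_zero_or_pos r with rfl | hr0
      · exact Or.inr ⟨i, hi, e3.symm⟩
      · left
        rw [← e3]
        have := hq (r - 1) (by omega)
        rwa [Nat.sub_add_cancel hr0] at this
  · have e1 : (G.rot ^ (q + 1)) ((G.rot ^ (s - q)) (G.rot x)) = (G.rot ^ (q + 1)) (R i) := by
      rw [← rot_pow_add, hqe]
      congr 2; omega
    have e2 := (G.rot ^ (q + 1)).injective e1
    have := (hs (s - q) (by omega)).2
    rw [e2] at this
    have := h.ht_flip i hi
    omega

variable {K : ℕ}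

/-- The edge following a left edge leads up or is the right edge. -/
theorem rot_left_cases (h : RightLevel G k n R) (hc : G.graph.Connected) (hG : G.LocallyFinite)
    {i : ℕ} (hi : i < n) : G.ht (G.flip (G.rot (G.flip (R (cycPred n i))))) = k + 1 ∨
      G.rot (G.flip (R (cycPred n i))) = R i := by
  set x := G.flip (R (cycPred n i)) with hx
  have hp := cycPred_lt hi
  have hxk : G.ht x = k := h.ht_flip _ hp
  have hfx : G.ht (G.flip x) = k := by rw [hx, G.flip_flip]; exact h.ht_right _ hp
  have hsc : G.rot.SameCycle (R i) x := h.left_sameCycle hi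
  have h1 := ht_flip_le hc (G.rot x)
  have h2 := ht_le_flip hc (G.rot x)
  rw [ht_rot, hxk] at h1 h2
  rcases (show G.ht (G.flip (G.rot x)) + 1 = k ∨ G.ht (G.flip (G.rot x)) = k ∨
    G.ht (G.flip (G.rot x)) = k + 1 by omega) with h3 | h3 | h3
  · rcases h.pred_down hG hxk h3 with h4 | ⟨j, hj, h4⟩
    · omega
    · exact absurd h4.symm (h.ne_flip j hj _ hp)
  · right
    rcases h.horizontal_at hi (Equiv.Perm.sameCycle_apply_right.2 hsc) h3 with h4 | h4
    · exact h4
    · exfalso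
      have hfix : ∀ m, (G.rot ^ m) x = x := fun m => by
        induction m with
        | zero => rfl
        | succ m ih => rw [rot_pow_succ, ih, h4]
      obtain ⟨m, -, hm⟩ := exists_pow_of_sameCycle (hG.minimalPeriod_pos x) hsc.symm
      rw [hfix] at hm
      exact h.ne_flip i hi _ hp hm.symm
  · exact Or.inl h3

/-- Suppose the right dart directly followed the left dart at one vertex. Then the triangle beside
these two horizontal edges has its third vertex at height `k` too, which forces the same situation
at the next vertex. It would spread around the cycle and no edge could lead up. -/
theorem rot_left_up (h : RightLevel G k n R) (hc : G.graph.Connected) (hG : G.LocallyFinite)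
    (htri : ∀ d, G.ht d = k → G.ht (G.flip d) = k → G.facePerm (G.facePerm (G.facePerm d)) = d)
    (hup : ∃ d, G.ht d = k ∧ G.ht (G.flip d) = k + 1) {i : ℕ} (hi : i < n) :
    G.ht (G.flip (G.rot (G.flip (R (cycPred n i))))) = k + 1 := by
  refine (h.rot_left_cases hc hG hi).resolve_right fun hbad => ?_
  have hall := cyc_induction (P := fun i => G.rot (G.flip (R (cycPred n i))) = R i) hi hbad (by
    intro i hi hi'
    have hp := cycPred_lt hi
    have hs := cycSucc_lt hi
    have ht := htri _ (h.ht_right _ hp) (h.ht_flip _ hp)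
    have e1 : G.facePerm (R (cycPred n i)) = R i := hi'
    rw [e1] at ht
    have e2 : G.ht (G.flip (G.facePerm (R i))) = k := by
      rw [← ht_facePerm, ht]; exact h.ht_right _ hp
    have := h.rot_left_cases hc hG hs
    rw [cycPred_cycSucc hi] at this ⊢
    refine this.resolve_left fun h3 => ?_
    have e3 : G.ht (G.flip (G.rot (G.flip (R i)))) = k := e2
    omega)
  obtain ⟨d, hd, hfd⟩ := hup
  obtain ⟨j, hj, hjd⟩ := h.cover d hd
  obtain ⟨m, -, hm⟩ := exists_pow_of_sameCycle (hG.minimalPeriod_pos _) hjd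
  have hno : ∀ m, G.ht (G.flip ((G.rot ^ m) (R j))) ≠ k + 1 := by
    intro m
    induction m with
    | zero => have := h.ht_flip j hj; intro h'; change G.ht (G.flip (R j)) = k + 1 at h'; omega
    | succ m ih =>
      rw [rot_pow_succ]
      set x := (G.rot ^ m) (R j) with hx
      have hxk : G.ht x = k := (ht_pow m _).trans (h.ht_right j hj)
      have hsc : G.rot.SameCycle (R j) x := sameCycle_pow _ _
      have h1 := ht_flip_le hc x
      have h2 := ht_le_flip hc x
      rcases (show G.ht (G.flip x) + 1 = k ∨ G.ht (G.flip x) = k by omega) with h3 | h3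
      · rcases h.rot_down x hxk h3 with h4 | ⟨i, hi, h4⟩
        · omega
        · rw [h4, G.flip_flip, h.ht_right i hi]; omega
      · rcases h.horizontal_at hj hsc h3 with h4 | h4
        · rw [h4]; have := h.rot_right j hj; omega
        · rw [h4, hall j hj, h.ht_flip j hj]; omega
  exact hno m (by rw [hm]; exact hfd)

/-- The edge following an edge which leads up. -/
theorem rot_up (h : RightLevel G k n R) (hc : G.graph.Connected) (hG : G.LocallyFinite)
    {i : ℕ} (hi : i < n) {d : G.Dart} (hd : G.rot.SameCycle (R i) d)
    (hf : G.ht (G.flip d) = k + 1) : G.ht (G.flip (G.rot d)) = k + 1 ∨ G.rot d = R i := by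
  have hdk : G.ht d = k := (ht_eq_of_sameCycle hd).symm.trans (h.ht_right i hi)
  have h1 := ht_flip_le hc (G.rot d)
  have h2 := ht_le_flip hc (G.rot d)
  rw [ht_rot, hdk] at h1 h2
  rcases (show G.ht (G.flip (G.rot d)) + 1 = k ∨ G.ht (G.flip (G.rot d)) = k ∨
    G.ht (G.flip (G.rot d)) = k + 1 by omega) with h3 | h3 | h3
  · rcases h.pred_down hG hdk h3 with h4 | ⟨j, hj, rfl⟩
    · omega
    · have := h.ht_flip j hj; omega
  · rcases h.horizontal_at hi (Equiv.Perm.sameCycle_apply_right.2 hd) h3 with h4 | h4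
    · exact Or.inr h4
    -- The left dart is preceded by a downward dart or by `R i`, never by an upward dart.
    · exfalso
      obtain ⟨q, hq, hqe⟩ := h.down_arc hG hi
      rw [← h4, rot_pow_succ] at hqe
      have hqd := G.rot.injective hqe
      rcases Nat.eq_zero_or_pos q with rfl | hq0
      · have := h.ht_flip i hi
        rw [← hqd] at hf
        change G.ht (G.flip (R i)) = k + 1 at hf
        omega
      · have := hq (q - 1) (by omega)
        rw [Nat.sub_add_cancel hq0, hqd] at this
        omega
  · exact Or.inl h3

end RightLevel

end RootedMap

/-! ### Strips above a cycle and around the root -/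

namespace RootedMap

variable {G : RootedMap}

/-- The vertical edges above a cycle. -/
theorem RightLevel.exists_strip {k n : ℕ} {R : ℕ → G.Dart} (h : RightLevel G k n R)
    (hk : 0 < k) (hc : G.graph.Connected) (hG : G.LocallyFinite)
    (htri : ∀ d, G.ht d = k → G.ht (G.flip d) = k → G.facePerm (G.facePerm (G.facePerm d)) = d)
    (hup : ∃ d, G.ht d = k ∧ G.ht (G.flip d) = k + 1) : ∃ c u, Strip G k n c R u := by
  classical
  -- The first upward dart at the `i`-th vertex, namely the one that follows the left dart. From it
  -- the upward darts run without interruption up to `R i`; their number is `c i + 1`, the last one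
  -- being the extra edge.
  set f : ℕ → G.Dart := fun i => G.rot (G.flip (R (cycPred n i))) with hf
  have hfc : ∀ i < n, G.rot.SameCycle (R i) (f i) := fun i hi =>
    Equiv.Perm.sameCycle_apply_right.2 (h.left_sameCycle hi)
  have hfu : ∀ i < n, G.ht (G.flip (f i)) = k + 1 := fun i hi => h.rot_left_up hc hG htri hup hi
  have exit : ∀ i < n, ∀ d, G.rot.SameCycle (R i) d → G.ht (G.flip d) = k + 1 →
      ∃ s, (∀ t ≤ s, G.ht (G.flip ((G.rot ^ t) d)) = k + 1) ∧ (G.rot ^ (s + 1)) d = R i := by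
    intro i hi d hd hdu
    obtain ⟨s, hs, he⟩ := exists_exit hG
      (P := fun x => G.rot.SameCycle (R i) x ∧ G.ht (G.flip x) = k + 1) (T := fun x => x = R i)
      (fun x hx => (h.rot_up hc hG hi hx.1 hx.2).imp_left fun h' =>
        ⟨Equiv.Perm.sameCycle_apply_right.2 hx.1, h'⟩)
      (d := d) (e := R i) ⟨hd, hdu⟩ hd.symm (fun hP => by
        have := hP.2
        have := h.ht_flip i hi
        omega)
    exact ⟨s, fun t ht => (hs t ht).2, he⟩
  have hex : ∀ i, ∃ s, i < n → (∀ t ≤ s, G.ht (G.flip ((G.rot ^ t) (f i))) = k + 1) ∧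
      (G.rot ^ (s + 1)) (f i) = R i := by
    intro i
    by_cases hi : i < n
    · obtain ⟨s, hs⟩ := exit i hi (f i) (hfc i hi) (hfu i hi)
      exact ⟨s, fun _ => hs⟩
    · exact ⟨0, fun h' => absurd h' hi⟩
  choose c hcs using hex
  have hsc : ∀ i < n, ∀ a, G.rot.SameCycle (R i) ((G.rot ^ a) (f i)) := fun i hi a =>
    (hfc i hi).trans (sameCycle_pow _ _)
  have hinj : ∀ i < n, ∀ a b, a < b → b ≤ c i → (G.rot ^ a) (f i) ≠ (G.rot ^ b) (f i) := by
    intro i hi a b hab hb heq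
    have h1 : (G.rot ^ (c i + 1 - b + a)) (f i) = R i := by
      rw [rot_pow_add, heq, ← rot_pow_add, Nat.sub_add_cancel (by omega)]
      exact (hcs i hi).2
    have h2 := (hcs i hi).1 (c i + 1 - b + a) (by omega)
    rw [h1, h.ht_flip i hi] at h2
    omega
  refine ⟨c, fun i a => (G.rot ^ a) (f i), h.n_pos, fun h0 => by omega, ?_, ?_, ?_, ?_, ?_, ?_, ?_⟩
  · intro i hi a ha
    exact ⟨(ht_eq_of_sameCycle (hsc i hi a)).symm.trans (h.ht_right i hi),
      (hcs i hi).1 a (by omega)⟩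
  · intro i hi a ha j hj b hb heq
    obtain rfl : i = j := h.uniq i hi j hj ((hsc i hi a).trans (heq ▸ (hsc j hj b).symm))
    refine ⟨rfl, ?_⟩
    rcases lt_trichotomy a b with hab | hab | hab
    · exact absurd heq (hinj i hi a b hab (by omega))
    · exact hab
    · exact absurd heq.symm (hinj i hi b a hab (by omega))
  · intro d hd hdu
    obtain ⟨i, hi, hid⟩ := h.cover d hd
    obtain ⟨s, hs, he⟩ := exit i hi d hid hdu
    have he' := (hcs i hi).2
    rcases le_or_gt s (c i) with hle | hlt
    · refine ⟨i, hi, c i - s, by omega, ?_⟩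
      apply (G.rot ^ (s + 1)).injective
      rw [he, ← rot_pow_add, ← he']
      congr 2; omega
    · exfalso
      have e1 : (G.rot ^ (c i + 1)) ((G.rot ^ (s - c i)) d) = (G.rot ^ (c i + 1)) (f i) := by
        rw [he', ← rot_pow_add, ← he]
        congr 2; omega
      have e2 := (G.rot ^ (c i + 1)).injective e1
      obtain ⟨r, hr⟩ : ∃ r, s - c i = r + 1 := ⟨s - c i - 1, by omega⟩
      rw [hr, rot_pow_succ] at e2
      have e3 := G.rot.injective e2
      have := hs r (by omega)
      rw [e3, G.flip_flip, h.ht_right _ (cycPred_lt hi)] at this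
      omega
  · intro i hi a ha
    rw [if_neg (by omega)]
    exact (rot_pow_succ _ _).symm
  · intro _ i hi
    rw [← rot_pow_succ]
    exact (hcs i hi).2
  · intro _ i hi
    simp only [hf, cycPred_cycSucc hi, pow_zero, Equiv.Perm.one_apply]
  · intro _ i hi
    have e1 : f (cycSucc n i) = G.facePerm (R i) := by
      simp only [hf, cycPred_cycSucc hi]; rfl
    -- The triangle above `R i`: its last side precedes `R i` in the rotation, hence is the last
    -- upward dart at that vertex.
    have e2 : G.rot (G.flip (G.rot (G.flip (f (cycSucc n i))))) = R i := by
      have := htri (R i) (h.ht_right i hi) (h.ht_flip i hi)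
      rw [← e1] at this
      exact this
    have e3 : G.flip (G.rot (G.flip (f (cycSucc n i)))) = (G.rot ^ (c i)) (f i) := by
      apply G.rot.injective
      rw [e2, ← rot_pow_succ, (hcs i hi).2]
    rw [← e3, G.flip_flip]
    rfl

/-- The vertical edges at the root. -/
theorem exists_strip_zero (hc : G.graph.Connected) (hG : G.LocallyFinite) (hr : G.NoRootLoop)
    (R : ℕ → G.Dart) : ∃ c u, Strip G 0 1 c R u ∧ u 0 0 = G.root := by
  set p := Function.minimalPeriod G.rot G.root with hp
  have hp0 : 0 < p := hG.minimalPeriod_pos G.root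
  refine ⟨fun _ => p, fun _ a => (G.rot ^ a) G.root, ⟨one_pos, fun _ => ⟨rfl, hp0⟩, ?_, ?_, ?_, ?_,
    fun h => absurd h (lt_irrefl 0), fun h => absurd h (lt_irrefl 0),
    fun h => absurd h (lt_irrefl 0)⟩, rfl⟩
  · intro i _ a _
    have h0 : G.ht ((G.rot ^ a) G.root) = 0 := (ht_pow _ _).trans ht_root
    have h1 := hr _ h0
    have h2 := ht_flip_le hc ((G.rot ^ a) G.root)
    exact ⟨h0, by omega⟩
  · intro i hi a ha j hj b hb heq
    refine ⟨by omega, ?_⟩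
    have := (pow_eq_pow_iff hp0 a b).1 heq
    rwa [Nat.mod_eq_of_lt (by omega), Nat.mod_eq_of_lt (by omega)] at this
  · intro d hd _
    obtain ⟨a, ha, hae⟩ := exists_pow_of_sameCycle hp0 ((ht_eq_zero_iff hc d).1 hd)
    exact ⟨0, one_pos, a, Or.inl ha, hae.symm⟩
  · intro i _ a ha
    simp only [← rot_pow_succ]
    split_ifs with h
    · rw [h.2, ← pow_mod_minimalPeriod, ← hp, Nat.mod_self]
    · rfl

/-- The cyclic order of the vertices and the edges at height `k`. -/
structure CycleLabel (G : RootedMap) (k m : ℕ) (e : ZMod m → G.Dart) : Prop where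
  ht_eq : ∀ x, G.ht (e x) = k
  uniq : ∀ x y, G.rot.SameCycle (e x) (e y) → x = y
  vert_flip : ∀ x, G.rot.SameCycle (G.flip (e x)) (e (x + 1))
  horizontal : ∀ d, G.ht d = k → G.ht (G.flip d) = k → ∃ x, d = e x ∨ d = G.flip (e x)
  ne_flip : ∀ x y, e x ≠ G.flip (e y)

theorem CycleAt.exists_label {k : ℕ} (h : G.CycleAt k) : ∃ m e, CycleLabel G k m e := by
  obtain ⟨m, -, e, hv, hf, he⟩ := h
  refine ⟨m, e, fun x => hv.mapsTo (Set.mem_univ x),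
    fun x y hxy => hv.injOn (Set.mem_univ _) (Set.mem_univ _) (vert_eq_iff.2 hxy),
    fun x => vert_eq_iff.1 (hf x), fun d h1 h2 => ?_, fun x y hxy => ?_⟩
  · obtain ⟨x, -, hx⟩ := he.surjOn ⟨d, rfl, h1, h2⟩
    exact ⟨x, edge_eq_iff.1 hx⟩
  · have hxy' : x = y := he.injOn (Set.mem_univ _) (Set.mem_univ _)
      (edge_eq_iff.2 (Or.inr (by rw [hxy, G.flip_flip])))
    exact G.flip_ne (e y) (by rw [← hxy, hxy'])

namespace CycleLabel

variable {k m : ℕ} {e : ZMod m → G.Dart}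

theorem ht_flip (h : CycleLabel G k m e) (x : ZMod m) : G.ht (G.flip (e x)) = k :=
  (ht_eq_of_sameCycle (h.vert_flip x)).trans (h.ht_eq _)

/-- `CycleAt` does not fix the sense in which the cycle is traversed; the reversal allows it to be
matched with the sense given by the strip below. -/
theorem reverse (h : CycleLabel G k m e) : CycleLabel G k m fun x => G.flip (e (-x)) := by
  refine ⟨fun x => h.ht_flip _, fun x y hxy => ?_, fun x => ?_, fun d h1 h2 => ?_,
    fun x y hxy => ?_⟩
  · have := h.uniq _ _ ((h.vert_flip _).symm.trans (hxy.trans (h.vert_flip _)))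
    exact neg_injective (add_right_cancel this)
  · have := (h.vert_flip (-(x + 1))).symm
    rw [neg_add, neg_add_cancel_right] at this
    rw [G.flip_flip, neg_add]
    exact this
  · obtain ⟨x, hx⟩ := h.horizontal d h1 h2
    exact ⟨-x, by rw [neg_neg, G.flip_flip]; exact hx.symm⟩
  · rw [G.flip_flip] at hxy
    exact h.ne_flip _ _ hxy.symm

theorem horizontal_at (h : CycleLabel G k m e) {x : ZMod m} {d : G.Dart}
    (hd : G.rot.SameCycle (e x) d) (hf : G.ht (G.flip d) = k) :
    d = e x ∨ d = G.flip (e (x - 1)) := by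
  obtain ⟨y, rfl | rfl⟩ := h.horizontal d ((ht_eq_of_sameCycle hd).symm.trans (h.ht_eq x)) hf
  · rw [h.uniq _ _ hd]; exact Or.inl rfl
  · rw [h.uniq _ _ (hd.trans (h.vert_flip y)), add_sub_cancel_right]
    exact Or.inr rfl

end CycleLabel

end RootedMap

theorem childIdx_last (f : ℕ → ℕ) {n i : ℕ} (hi : i < n) :
    (if childSum f i + f i < childSum f n then childSum f i + f i else 0) =
      if childSum f (cycSucc n i) + 0 < childSum f n then childSum f (cycSucc n i) + 0 else 0 := by
  rw [← childSum_succ]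
  by_cases h : i + 1 < n
  · rw [cycSucc, if_pos h, add_zero]
  · rw [cycSucc, if_neg h, childSum_zero, if_neg]
    · simp
    · have : i + 1 = n := by omega
      rw [this]; exact lt_irrefl _

/-! ### From a strip to the cycle above it -/

namespace RootedMap

variable {G : RootedMap} {k n : ℕ} {c : ℕ → ℕ} {R : ℕ → G.Dart} {u : ℕ → ℕ → G.Dart}

/-- The horizontal edges `S` above the strip. -/
def IsNextLevel (G : RootedMap) (n : ℕ) (c : ℕ → ℕ) (u : ℕ → ℕ → G.Dart) (S : ℕ → G.Dart) : Prop :=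
  ∀ i < n, ∀ a < c i, G.rot (S (childSum c i + a)) = G.flip (u i a) ∧
    G.rot (G.flip (G.rot (u i a))) = G.flip (S (childSum c i + a))

namespace Strip

theorem ht_rot_up (h : Strip G k n c R u) {i a : ℕ} (hi : i < n) (ha : a < c i) :
    G.ht (G.rot (u i a)) = k ∧ G.ht (G.flip (G.rot (u i a))) = k + 1 := by
  rw [h.rot_child i hi a ha]
  split_ifs with h0
  · exact h.ht_up 0 h.n_pos 0 (Or.inl (h.zero h0.1).2)
  · refine h.ht_up i hi (a + 1) ?_
    rcases Nat.eq_zero_or_pos k with rfl | hk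
    · obtain rfl : i = 0 := by have := (h.zero rfl).1; omega
      omega
    · omega

/-- The candidate for the `j`-th horizontal dart is the dart before the tree edge at the `j`-th
vertex. It closes the triangle formed by `u i a` and the next upward dart. -/
theorem isNextLevel (h : Strip G k n c R u)
    (htri : ∀ d, G.ht d ≤ k + 1 → G.ht (G.flip d) ≤ k + 1 →
      G.facePerm (G.facePerm (G.facePerm d)) = d) :
    IsNextLevel G n c u
      (fun j => G.rot.symm (G.flip (u (parentIdx c n j) (siblingIdx c n j)))) := by
  intro i hi a ha
  simp only [parentIdx_childSum_add hi ha, siblingIdx_childSum_add hi ha]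
  have hu := h.ht_up i hi a (Or.inl ha)
  refine ⟨Equiv.apply_symm_apply _ _, ?_⟩
  have ht := htri (G.flip (u i a)) hu.2.le (by rw [G.flip_flip, hu.1]; omega)
  simp only [facePerm_apply, G.flip_flip] at ht
  have h2 := (Equiv.symm_apply_eq G.rot).2 ht.symm
  rw [h2, G.flip_flip]

/-- The darts leading down from the level above the strip. -/
theorem exists_down (h : Strip G k n c R u) {d : G.Dart} (hd : G.ht d = k + 1)
    (hf : G.ht (G.flip d) = k) :
    ∃ i < n, ∃ a, (a < c i ∨ a = c i ∧ 0 < k) ∧ d = G.flip (u i a) := by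
  obtain ⟨i, hi, a, ha, he⟩ := h.surj (G.flip d) hf (by rwa [G.flip_flip])
  exact ⟨i, hi, a, ha, by rw [← he, G.flip_flip]⟩

variable {S : ℕ → G.Dart}

theorem rot_down_cases (h : Strip G k n c R u) (hS : IsNextLevel G n c u S) {d : G.Dart}
    (hd : G.ht d = k + 1) (hf : G.ht (G.flip d) = k) :
    (∃ j < childSum c n, G.rot d = G.flip (S j)) ∨ G.ht (G.flip (G.rot d)) = k := by
  obtain ⟨i, hi, a, ha, rfl⟩ := h.exists_down hd hf
  rcases Nat.eq_zero_or_pos a with rfl | ha0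
  · rcases Nat.eq_zero_or_pos k with rfl | hk
    · left
      obtain ⟨hn, hc0⟩ := h.zero rfl
      obtain rfl : i = 0 := by omega
      have h1 := h.rot_child 0 hi (c 0 - 1) (by omega)
      rw [if_pos ⟨rfl, by omega⟩] at h1
      refine ⟨_, childSum_add_lt hi (show c 0 - 1 < c 0 by omega), ?_⟩
      rw [← (hS 0 hi _ (by omega)).2, h1]
    · right
      have := h.rot_flip hk _ (cycPred_lt hi)
      rw [cycSucc_cycPred hi] at this
      rw [this, G.flip_flip]
      exact (h.ht_up _ (cycPred_lt hi) _ (Or.inr ⟨rfl, hk⟩)).1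
  · left
    obtain ⟨b, rfl⟩ : ∃ b, a = b + 1 := ⟨a - 1, by omega⟩
    have h1 := h.rot_child i hi b (by omega)
    rw [if_neg] at h1
    · refine ⟨_, childSum_add_lt hi (show b < c i by omega), ?_⟩
      rw [← (hS i hi b (by omega)).2, h1]
    · rintro ⟨rfl, hb⟩
      obtain rfl : i = 0 := by have := (h.zero rfl).1; omega
      omega

/-- Without children the rotation would take downward darts to downward darts, leaving no place for
a horizontal dart at the same vertex. -/
theorem exists_child (h : Strip G k n c R u) (hc : G.graph.Connected) (hG : G.LocallyFinite)
    (hS : IsNextLevel G n c u S) (hhor : ∃ d, G.ht d = k + 1 ∧ G.ht (G.flip d) = k + 1) :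
    0 < childSum c n := by
  by_contra h0
  obtain ⟨d, hd, hfd⟩ := hhor
  obtain ⟨d', hdd', hd'⟩ := exists_lower hc d (by omega)
  have hht := ht_eq_of_sameCycle hdd'
  obtain ⟨m, -, hm⟩ := exists_pow_of_sameCycle (hG.minimalPeriod_pos d') hdd'.symm
  have hall : ∀ m, G.ht (G.flip ((G.rot ^ m) d')) = k := by
    intro m
    induction m with
    | zero => change G.ht (G.flip d') = k; omega
    | succ m ih =>
      rw [rot_pow_succ]
      rcases h.rot_down_cases hS (by rw [ht_pow]; omega) ih with ⟨j, hj, -⟩ | h1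
      · omega
      · exact h1
  have := hall m
  rw [hm] at this
  omega

/-- Every dart leading down from the level above the strip follows a horizontal edge, with only
darts leading down in between. -/
theorem exists_right_before (h : Strip G k n c R u) (hS : IsNextLevel G n c u S)
    (hk : 0 < k) (hpos : 0 < childSum c n) : ∀ i < n, ∀ a ≤ c i,
      ∃ s, (G.rot ^ (s + 1))
          (S (if childSum c i + a < childSum c n then childSum c i + a else 0)) = G.flip (u i a) ∧
        ∀ t ≤ s, G.ht (G.flip ((G.rot ^ (t + 1))
          (S (if childSum c i + a < childSum c n then childSum c i + a else 0)))) = k := by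
  refine strip_induction hpos _ (fun i hi a ha => ⟨0, ?_, fun t ht => ?_⟩) ?_
  · rw [if_pos (childSum_add_lt hi ha)]
    exact (hS i hi a ha).1
  · obtain rfl : t = 0 := by omega
    rw [if_pos (childSum_add_lt hi ha)]
    have h1 : (G.rot ^ (0 + 1)) (S (childSum c i + a)) = G.flip (u i a) := (hS i hi a ha).1
    rw [h1, G.flip_flip]
    exact (h.ht_up i hi a (Or.inl ha)).1
  · rintro i hi ⟨s, hs, hd⟩
    rw [← childIdx_last c hi] at hs hd
    have h1 : (G.rot ^ (s + 1 + 1)) (S (if childSum c i + c i < childSum c n then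
        childSum c i + c i else 0)) = G.flip (u i (c i)) := by
      rw [rot_pow_succ, hs, h.rot_flip hk i hi]
    refine ⟨s + 1, h1, fun t ht => ?_⟩
    rcases ht.lt_or_eq with h2 | rfl
    · exact hd t (by omega)
    · rw [h1, G.flip_flip]
      exact (h.ht_up i hi _ (Or.inr ⟨rfl, hk⟩)).1

theorem exists_cell {j : ℕ} (hj : j < childSum c n) :
    ∃ i < n, ∃ a < c i, j = childSum c i + a :=
  ⟨_, parentIdx_lt hj, _, siblingIdx_lt hj, (childSum_add_siblingIdx c n j).symm⟩

/-- From `S (j + 1)` one turns over darts leading down to the reversal of `S j`. -/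
theorem down_arc_next (h : Strip G k n c R u) (hS : IsNextLevel G n c u S)
    {j : ℕ} (hj : j < childSum c n) :
    ∃ s, (G.rot ^ (s + 2)) (S (cycSucc (childSum c n) j)) = G.flip (S j) ∧
      ∀ t ≤ s, G.ht (G.flip ((G.rot ^ (t + 1)) (S (cycSucc (childSum c n) j)))) = k := by
  obtain ⟨i, hi, a, ha, rfl⟩ := exists_cell hj
  have hS2 := (hS i hi a ha).2
  have single : ∀ i' a', i' < n → a' < c i' → G.rot (u i a) = u i' a' →
      childSum c i' + a' = cycSucc (childSum c n) (childSum c i + a) →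
      ∃ s, (G.rot ^ (s + 2)) (S (cycSucc (childSum c n) (childSum c i + a))) =
          G.flip (S (childSum c i + a)) ∧
        ∀ t ≤ s, G.ht (G.flip ((G.rot ^ (t + 1))
          (S (cycSucc (childSum c n) (childSum c i + a))))) = k := by
    intro i' a' hi' ha' hr he
    have h1 := (hS i' hi' a' ha').1
    rw [← he]
    refine ⟨0, ?_, fun t ht => ?_⟩
    · change G.rot (G.rot _) = _
      rw [h1, ← hr, hS2]
    · obtain rfl : t = 0 := by omega
      change G.ht (G.flip (G.rot _)) = k
      rw [h1, G.flip_flip]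
      exact (h.ht_up i' hi' a' (Or.inl ha')).1
  have hrot := h.rot_child i hi a ha
  by_cases h0 : k = 0 ∧ a + 1 = c 0
  · rw [if_pos h0] at hrot
    obtain ⟨hn, hc0⟩ := h.zero h0.1
    subst hn
    refine single 0 0 h.n_pos hc0 hrot ?_
    obtain rfl : i = 0 := by omega
    rw [cycSucc, if_neg]
    · rfl
    · rw [childSum_succ, childSum_zero]; omega
  · rw [if_neg h0] at hrot
    by_cases ha1 : a + 1 < c i
    · refine single i (a + 1) hi ha1 hrot ?_
      have := childSum_add_lt hi ha1
      rw [cycSucc, if_pos (by omega)]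
      omega
    -- Here the next upward dart is the extra edge of the `i`-th vertex. The arc is the one that
    -- `exists_right_before` provides for it, one turn longer.
    · have hac : a + 1 = c i := by omega
      have hk : 0 < k := by
        by_contra hk
        obtain rfl : k = 0 := by omega
        obtain rfl : i = 0 := by have := (h.zero rfl).1; omega
        exact h0 ⟨rfl, hac⟩
      obtain ⟨s, hs, hd⟩ := h.exists_right_before hS hk (by omega) i hi (c i) le_rfl
      have he : (if childSum c i + c i < childSum c n then childSum c i + c i else 0) =
          cycSucc (childSum c n) (childSum c i + a) := by
        rw [cycSucc, ← hac, add_assoc]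
      rw [he] at hs hd
      refine ⟨s, ?_, hd⟩
      rw [rot_pow_succ, hs, ← hac, ← hrot, hS2]

/-- The darts `S j` form a closed path at height `k + 1`. It never turns back (`hnf`), and each
vertex of the cycle carries just two horizontal darts, so the path follows the cycle in one sense.
Distinct `S j` follow distinct tree edges, hence none is repeated; every vertex of this height has a
downward dart, hence none is missed. -/
theorem exists_rightLevel (h : Strip G k n c R u) (hc : G.graph.Connected) (hG : G.LocallyFinite)
    (htri : ∀ d, G.ht d ≤ k + 1 → G.ht (G.flip d) ≤ k + 1 →
      G.facePerm (G.facePerm (G.facePerm d)) = d) (hcyc : G.CycleAt (k + 1)) :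
    ∃ S, RightLevel G (k + 1) (childSum c n) S ∧ IsNextLevel G n c u S := by
  set S : ℕ → G.Dart := fun j => G.rot.symm (G.flip (u (parentIdx c n j) (siblingIdx c n j)))
  have hS : IsNextLevel G n c u S := h.isNextLevel htri
  refine ⟨S, ?_, hS⟩
  obtain ⟨m, e, he⟩ := hcyc.exists_label
  have hpos : 0 < childSum c n := h.exists_child hc hG hS ⟨e 0, he.ht_eq 0, he.ht_flip 0⟩
  have hrotS : ∀ j < childSum c n, G.ht (G.flip (G.rot (S j))) = k := fun j hj => by
    obtain ⟨i, hi, a, ha, rfl⟩ := exists_cell hj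
    rw [(hS i hi a ha).1, G.flip_flip]
    exact (h.ht_up i hi a (Or.inl ha)).1
  have hhtS : ∀ j < childSum c n, G.ht (S j) = k + 1 := fun j hj => by
    obtain ⟨i, hi, a, ha, rfl⟩ := exists_cell hj
    rw [← ht_rot, (hS i hi a ha).1]
    exact (h.ht_up i hi a (Or.inl ha)).2
  have hfS : ∀ j < childSum c n, G.ht (G.flip (S j)) = k + 1 := fun j hj => by
    obtain ⟨i, hi, a, ha, rfl⟩ := exists_cell hj
    rw [← (hS i hi a ha).2, ht_rot]
    exact (h.ht_rot_up hi ha).2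
  have hinjS : ∀ i < childSum c n, ∀ j < childSum c n, S i = S j → i = j := by
    intro i hi j hj hij
    obtain ⟨i, hi', a, ha, rfl⟩ := exists_cell hi
    obtain ⟨j, hj', b, hb, rfl⟩ := exists_cell hj
    have h1 := (hS i hi' a ha).1
    rw [hij, (hS j hj' b hb).1] at h1
    obtain ⟨rfl, rfl⟩ := h.inj _ hj' _ (Or.inl hb) _ hi' _ (Or.inl ha) (G.flip.injective h1)
    rfl
  have hvert : ∀ j < childSum c n,
      G.rot.SameCycle (S (cycSucc (childSum c n) j)) (G.flip (S j)) := fun j hj => by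
    obtain ⟨s, hs, -⟩ := h.down_arc_next hS hj
    exact hs ▸ sameCycle_pow _ _
  -- If the path turned back, a full turn at that vertex would meet only downward darts besides this
  -- one. But a cycle has two horizontal darts at each vertex, even when it is a single loop.
  have hnf : ∀ j < childSum c n, S (cycSucc (childSum c n) j) ≠ G.flip (S j) := by
    intro j hj hbad
    set d := S (cycSucc (childSum c n) j) with hd
    have hsj := cycSucc_lt hj
    obtain ⟨s, hs, hdn⟩ := h.down_arc_next hS hj
    rw [← hd] at hs hdn
    rw [← hbad] at hs
    have hper : Function.minimalPeriod G.rot d ≤ s + 2 := by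
      refine Function.IsPeriodicPt.minimalPeriod_le (by omega) ?_
      change G.rot^[s + 2] d = d
      rw [← Equiv.Perm.coe_pow]; exact hs
    have honly : ∀ d', G.rot.SameCycle d d' → G.ht (G.flip d') = k + 1 → d' = d := by
      intro d' hdd' hf
      obtain ⟨t, ht, rfl⟩ := exists_pow_of_sameCycle (hG.minimalPeriod_pos d) hdd'
      rcases Nat.eq_zero_or_pos t with rfl | ht0
      · rfl
      · have := hdn (t - 1) (by omega)
        rw [Nat.sub_add_cancel ht0] at this
        omega
    obtain ⟨x, hx | hx⟩ := he.horizontal d (hhtS _ hsj) (hfS _ hsj)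
    · have h1 := he.vert_flip (x - 1)
      rw [sub_add_cancel, ← hx] at h1
      have h2 := honly _ h1.symm (by rw [G.flip_flip]; exact he.ht_eq _)
      exact he.ne_flip x (x - 1) (by rw [← hx, h2])
    · have h1 := he.vert_flip x
      rw [← hx] at h1
      have h2 := honly _ h1 (he.ht_flip _)
      exact he.ne_flip (x + 1) x (by rw [h2, hx])
  -- Orient the cycle along `S 0`.
  obtain ⟨e', he', x₀, hx₀⟩ : ∃ e', CycleLabel G (k + 1) m e' ∧ ∃ x, S 0 = e' x := by
    obtain ⟨x, hx | hx⟩ := he.horizontal (S 0) (hhtS 0 hpos) (hfS 0 hpos)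
    · exact ⟨e, he, x, hx⟩
    · exact ⟨_, he.reverse, -x, by rw [neg_neg]; exact hx⟩
  have hlab : ∀ j < childSum c n, ∃ x, S j = e' x := by
    refine cyc_induction hpos ⟨x₀, hx₀⟩ fun j hj ⟨x, hx⟩ => ?_
    have hsj := cycSucc_lt hj
    have h1 := (hvert j hj).symm
    rw [hx] at h1
    rcases he'.horizontal_at ((he'.vert_flip x).symm.trans h1) (hfS _ hsj) with h2 | h2
    · exact ⟨_, h2⟩
    · rw [add_sub_cancel_right, ← hx] at h2
      exact absurd h2 (hnf j hj)
  have huniq : ∀ i < childSum c n, ∀ j < childSum c n, G.rot.SameCycle (S i) (S j) → i = j := by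
    intro i hi j hj hij
    obtain ⟨x, hx⟩ := hlab i hi
    obtain ⟨y, hy⟩ := hlab j hj
    refine hinjS i hi j hj ?_
    rw [hx, hy] at hij ⊢
    rw [he'.uniq x y hij]
  have hcover : ∀ d, G.ht d = k + 1 → ∃ i < childSum c n, G.rot.SameCycle (S i) d := by
    intro d hd
    obtain ⟨d', hdd', hd'⟩ := exists_lower hc d (by omega)
    have hht := ht_eq_of_sameCycle hdd'
    obtain ⟨i, hi, a, ha, hda⟩ := h.exists_down (d := d') (by omega) (by omega)
    rcases ha with ha | ⟨rfl, hk⟩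
    · refine ⟨_, childSum_add_lt hi ha, ?_⟩
      refine Equiv.Perm.sameCycle_apply_left.1 ?_
      rw [(hS i hi a ha).1, ← hda]
      exact hdd'.symm
    · obtain ⟨s, hs, -⟩ := h.exists_right_before hS hk hpos i hi (c i) le_rfl
      refine ⟨if childSum c i + c i < childSum c n then childSum c i + c i else 0, ?_,
        (sameCycle_pow _ (s + 1)).trans ?_⟩
      · split_ifs <;> omega
      · rw [hs, ← hda]; exact hdd'.symm
  refine ⟨hpos, hhtS, hfS, huniq, hcover, ?_, ?_, hvert, ?_, ?_⟩
  · intro d h1 h2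
    obtain ⟨x, hx⟩ := he'.horizontal d h1 h2
    obtain ⟨i, hi, hix⟩ := hcover (e' x) (he'.ht_eq x)
    obtain ⟨y, hy⟩ := hlab i hi
    rw [hy] at hix
    refine ⟨i, hi, ?_⟩
    rw [hy, he'.uniq y x hix]
    exact hx
  · intro i hi j hj hij
    obtain ⟨x, hx⟩ := hlab i hi
    obtain ⟨y, hy⟩ := hlab j hj
    rw [hx, hy] at hij
    exact he'.ne_flip x y hij
  · intro i hi
    rw [hrotS i hi]
  · intro d h1 h2
    rcases h.rot_down_cases hS h1 (by omega) with h3 | h3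
    · exact Or.inr h3
    · exact Or.inl (by omega)

end Strip

end RootedMap

/-- Dependent choice up to the height `K`; from there on the sequence is arbitrary. -/
theorem exists_seq_of_step {X : Type*} {K : ℕ} {P : ℕ → X → Prop} {T : ℕ → X → X → Prop}
    (h0 : ∃ x, P 0 x) (hs : ∀ k x, k + 1 < K → P k x → ∃ y, P (k + 1) y ∧ T k x y) :
    ∃ s : ℕ → X, (∀ k < K, P k (s k)) ∧ ∀ k, k + 1 < K → T k (s k) (s (k + 1)) := by
  classical
  obtain ⟨x₀, hx₀⟩ := h0
  have : ∀ k x, ∃ y, k + 1 < K → P k x → P (k + 1) y ∧ T k x y := by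
    intro k x
    by_cases h : k + 1 < K ∧ P k x
    · obtain ⟨y, hy⟩ := hs k x h.1 h.2
      exact ⟨y, fun _ _ => hy⟩
    · exact ⟨x, fun h1 h2 => absurd ⟨h1, h2⟩ h⟩
  choose F hF using this
  let s : ℕ → X := fun k => Nat.rec x₀ (fun k x => F k x) k
  have hP : ∀ k < K, P k (s k) := by
    intro k
    induction k with
    | zero => exact fun _ => hx₀
    | succ k ih => exact fun hk => (hF k (s k) hk (ih (by omega))).1
  exact ⟨s, hP, fun k hk => (hF k (s k) hk (hP k (by omega))).2⟩

/-! ### The decorated top level -/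

namespace RootedMap

variable {G : RootedMap}

theorem Strip.congr {k n : ℕ} {c c' : ℕ → ℕ} {R : ℕ → G.Dart} {u : ℕ → ℕ → G.Dart}
    (h : Strip G k n c R u) (hcc : ∀ i < n, c i = c' i) : Strip G k n c' R u := by
  have h00 := hcc 0 h.n_pos
  refine ⟨h.n_pos, fun hk => by rw [← h00]; exact h.zero hk, fun i hi a ha => ?_,
    fun i hi a ha j hj b hb => ?_, fun d h1 h2 => ?_, fun i hi a ha => ?_, fun hk i hi => ?_,
    h.rot_left, fun hk i hi => ?_⟩
  · rw [← hcc i hi] at ha; exact h.ht_up i hi a ha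
  · rw [← hcc i hi] at ha; rw [← hcc j hj] at hb; exact h.inj i hi a ha j hj b hb
  · obtain ⟨i, hi, a, ha, he⟩ := h.surj d h1 h2
    exact ⟨i, hi, a, by rwa [← hcc i hi], he⟩
  · rw [← hcc i hi] at ha; rw [← h00]; exact h.rot_child i hi a ha
  · rw [← hcc i hi]; exact h.rot_last hk i hi
  · rw [← hcc i hi]; exact h.rot_flip hk i hi

theorem face_facePerm (d : G.Dart) : G.face (G.facePerm d) = G.face d :=
  Quotient.sound ⟨-1, by simp⟩

theorem facePerm_three {d : G.Dart} (h : G.faceDegree d = 3) :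
    G.facePerm (G.facePerm (G.facePerm d)) = d := by
  have := Function.isPeriodicPt_minimalPeriod G.facePerm d
  unfold faceDegree at h
  rw [h] at this
  exact this

namespace IsFiniteCT

variable {K : ℕ}

theorem facePerm_three_of_lt (h : G.IsFiniteCT K) {d : G.Dart} (h1 : G.ht d < K)
    (h2 : G.ht (G.flip d) < K) : G.facePerm (G.facePerm (G.facePerm d)) = d := by
  obtain ⟨-, -, -, -, -, -, -, ext, htri, hext, -⟩ := h
  refine facePerm_three (htri d fun he => ?_)
  rcases hext d he with h3 | h3 <;> omega

theorem exists_up (h : G.IsFiniteCT K) {k : ℕ} (hk : k < K) :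
    ∃ d, G.ht d = k ∧ G.ht (G.flip d) = k + 1 := by
  obtain ⟨hK, hc, -, -, -, -, hcyc, ext, -, -, -, hlast⟩ := h
  obtain ⟨m, e, he⟩ := (hcyc (K - 1) (by omega) (by omega)).exists_label
  obtain ⟨d, ⟨-, hd⟩, -⟩ := hlast (e 0) (he.ht_eq 0) (he.ht_flip 0)
  obtain ⟨d', h1, h2⟩ := exists_ht_eq hc (m := k + 1) (by omega) _ (by rw [hd]; omega)
  exact ⟨G.flip d', by omega, by rw [G.flip_flip]; exact h1⟩

/-- A vertex of height `K` has two darts, one on the exterior face and one on a triangle. The dart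
`flip (u i (c i))` borders the triangle on `R i`, so its partner `flip (u (cycSucc n i) 0)` is
exterior; this excludes `c i = 0`. A dart `flip (u i a)` with `a < c i` is exterior as well, since a
triangle there would have a side joining two vertices of height `K`. If `1 < c i`, the partner of
`flip (u i 1)` would be some `flip (u j (c j))`, which already has another partner. -/
theorem top_strip (h : G.IsFiniteCT K) {k n : ℕ} (hk : k + 1 = K) {c : ℕ → ℕ} {R : ℕ → G.Dart}
    {u : ℕ → ℕ → G.Dart} (hR : RightLevel G k n R) (hs : Strip G k n c R u) :
    ∀ i < n, c i = 1 ∧ G.rot (G.flip (u i 1)) = G.flip (u (cycSucc n i) 0) := by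
  obtain ⟨hK, -, -, -, -, -, -, ext, htri, hext, htop, -⟩ := h
  subst hk
  have hk : 0 < k := by omega
  have hK' : ∀ d, G.ht d = k + 1 → G.rot (G.rot d) = d ∧
      (G.face d = ext ↔ G.face (G.rot d) ≠ ext) := fun d hd =>
    ⟨(htop d hd).2.1, (htop d hd).2.2.2⟩
  have hw : ∀ i < n, ∀ a ≤ c i, G.ht (G.flip (u i a)) = k + 1 := fun i hi a ha =>
    (hs.ht_up i hi a (by omega)).2
  have hlast : ∀ i < n, G.face (G.flip (u i (c i))) ≠ ext := by
    intro i hi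
    have h1 : G.facePerm (G.flip (u i (c i))) = R i := by
      rw [facePerm_apply, G.flip_flip, hs.rot_last hk i hi]
    rw [← face_facePerm, h1]
    intro he
    have h2 := hR.ht_right i hi
    have h3 := hR.ht_flip i hi
    rcases hext _ he with h4 | h4 <;> omega
  have hfirst : ∀ i < n, G.face (G.flip (u i 0)) = ext := by
    intro i hi
    have hp := cycPred_lt hi
    have h1 := hs.rot_flip hk _ hp
    rw [cycSucc_cycPred hi] at h1
    refine (hK' _ (hw i hi 0 (Nat.zero_le _))).2.2 ?_
    rw [h1]
    exact hlast _ hp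
  have hpos : ∀ i < n, 0 < c i := by
    intro i hi
    by_contra h0
    have h1 := hlast i hi
    rw [show c i = 0 by omega] at h1
    exact h1 (hfirst i hi)
  have hinner : ∀ i < n, ∀ a < c i, G.face (G.flip (u i a)) = ext := by
    intro i hi a ha
    by_contra hne
    have h1 := facePerm_three (htri _ hne)
    have h2 : G.facePerm (G.flip (u i a)) = u i (a + 1) := by
      rw [facePerm_apply, G.flip_flip, hs.rot_child i hi a ha, if_neg (by omega)]
    have h3 : G.ht (G.facePerm (G.facePerm (u i (a + 1)))) = k := by
      rw [ht_facePerm]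
      have h5 : G.ht (G.facePerm (u i (a + 1))) = k + 1 := by
        rw [ht_facePerm]; exact hw i hi (a + 1) ha
      have := (htop _ h5).2.2.1
      omega
    rw [h2] at h1
    rw [h1, hw i hi a ha.le] at h3
    omega
  have hone : ∀ i < n, c i = 1 := by
    intro i hi
    by_contra hne
    have h2 : 1 < c i := by have := hpos i hi; omega
    have hht := hw i hi 1 h2.le
    have h3 := (hK' _ hht).2.1 (hinner i hi 1 h2)
    obtain ⟨j, hj, b, hb, he⟩ := hs.exists_down (d := G.rot (G.flip (u i 1)))
      (by rw [ht_rot]; exact hht) (by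
        have := (htop (G.rot (G.flip (u i 1))) (by rw [ht_rot]; exact hht)).2.2.1
        omega)
    rcases hb with hb | ⟨rfl, -⟩
    · rw [he] at h3
      exact h3 (hinner j hj b hb)
    · have h4 := hs.rot_flip hk j hj
      have h5 := (hK' _ hht).1
      rw [he, ← h4, (hK' _ (hw _ (cycSucc_lt hj) 0 (Nat.zero_le _))).1] at h5
      obtain ⟨-, h6⟩ := hs.inj _ (cycSucc_lt hj) 0 (by omega) i hi 1 (Or.inl h2)
        (G.flip.injective h5)
      omega
  refine fun i hi => ⟨hone i hi, ?_⟩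
  have h1 := hs.rot_flip hk i hi
  rw [hone i hi] at h1
  rw [← h1, (hK' _ (hw _ (cycSucc_lt hi) 0 (Nat.zero_le _))).1]

end IsFiniteCT

end RootedMap

/-! ### Isomorphism with the triangulation of the tree read off -/

namespace LayerCode

open RootedMap StripDart

variable {G : RootedMap} {C : LayerCode}

/-- The dart of a map in which the levels and strips are labelled as in a layer code. -/
def toDart (u : ℕ → ℕ → ℕ → G.Dart) (R : ℕ → ℕ → G.Dart) : StripDart → G.Dart
  | up k i a => u k i a
  | down k i a => G.flip (u k i a)
  | right k i => R k i
  | left k i => G.flip (R k i)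

theorem iso_of_strips {u : ℕ → ℕ → ℕ → G.Dart} {R : ℕ → ℕ → G.Dart} (hG : G.IsFiniteCT C.top)
    (hs : ∀ k < C.top, Strip G k (C.n k) (C.c k) (R k) (u k))
    (hR : ∀ k < C.top, 0 < k → RightLevel G k (C.n k) (R k))
    (hN : ∀ k, k + 1 < C.top → IsNextLevel G (C.n k) (C.c k) (u k) (R (k + 1)))
    (ht : ∀ k, k + 1 = C.top → ∀ i < C.n k, G.rot (G.flip (u k i 1)) =
      G.flip (u k (cycSucc (C.n k) i) 0)) (hr : u 0 0 0 = G.root) : Iso C.toRootedMap G := by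
  have hK : 2 ≤ C.top := hG.1
  have hB : ∀ {k}, C.Below k → k < C.top := fun h => h.resolve_left (by omega)
  have hflip : ∀ d, toDart u R (flipFun d) = G.flip (toDart u R d) := by
    rintro (_ | _ | _ | _) <;> simp [flipFun, toDart, G.flip_flip]
  have hrot : ∀ d, C.Ok d → toDart u R (C.rotFun d) = G.rot (toDart u R d) := by
    rintro (⟨k, i, a⟩ | ⟨k, i, _ | a⟩ | ⟨k, i⟩ | ⟨k, i⟩)
    · rintro ⟨hk, hi, ha⟩
      simp only [rotFun]
      by_cases h1 : a < C.c k i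
      · rw [if_pos h1]
        change _ = G.rot (u k i a)
        rw [(hs k (hB hk)).rot_child i hi a h1]
        split_ifs with h2 h3 h3
        · rw [h2.1]; rfl
        · exact absurd ⟨h2.1, by rw [h2.1]; exact h2.2⟩ h3
        · exact absurd ⟨h3.1, by have := h3.2; rwa [h3.1] at this⟩ h2
        · rfl
      · rw [if_neg h1]
        obtain ⟨rfl, hk0⟩ := ha.resolve_left h1
        exact ((hs k (hB hk)).rot_last hk0 i hi).symm
    · rintro ⟨hk, hi, ha⟩
      simp only [rotFun]
      split_ifs with h0
      · subst h0
        obtain rfl : i = 0 := by rw [n_zero] at hi; omega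
        have hc := c_zero_pos (C := C)
        have h1 := (hs 0 (by omega)).rot_child 0 one_pos (C.c 0 0 - 1) (by omega)
        rw [if_pos ⟨rfl, by omega⟩] at h1
        have h2 := (hN 0 (by omega) 0 one_pos (C.c 0 0 - 1) (by omega)).2
        rw [h1, childSum_zero] at h2
        simp only [zero_add] at h2
        exact h2.symm
      · have h1 := (hs k (hB hk)).rot_flip (by omega) _ (cycPred_lt hi)
        rw [cycSucc_cycPred hi] at h1
        exact h1.symm
    · rintro ⟨hk, hi, ha⟩
      simp only [rotFun]
      split_ifs with h0
      · rw [C.top_eq k h0] at ha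
        obtain rfl : a = 0 := by omega
        exact (ht k h0 i hi).symm
      · have ha' : a < C.c k i := by omega
        have h1 := (hs k (hB hk)).rot_child i hi a ha'
        rw [if_neg] at h1
        · have h2 := (hN k (by have := hB hk; omega) i hi a ha').2
          rw [h1] at h2
          exact h2.symm
        · rintro ⟨rfl, h3⟩
          obtain rfl : i = 0 := by rw [n_zero] at hi; omega
          omega
    · rintro ⟨h0, hk, hi⟩
      have h := lt_childSum_of_ok h0 hi
      obtain ⟨k, rfl⟩ : ∃ m, k = m + 1 := ⟨k - 1, by omega⟩
      simp only [rotFun, Nat.add_sub_cancel] at h ⊢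
      have h1 := (hN k (hB hk) _ (parentIdx_lt h) _ (siblingIdx_lt h)).1
      rw [childSum_add_siblingIdx] at h1
      exact h1.symm
    · rintro ⟨h0, hk, hi⟩
      exact ((hs k (hB hk)).rot_left h0 i hi).symm
  -- The heights of the two ends separate upward, downward and horizontal darts; `ne_flip` separates
  -- `right` from `left`.
  have hinj : ∀ d d', C.Ok d → C.Ok d' → toDart u R d = toDart u R d' → d = d' := by
    have hht : ∀ d, C.Ok d → G.ht (toDart u R d) = level d ∧
        G.ht (G.flip (toDart u R d)) = level (flipFun d) := by
      rintro (⟨k, i, a⟩ | ⟨k, i, a⟩ | ⟨k, i⟩ | ⟨k, i⟩)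
      · rintro ⟨hk, hi, ha⟩
        exact (hs k (hB hk)).ht_up i hi a ha
      · rintro ⟨hk, hi, ha⟩
        have := (hs k (hB hk)).ht_up i hi a ha
        exact ⟨this.2, by simp only [toDart, G.flip_flip]; exact this.1⟩
      · rintro ⟨h0, hk, hi⟩
        exact ⟨(hR k (hB hk) h0).ht_right i hi, (hR k (hB hk) h0).ht_flip i hi⟩
      · rintro ⟨h0, hk, hi⟩
        exact ⟨(hR k (hB hk) h0).ht_flip i hi,
          by simp only [toDart, G.flip_flip]; exact (hR k (hB hk) h0).ht_right i hi⟩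
    intro d d' hd hd' heq
    have h1 := hht d hd
    have h2 := hht d' hd'
    rw [heq] at h1
    have h3 := h1.1.symm.trans h2.1
    have h4 := h1.2.symm.trans h2.2
    clear h1 h2
    rcases d with ⟨k, i, a⟩ | ⟨k, i, a⟩ | ⟨k, i⟩ | ⟨k, i⟩ <;>
      rcases d' with ⟨k', i', a'⟩ | ⟨k', i', a'⟩ | ⟨k', i'⟩ | ⟨k', i'⟩ <;>
      simp only [level, flipFun] at h3 h4 <;> try omega
    · subst h3
      obtain ⟨rfl, rfl⟩ := (hs k (hB hd.1)).inj i hd.2.1 a hd.2.2 i' hd'.2.1 a' hd'.2.2 heq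
      rfl
    · obtain rfl : k = k' := by omega
      obtain ⟨rfl, rfl⟩ := (hs k (hB hd.1)).inj i hd.2.1 a hd.2.2 i' hd'.2.1 a' hd'.2.2
        (G.flip.injective heq)
      rfl
    · subst h3
      have hRk := hR k (hB hd.2.1) hd.1
      have h5 : R k i = R k i' := heq
      rw [hRk.uniq i hd.2.2 i' hd'.2.2 (h5 ▸ Equiv.Perm.SameCycle.refl _ _)]
    · subst h3
      exact absurd heq ((hR k (hB hd.2.1) hd.1).ne_flip i hd.2.2 i' hd'.2.2)
    · subst h3
      exact absurd heq.symm ((hR k (hB hd.2.1) hd.1).ne_flip i' hd'.2.2 i hd.2.2)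
    · subst h3
      have hRk := hR k (hB hd.2.1) hd.1
      have h5 : R k i = R k i' := G.flip.injective heq
      rw [hRk.uniq i hd.2.2 i' hd'.2.2 (h5 ▸ Equiv.Perm.SameCycle.refl _ _)]
  have hsurj : ∀ d, ∃ d', C.Ok d' ∧ toDart u R d' = d := by
    have hup : ∀ d, G.ht (G.flip d) = G.ht d + 1 → ∃ d', C.Ok d' ∧ toDart u R d' = d := by
      intro d hd
      have hle := hG.2.2.2.2.2.1 (G.flip d)
      obtain ⟨i, hi, a, ha, he⟩ := (hs (G.ht d) (by omega)).surj d rfl hd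
      exact ⟨up (G.ht d) i a, ⟨Or.inr (by omega), hi, ha⟩, he.symm⟩
    intro d
    have h1 := ht_flip_le hG.2.1 d
    have h2 := ht_le_flip hG.2.1 d
    rcases (show G.ht (G.flip d) = G.ht d + 1 ∨ G.ht d = G.ht (G.flip d) + 1 ∨
      G.ht (G.flip d) = G.ht d by omega) with h3 | h3 | h3
    · exact hup d h3
    · obtain ⟨d', hd', he⟩ := hup (G.flip d) (by rw [G.flip_flip]; exact h3)
      exact ⟨flipFun d', ok_flipFun d' hd', by rw [hflip, he, G.flip_flip]⟩
    · have hle := hG.2.2.2.2.2.1 d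
      have h0 : 0 < G.ht d := by
        by_contra h0
        exact hG.2.2.2.2.1 d (by omega) (by omega)
      have hlt : G.ht d < C.top := by
        obtain ⟨-, -, -, -, -, -, -, ext, -, -, htop, -⟩ := hG
        by_contra hge
        have h4 : G.ht d = C.top := by omega
        have := (htop d h4).2.2.1
        omega
      obtain ⟨i, hi, he⟩ := (hR _ hlt h0).horizontal d rfl h3
      rcases he with he | he
      · exact ⟨right (G.ht d) i, ⟨h0, Or.inr hlt, hi⟩, he.symm⟩
      · exact ⟨left (G.ht d) i, ⟨h0, Or.inr hlt, hi⟩, he.symm⟩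
  refine ⟨Equiv.ofBijective (fun d => toDart u R d.1) ⟨fun d d' h =>
    Subtype.ext (hinj _ _ d.2 d'.2 h), fun d => ?_⟩, hr, fun d => hrot d.1 d.2, fun d => hflip d.1⟩
  obtain ⟨d', hd', he⟩ := hsurj d
  exact ⟨⟨d', hd'⟩, he⟩

end LayerCode

namespace RootedMap

/-- Every finite causal triangulation is encoded by a plane tree. -/
theorem IsFiniteCT.exists_layerCode {G : RootedMap} {K : ℕ} (hG : G.IsFiniteCT K) :
    ∃ C : LayerCode, C.top = K ∧ Iso C.toRootedMap G := by
  have hK := hG.1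
  have hc := hG.2.1
  have hl := hG.2.2.1
  have hcyc := hG.2.2.2.2.2.2.1
  obtain ⟨s, hs, hst⟩ := exists_seq_of_step (K := K)
    (X := ℕ × (ℕ → ℕ) × (ℕ → G.Dart) × (ℕ → ℕ → G.Dart))
    (P := fun k x => Strip G k x.1 x.2.1 x.2.2.1 x.2.2.2 ∧
      (0 < k → RightLevel G k x.1 x.2.2.1) ∧ (k = 0 → x.1 = 1 ∧ x.2.2.2 0 0 = G.root))
    (T := fun _ x y => IsNextLevel G x.1 x.2.1 x.2.2.2 y.2.2.1 ∧ y.1 = childSum x.2.1 x.1)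
    (by
      obtain ⟨c, u, h, hu⟩ := exists_strip_zero hc hl hG.2.2.2.2.1 fun _ => G.root
      exact ⟨(1, c, _, u), h, fun h => absurd h (lt_irrefl 0), fun _ => ⟨rfl, hu⟩⟩)
    (by
      rintro k ⟨n, c, R, u⟩ hk ⟨h1, -, -⟩
      obtain ⟨S, hS, hN⟩ := h1.exists_rightLevel hc hl (fun d h2 h3 =>
        hG.facePerm_three_of_lt (by omega) (by omega)) (hcyc _ (by omega) hk)
      obtain ⟨c', u', hst⟩ := hS.exists_strip (by omega) hc hl (fun d h2 h3 =>
        hG.facePerm_three_of_lt (by omega) (by omega)) (hG.exists_up hk)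
      exact ⟨(_, c', S, u'), ⟨hst, fun _ => hS, fun h => absurd h (by omega)⟩, hN, rfl⟩)
  -- From the last strip on the numbers of children are set to `1`, as `top_eq` asks for all
  -- indices. By `htop` this changes nothing at the vertices of the last strip.
  set c : ℕ → ℕ → ℕ := fun k => if k + 1 < K then (s k).2.1 else fun _ => 1 with hcdef
  have hcl : ∀ k, k + 1 < K → c k = (s k).2.1 := fun k hk => if_pos hk
  have hcg : ∀ k, ¬ k + 1 < K → c k = fun _ => 1 := fun k hk => if_neg hk
  have hn : ∀ k < K, levelSize c k = (s k).1 := by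
    intro k
    induction k with
    | zero => intro h; exact ((hs 0 h).2.2 rfl).1.symm
    | succ k ih =>
      intro h
      rw [levelSize_succ, ih (by omega), hcl k h, (hst k h).2]
  have hpos : ∀ k, 0 < levelSize c k := by
    intro k
    induction k with
    | zero => exact one_pos
    | succ k ih =>
      by_cases h : k + 1 < K
      · rw [hn _ h]; exact (hs _ h).1.n_pos
      · rw [levelSize_succ, hcg k h]
        simpa [childSum] using ih
  have htop : ∀ k, k + 1 = K → ∀ i < (s k).1, (s k).2.1 i = 1 ∧
      G.rot (G.flip ((s k).2.2.2 i 1)) = G.flip ((s k).2.2.2 (cycSucc (s k).1 i) 0) := fun k hk =>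
    hG.top_strip hk ((hs k (by omega)).2.1 (by omega)) (hs k (by omega)).1
  let C : LayerCode := ⟨c, K, by omega, hpos, fun k hk i => by rw [hcg k (by omega)]⟩
  refine ⟨C, rfl, LayerCode.iso_of_strips (C := C) (u := fun k => (s k).2.2.2)
    (R := fun k => (s k).2.2.1) hG ?_ ?_ ?_ ?_ ((hs 0 (by omega)).2.2 rfl).2⟩
  · intro k hk
    change Strip G k (levelSize c k) (c k) _ _
    rw [hn k hk]
    by_cases h : k + 1 < K
    · rw [hcl k h]; exact (hs k hk).1
    · rw [hcg k h]
      have hk' : k < K := hk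
      exact (hs k hk).1.congr fun i hi => (htop k (by omega) i hi).1
  · intro k hk h0
    change RightLevel G k (levelSize c k) _
    rw [hn k hk]
    exact (hs k hk).2.1 h0
  · intro k hk
    have hk' : k + 1 < K := hk
    change IsNextLevel G (levelSize c k) (c k) _ _
    rw [hn k (by omega), hcl k hk]
    exact (hst k hk).1
  · intro k hk i hi
    have hk' : k + 1 = K := hk
    change i < levelSize c k at hi
    change _ = G.flip ((s k).2.2.2 (cycSucc (levelSize c k) i) 0)
    rw [hn k (by omega)] at hi ⊢
    exact (htop k hk i hi).2

end RootedMap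

/-! ### The tree is determined by its triangulation -/

namespace LayerCode

open RootedMap StripDart

variable {C D : LayerCode}

/-- Isomorphic triangulations have the same code. -/
theorem eq_of_iso (h : Iso C.toRootedMap D.toRootedMap) (ht : C.top = D.top) :
    ∀ k, C.Below k → C.n k = D.n k ∧ ∀ i < C.n k, C.c k i = D.c k i := by
  obtain ⟨f, h1, h2, h3⟩ := h
  have hlev : ∀ d h d' h', f (C.dart d h) = D.dart d' h' → level d = level d' := by
    intro d h d' h' e
    rw [← ht_dart h, ← ht_dart h', ← e]
    exact ((ht_map connected_and_ht_eq_level.1 f h1 h2 h3).2 _).symm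
  have hB : ∀ {k}, C.Below k → D.Below k := by
    intro k hk; unfold Below at *; rwa [← ht]
  -- An isomorphism preserves the root dart, rotation, reversal and heights, so it respects the
  -- labels of the darts one after another. The number of children is the number of turns before the
  -- far end changes height, or, at the root, before the root dart returns.
  let Fix : StripDart → Prop := fun d => ∃ h h', f (C.dart d h) = D.dart d h'
  have hrot : ∀ d, Fix d → ∃ h h', f (C.dart (C.rotFun d) h) = D.dart (D.rotFun d) h' := by
    rintro d ⟨h, h', e⟩
    refine ⟨ok_rotFun d h, ok_rotFun d h', ?_⟩
    rw [← rot_dart (h := h) rfl, ← rot_dart (h := h') rfl, h2, e]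
  have hflip : ∀ d, Fix d → Fix (flipFun d) := by
    rintro d ⟨h, h', e⟩
    exact ⟨ok_flipFun d h, ok_flipFun d h',
      (h3 (C.dart d h)).trans (congrArg D.toRootedMap.flip e)⟩
  have hinv : ∀ d d', C.Ok d → D.Ok d → C.rotFun d = d' → D.rotFun d = d' → Fix d' → Fix d := by
    rintro d d' h h' e e' ⟨k, k', ek⟩
    subst e
    refine ⟨h, h', D.toRootedMap.rot.injective ?_⟩
    rw [← h2, rot_dart (h := h) rfl, rot_dart (h := h') e']
    exact ek
  have hroot : Fix (up 0 0 0) := ⟨⟨below_zero, one_pos, Or.inl c_zero_pos⟩,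
    ⟨below_zero, one_pos, Or.inl c_zero_pos⟩, h1⟩
  have hlevrot : ∀ d, Fix d → level (flipFun (C.rotFun d)) = level (flipFun (D.rotFun d)) := by
    intro d hd
    obtain ⟨h, h', e⟩ := hrot d hd
    exact hlev _ (ok_flipFun _ h) _ (ok_flipFun _ h')
      ((h3 (C.dart _ h)).trans (congrArg D.toRootedMap.flip e))
  have hzero : C.c 0 0 = D.c 0 0 ∧ ∀ a < C.c 0 0, Fix (up 0 0 a) := by
    have key : ∀ a, Fix (up 0 0 a) → a < C.c 0 0 → a < D.c 0 0 →
        (a + 1 = C.c 0 0 ↔ a + 1 = D.c 0 0) := by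
      intro a ha hC hD
      obtain ⟨h, h', e⟩ := hrot _ ha
      have hCr : C.dart (C.rotFun (up 0 0 a)) h = C.toRootedMap.root ↔ a + 1 = C.c 0 0 := by
        refine Subtype.ext_iff.trans ?_
        change C.rotFun (up 0 0 a) = up 0 0 0 ↔ _
        simp only [rotFun, if_pos hC]
        split_ifs with h0
        · simp [h0.2]
        · simp only [true_and] at h0; simp [h0]
      have hDr : D.dart (D.rotFun (up 0 0 a)) h' = D.toRootedMap.root ↔ a + 1 = D.c 0 0 := by
        refine Subtype.ext_iff.trans ?_
        change D.rotFun (up 0 0 a) = up 0 0 0 ↔ _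
        simp only [rotFun, if_pos hD]
        split_ifs with h0
        · simp [h0.2]
        · simp only [true_and] at h0; simp [h0]
      rw [← hCr, ← hDr, ← e, ← h1]
      exact f.injective.eq_iff.symm
    have hind : ∀ a < C.c 0 0, a < D.c 0 0 ∧ Fix (up 0 0 a) := by
      intro a
      induction a with
      | zero => exact fun _ => ⟨c_zero_pos, hroot⟩
      | succ a ih =>
        intro ha
        obtain ⟨h4, h5⟩ := ih (by omega)
        have h6 := key a h5 (by omega) h4
        have h7 : a + 1 < D.c 0 0 := by omega
        refine ⟨h7, ?_⟩
        obtain ⟨h, h', e⟩ := hrot _ h5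
        have e1 : C.rotFun (up 0 0 a) = up 0 0 (a + 1) := by
          simp only [rotFun]; rw [if_pos (by omega), if_neg (by omega)]
        have e2 : D.rotFun (up 0 0 a) = up 0 0 (a + 1) := by
          simp only [rotFun]; rw [if_pos (by omega), if_neg (by omega)]
        simp only [e1, e2] at h h' e
        exact ⟨h, h', e⟩
    have hc := c_zero_pos (C := C)
    obtain ⟨h4, h5⟩ := hind (C.c 0 0 - 1) (by omega)
    have h6 := key _ h5 (by omega) h4
    exact ⟨by omega, fun a ha => (hind a ha).2⟩
  have hstrip : ∀ k, 0 < k → C.Below k → ∀ i, i < C.n k → i < D.n k → Fix (right k i) →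
      Fix (up k i 0) → C.c k i = D.c k i ∧ ∀ a ≤ C.c k i, Fix (up k i a) := by
    intro k h0 hk i hi hi' hr hu
    have hind : ∀ a ≤ C.c k i, a ≤ D.c k i ∧ Fix (up k i a) := by
      intro a
      induction a with
      | zero => exact fun _ => ⟨Nat.zero_le _, hu⟩
      | succ a ih =>
        intro ha
        obtain ⟨h4, h5⟩ := ih (by omega)
        have h6 := hlevrot _ h5
        have e1 : C.rotFun (up k i a) = up k i (a + 1) := by
          simp only [rotFun]; rw [if_pos (by omega), if_neg (by omega)]
        have h7 : a < D.c k i := by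
          by_contra h7
          have e2 : D.rotFun (up k i a) = right k i := by simp only [rotFun]; rw [if_neg h7]
          rw [e1, e2] at h6
          simp only [flipFun, level] at h6
          omega
        have e2 : D.rotFun (up k i a) = up k i (a + 1) := by
          simp only [rotFun]; rw [if_pos (by omega), if_neg (by omega)]
        obtain ⟨h, h', e⟩ := hrot _ h5
        simp only [e1, e2] at h h' e
        exact ⟨h7, h, h', e⟩
    refine ⟨?_, fun a ha => (hind a ha).2⟩
    obtain ⟨h4, h5⟩ := hind _ le_rfl
    by_contra hne
    have h6 := hlevrot _ h5
    have e1 : C.rotFun (up k i (C.c k i)) = right k i := by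
      simp only [rotFun]; rw [if_neg (lt_irrefl _)]
    have e2 : D.rotFun (up k i (C.c k i)) = up k i (C.c k i + 1) := by
      simp only [rotFun]; rw [if_pos (by omega), if_neg (by omega)]
    rw [e1, e2] at h6
    simp only [flipFun, level] at h6
    omega
  have main : ∀ k, C.Below k → C.n k = D.n k ∧ ∀ i < C.n k, C.c k i = D.c k i ∧
      ∀ a, (a < C.c k i ∨ a = C.c k i ∧ 0 < k) → Fix (up k i a) := by
    intro k
    induction k with
    | zero =>
      intro _
      refine ⟨rfl, fun i hi => ?_⟩
      obtain rfl : i = 0 := by rw [n_zero] at hi; omega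
      exact ⟨hzero.1, fun a ha => hzero.2 a (by omega)⟩
    | succ k ih =>
      intro hk
      obtain ⟨h4, h5⟩ := ih (by unfold Below at *; omega)
      have hn : C.n (k + 1) = D.n (k + 1) := by
        rw [n_succ, n_succ, ← h4]
        exact childSum_congr (fun i hi => (h5 i hi).1) le_rfl
      refine ⟨hn, ?_⟩
      have hright : ∀ i < C.n (k + 1), Fix (right (k + 1) i) := by
        intro j hj
        have hj' : j < childSum (C.c k) (C.n k) := hj
        obtain ⟨h6, h7⟩ := parentIdx_congr (fun x hx => (h5 x hx).1) hj'
        refine hinv _ _ ⟨by omega, hk, hj⟩ ⟨by omega, hB hk, by rwa [← hn]⟩ rfl ?_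
          (hflip _ ((h5 _ (parentIdx_lt hj')).2 _ (Or.inl (siblingIdx_lt hj'))))
        simp only [rotFun, Nat.add_sub_cancel]
        rw [← h4, h6, h7]
      intro i hi
      have hp := cycPred_lt hi
      have hu : Fix (up (k + 1) i 0) := by
        obtain ⟨h, h', e⟩ := hrot _ (hflip _ (hright _ hp))
        have e1 : C.rotFun (flipFun (right (k + 1) (cycPred (C.n (k + 1)) i))) =
            up (k + 1) i 0 := by
          simp only [flipFun, rotFun, cycSucc_cycPred hi]
        have e2 : D.rotFun (flipFun (right (k + 1) (cycPred (C.n (k + 1)) i))) =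
            up (k + 1) i 0 := by
          simp only [flipFun, rotFun, ← hn, cycSucc_cycPred hi]
        simp only [e1, e2] at h h' e
        exact ⟨h, h', e⟩
      obtain ⟨h6, h7⟩ := hstrip (k + 1) (by omega) hk i hi (by rwa [← hn]) (hright i hi) hu
      exact ⟨h6, fun a ha => h7 a (by omega)⟩
  exact fun k hk => ⟨(main k hk).1, fun i hi => ((main k hk).2 i hi).1⟩

theorem top_eq_of_iso (h : Iso C.toRootedMap D.toRootedMap) (hC : C.top ≠ 0) (hD : D.top ≠ 0) :
    C.top = D.top := by
  have key : ∀ C D : LayerCode, Iso C.toRootedMap D.toRootedMap → C.top ≠ 0 → D.top ≠ 0 →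
      C.top ≤ D.top := by
    intro C D ⟨f, h1, h2, h3⟩ hC hD
    obtain ⟨k, hk⟩ : ∃ k, k + 1 = C.top := ⟨C.top - 1, by omega⟩
    have h4 := (ht_map connected_and_ht_eq_level.1 f h1 h2 h3).2
      (C.dart (down k 0 0) (ok_ext hk (C.pos k) zero_le_one))
    rw [ht_dart, ht_eq] at h4
    have h5 := level_le hD (f (C.dart (down k 0 0) (ok_ext hk (C.pos k) zero_le_one))).2
    rw [h4] at h5
    simp only [level] at h5
    omega
  exact le_antisymm (key C D h hC hD) (key D C h.symm hD hC)

end LayerCode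

section

open Filter Topology

/-! ### Counting plane forests -/

/-- A plane forest with `n` roots, given by the numbers of children of the vertices of its
successive nonempty levels. -/
def IsForest : ℕ → List (List ℕ) → Prop
  | n, [] => n = 0
  | n, c :: l => 0 < n ∧ c.length = n ∧ IsForest c.sum l

/-- The number of vertices above the roots. -/
def forestSize (l : List (List ℕ)) : ℕ := (l.map List.sum).sum

/-- The plane forests with `n` roots and `M` other vertices. -/
def forests (n M : ℕ) : Set (List (List ℕ)) := {l | IsForest n l ∧ forestSize l = M}

/-- The number of plane forests with `n` roots and `M` other vertices. -/
def forestCount : ℕ → ℕ → ℕ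
  | 0, _ => 1
  | M + 1, n => ∑ i ∈ Finset.range n, forestCount M (i + 2)

theorem forestSize_cons (c : List ℕ) (l : List (List ℕ)) :
    forestSize (c :: l) = c.sum + forestSize l := by simp [forestSize]

theorem forestSize_append (p l : List (List ℕ)) :
    forestSize (p ++ l) = forestSize p + forestSize l := by simp [forestSize]

theorem forestCount_zero (n : ℕ) : forestCount 0 n = 1 := by rw [forestCount]

theorem forestCount_succ_zero (M : ℕ) : forestCount (M + 1) 0 = 0 := by
  rw [forestCount, Finset.sum_range_zero]

theorem forestCount_succ_succ (M n : ℕ) :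
    forestCount (M + 1) (n + 1) = forestCount (M + 1) n + forestCount M (n + 2) := by
  rw [forestCount, Finset.sum_range_succ, forestCount]

/-- Forests whose roots are `n` vertices with known numbers of children, and `q` further
vertices. -/
def partialForests (n q M : ℕ) : Set (List ℕ × List (List ℕ)) :=
  {p | p.1.length = n ∧ IsForest (p.1.sum + q) p.2 ∧ p.1.sum + forestSize p.2 = M}

theorem partialForests_succ_zero (n q : ℕ) : partialForests (n + 1) q 0 =
    (fun p : List ℕ × List (List ℕ) => (0 :: p.1, p.2)) '' partialForests n q 0 := by
  ext ⟨c, l⟩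
  constructor
  · rintro ⟨h1, h2, h3⟩
    rcases c with _ | ⟨a, c⟩
    · simp at h1
    · simp only [List.length_cons, List.sum_cons] at h1 h2 h3
      obtain rfl : a = 0 := by omega
      refine ⟨(c, l), ⟨by simp only; omega, ?_, by simp only; omega⟩, rfl⟩
      rwa [zero_add] at h2
  · rintro ⟨⟨c, l⟩, ⟨h1, h2, h3⟩, h4⟩
    obtain ⟨rfl, rfl⟩ := Prod.mk.injEq _ _ _ _ ▸ h4
    exact ⟨by simpa using h1, by simpa using h2, by simpa using h3⟩

/-- The children of the first vertex are revealed one at a time. Either it has no child left and is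
discarded, or one child joins the `q` vertices of the next level that are already known. -/
theorem partialForests_succ_succ (n q M : ℕ) : partialForests (n + 1) q (M + 1) =
    (fun p : List ℕ × List (List ℕ) => (0 :: p.1, p.2)) '' partialForests n q (M + 1) ∪
    (fun p : List ℕ × List (List ℕ) => (p.1.modifyHead (· + 1), p.2)) ''
      partialForests (n + 1) (q + 1) M := by
  ext ⟨c, l⟩
  constructor
  · rintro ⟨h1, h2, h3⟩
    rcases c with _ | ⟨_ | a, c⟩
    · simp at h1
    · simp only [List.length_cons, List.sum_cons] at h1 h2 h3
      refine Or.inl ⟨(c, l), ⟨by simp only; omega, ?_, by simp only; omega⟩, rfl⟩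
      rwa [zero_add] at h2
    · simp only [List.length_cons, List.sum_cons] at h1 h2 h3
      refine Or.inr ⟨(a :: c, l), ⟨by simpa using h1, ?_, ?_⟩, rfl⟩
      · simp only [List.sum_cons]
        rwa [show a + c.sum + (q + 1) = a + 1 + c.sum + q by omega]
      · simp only [List.sum_cons]; omega
  · rintro (⟨⟨c, l⟩, ⟨h1, h2, h3⟩, h4⟩ | ⟨⟨c, l⟩, ⟨h1, h2, h3⟩, h4⟩)
    · obtain ⟨rfl, rfl⟩ := Prod.mk.injEq _ _ _ _ ▸ h4
      exact ⟨by simpa using h1, by simpa using h2, by simpa using h3⟩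
    · rcases c with _ | ⟨a, c⟩
      · simp at h1
      · obtain ⟨rfl, rfl⟩ := Prod.mk.injEq _ _ _ _ ▸ h4
        simp only [List.length_cons, List.sum_cons] at h1 h2 h3
        refine ⟨by simpa using h1, ?_, ?_⟩
        · simp only [List.modifyHead_cons, List.sum_cons]
          rwa [show a + 1 + c.sum + q = a + c.sum + (q + 1) by omega]
        · simp only [List.modifyHead_cons, List.sum_cons]; omega

theorem partialForests_zero (q M : ℕ) :
    partialForests 0 q M = (fun l => ([], l)) '' forests q M := by
  ext ⟨c, l⟩
  constructor
  · rintro ⟨h1, h2, h3⟩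
    obtain rfl := List.eq_nil_of_length_eq_zero h1
    exact ⟨l, ⟨by simpa using h2, by simpa using h3⟩, rfl⟩
  · rintro ⟨l, ⟨h2, h3⟩, h4⟩
    obtain ⟨rfl, rfl⟩ := Prod.mk.injEq _ _ _ _ ▸ h4
    exact ⟨rfl, by simpa using h2, by simpa using h3⟩

theorem forests_succ (n M : ℕ) :
    forests (n + 1) M = (fun p : List ℕ × List (List ℕ) => p.1 :: p.2) ''
      partialForests (n + 1) 0 M := by
  ext l
  constructor
  · rintro ⟨h1, h2⟩
    rcases l with _ | ⟨c, l⟩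
    · exact absurd h1 (Nat.succ_ne_zero n)
    · exact ⟨(c, l), ⟨h1.2.1, h1.2.2, by rwa [forestSize_cons] at h2⟩, rfl⟩
  · rintro ⟨⟨c, l⟩, ⟨h1, h2, h3⟩, rfl⟩
    exact ⟨⟨by omega, h1, h2⟩, by rwa [forestSize_cons]⟩

theorem forests_zero_zero : forests 0 0 = {[]} := by
  ext l
  rcases l with _ | ⟨c, l⟩
  · simp [forests, IsForest, forestSize]
  · simp [forests, IsForest]

theorem forests_zero_succ (M : ℕ) : forests 0 (M + 1) = ∅ := by
  ext l
  rcases l with _ | ⟨c, l⟩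
  · simp [forests, forestSize]
  · simp [forests, IsForest]

/-- For fixed `M` only the step from `n` to `n + 1` matters: starting from `forests 0 M` with `q =
0` it reaches all forests, and these are in turn the cases `n = 0` for arbitrary `q`. -/
theorem partialForests_step {M : ℕ}
    (hs : ∀ n q, (partialForests n q M).Finite ∧
        (partialForests n q M).ncard = forestCount M (n + q) →
      (partialForests (n + 1) q M).Finite ∧
        (partialForests (n + 1) q M).ncard = forestCount M (n + 1 + q)) :
    (∀ n, (forests n M).Finite ∧ (forests n M).ncard = forestCount M n) ∧
    ∀ n q, (partialForests n q M).Finite ∧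
      (partialForests n q M).ncard = forestCount M (n + q) := by
  have hinj : Function.Injective fun l : List (List ℕ) => (([] : List ℕ), l) := fun l l' h =>
    congrArg Prod.snd h
  have h0 : (forests 0 M).Finite ∧ (forests 0 M).ncard = forestCount M 0 := by
    rcases M with _ | M
    · rw [forests_zero_zero]
      exact ⟨Set.finite_singleton _, by rw [Set.ncard_singleton, forestCount_zero]⟩
    · rw [forests_zero_succ]
      exact ⟨Set.finite_empty, by rw [Set.ncard_empty, forestCount_succ_zero]⟩
  have lift : ∀ q, (forests q M).Finite ∧ (forests q M).ncard = forestCount M q →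
      ∀ n, (partialForests n q M).Finite ∧
        (partialForests n q M).ncard = forestCount M (n + q) := by
    intro q hq n
    induction n with
    | zero =>
      rw [partialForests_zero, Set.ncard_image_of_injective _ hinj, zero_add]
      exact ⟨hq.1.image _, hq.2⟩
    | succ n ih => exact hs n q ih
  have hF : ∀ n, (forests n M).Finite ∧ (forests n M).ncard = forestCount M n := by
    intro n
    rcases n with _ | n
    · exact h0
    · have := lift 0 h0 (n + 1)
      rw [forests_succ, Set.InjOn.ncard_image]
      · exact ⟨this.1.image _, this.2⟩
      · rintro ⟨c, l⟩ - ⟨c', l'⟩ - h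
        simpa using h
  exact ⟨hF, fun n q => lift q (hF q) n⟩

/-- The decomposition in `partialForests_succ_succ` is disjoint and replaces `n + 1 + q` by `n + q`
with the same size, or by `n + q + 2` with size one less. This is the recurrence
`forestCount_succ_succ`, so the count depends on `n + q` only. -/
theorem forests_finite_ncard (M : ℕ) :
    (∀ n, (forests n M).Finite ∧ (forests n M).ncard = forestCount M n) ∧
    ∀ n q, (partialForests n q M).Finite ∧
      (partialForests n q M).ncard = forestCount M (n + q) := by
  have hinj : Function.Injective fun p : List ℕ × List (List ℕ) => (0 :: p.1, p.2) := by
    rintro ⟨c, l⟩ ⟨c', l'⟩ h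
    simpa using h
  induction M with
  | zero =>
    refine partialForests_step fun n q h => ?_
    rw [partialForests_succ_zero, Set.ncard_image_of_injective _ hinj]
    exact ⟨h.1.image _, h.2.trans (by simp only [forestCount_zero])⟩
  | succ M ih =>
    refine partialForests_step fun n q h => ?_
    have h2 := ih.2 (n + 1) (q + 1)
    have hinj2 : Set.InjOn (fun p : List ℕ × List (List ℕ) => (p.1.modifyHead (· + 1), p.2))
        (partialForests (n + 1) (q + 1) M) := by
      rintro ⟨c, l⟩ hc ⟨c', l'⟩ hc' h
      rcases c with _ | ⟨a, c⟩
      · simp [partialForests] at hc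
      rcases c' with _ | ⟨a', c'⟩
      · simp [partialForests] at hc'
      simpa using h
    rw [partialForests_succ_succ]
    refine ⟨(h.1.image _).union (h2.1.image _), ?_⟩
    rw [Set.ncard_union_eq _ (h.1.image _) (h2.1.image _), Set.ncard_image_of_injective _ hinj,
      hinj2.ncard_image, h.2, h2.2, show n + 1 + q = n + q + 1 by omega, forestCount_succ_succ]
    · congr 2; omega
    · rw [Set.disjoint_left]
      rintro ⟨c, l⟩ ⟨⟨c₁, l₁⟩, -, h1⟩ ⟨⟨c₂, l₂⟩, hc, h2⟩
      rcases c₂ with _ | ⟨a, c₂⟩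
      · simp [partialForests] at hc
      · simp only [List.modifyHead_cons, Prod.mk.injEq] at h1 h2
        have := h1.1.trans h2.1.symm
        simp at this

theorem forests_finite (n M : ℕ) : (forests n M).Finite := ((forests_finite_ncard M).1 n).1

theorem ncard_forests (n M : ℕ) : (forests n M).ncard = forestCount M n :=
  ((forests_finite_ncard M).1 n).2

/-! ### Asymptotics -/

/-- The ballot numbers. -/
theorem forestCount_add_choose (M n : ℕ) :
    forestCount (M + 1) n + (2 * M + n + 1).choose M = (2 * M + n + 1).choose (M + 1) := by
  induction M generalizing n with
  | zero =>
    simp [forestCount]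
  | succ M ihM =>
    induction n with
    | zero =>
      rw [forestCount_succ_zero, zero_add, add_zero]
      exact (Nat.choose_symm_half (M + 1)).symm
    | succ n ih =>
      rw [forestCount_succ_succ]
      have h1 := ihM (n + 2)
      have e1 : 2 * (M + 1) + n + 1 = 2 * M + (n + 2) + 1 := by omega
      rw [e1] at ih
      have e2 : 2 * (M + 1) + (n + 1) + 1 = 2 * M + (n + 2) + 1 + 1 := by omega
      rw [e2, Nat.choose_succ_succ' _ M, Nat.choose_succ_succ' _ (M + 1)]
      omega

/-- With a single root the ballot numbers are the Catalan numbers. -/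
theorem succ_mul_forestCount_one (M : ℕ) : (M + 1) * forestCount M 1 = M.centralBinom := by
  rcases M with _ | M
  · simp [forestCount_zero]
  · have h1 := forestCount_add_choose M 1
    have h2 := Nat.choose_succ_right_eq (2 * M + 1 + 1) M
    rw [show 2 * M + 1 + 1 - M = M + 2 by omega] at h2
    rw [Nat.centralBinom, show 2 * (M + 1) = 2 * M + 1 + 1 by omega]
    nlinarith

theorem forestCount_one_pos (M : ℕ) : 0 < forestCount M 1 := by
  have := succ_mul_forestCount_one M
  have := Nat.centralBinom_pos M
  by_contra h
  have h0 : forestCount M 1 = 0 := by omega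
  simp_all

theorem forestCount_one_succ (M : ℕ) :
    (M + 2) * forestCount (M + 1) 1 = 2 * (2 * M + 1) * forestCount M 1 := by
  have h1 := succ_mul_forestCount_one M
  have h2 := succ_mul_forestCount_one (M + 1)
  have h3 := Nat.succ_mul_centralBinom_succ M
  rw [← h1, ← h2] at h3
  have : (M + 1) * ((M + 2) * forestCount (M + 1) 1) =
      (M + 1) * (2 * (2 * M + 1) * forestCount M 1) := by linarith
  exact Nat.eq_of_mul_eq_mul_left (by omega) this

theorem tendsto_forestCount_one :
    Tendsto (fun N => (forestCount (N + 1) 1 : ℝ) / forestCount N 1) atTop (𝓝 4) := by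
  have h : ∀ N : ℕ, (forestCount (N + 1) 1 : ℝ) / forestCount N 1 = 4 - 6 * (1 / ((N : ℝ) + 1 + 1)) := by
    intro N
    have h1 : (0 : ℝ) < forestCount N 1 := by exact_mod_cast forestCount_one_pos N
    have h2 : ((N : ℝ) + 2) * forestCount (N + 1) 1 = 2 * (2 * N + 1) * forestCount N 1 := by
      exact_mod_cast forestCount_one_succ N
    have h3 : (0 : ℝ) < (N : ℝ) + 2 := by positivity
    rw [div_eq_iff h1.ne', show (N : ℝ) + 1 + 1 = N + 2 by ring]
    apply mul_left_cancel₀ h3.ne'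
    rw [h2]
    field_simp
    ring
  simp_rw [h]
  have h1 := (tendsto_one_div_add_atTop_nhds_zero_nat (𝕜 := ℝ)).comp (tendsto_add_atTop_nat 1)
  have h2 := (h1.const_mul 6).const_sub 4
  rw [mul_zero, sub_zero] at h2
  refine h2.congr fun N => ?_
  simp

/-- In the limit the recurrence becomes `a (n + 2) = 4 * (a (n + 1) - a n)`, because Catalan numbers
grow by the factor `4`. Its characteristic polynomial has the double root `2`, and `a 0 = 0`, `a 1 =
1` select `n * 2 ^ n / 2`. -/
theorem tendsto_forestCount (n : ℕ) :
    Tendsto (fun N => (forestCount N n : ℝ) / forestCount N 1) atTop (𝓝 (n * 2 ^ n / 2)) := by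
  have hpos : ∀ N, (forestCount N 1 : ℝ) ≠ 0 := fun N => by
    exact_mod_cast (forestCount_one_pos N).ne'
  have key : ∀ n, Tendsto (fun N => (forestCount N n : ℝ) / forestCount N 1) atTop
      (𝓝 (n * 2 ^ n / 2)) ∧ Tendsto (fun N => (forestCount N (n + 1) : ℝ) / forestCount N 1) atTop
      (𝓝 ((n + 1 : ℕ) * 2 ^ (n + 1) / 2)) := by
    intro n
    induction n with
    | zero =>
      constructor
      · refine tendsto_const_nhds.congr' ?_
        filter_upwards [eventually_ge_atTop 1] with N hN
        obtain ⟨M, rfl⟩ : ∃ M, N = M + 1 := ⟨N - 1, by omega⟩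
        rw [forestCount_succ_zero]
        simp
      · refine tendsto_const_nhds.congr fun N => ?_
        simp [hpos N]
    | succ n ih =>
      refine ⟨ih.2, ?_⟩
      have h1 := ((ih.2.comp (tendsto_add_atTop_nat 1)).sub
        (ih.1.comp (tendsto_add_atTop_nat 1))).mul tendsto_forestCount_one
      have e : (((n + 1 : ℕ) : ℝ) * 2 ^ (n + 1) / 2 - n * 2 ^ n / 2) * 4 =
          (n + 1 + 1 : ℕ) * 2 ^ (n + 1 + 1) / 2 := by push_cast; ring
      rw [e] at h1
      refine h1.congr fun N => ?_
      simp only [Function.comp]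
      have h2 : (forestCount (N + 1) (n + 1) : ℝ) =
          forestCount (N + 1) n + forestCount N (n + 1 + 1) := by
        exact_mod_cast forestCount_succ_succ N n
      rw [h2]
      have h3 := hpos (N + 1)
      have h4 := hpos N
      field_simp
      ring
  exact (key n).1

theorem tendsto_forestCount_sub (n m : ℕ) :
    Tendsto (fun N => (forestCount (N - m) n : ℝ) / forestCount N 1) atTop
      (𝓝 (n * 2 ^ n / 2 / 4 ^ m)) := by
  have hpos : ∀ N, (forestCount N 1 : ℝ) ≠ 0 := fun N => by
    exact_mod_cast (forestCount_one_pos N).ne'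
  have h1 : Tendsto (fun N => (forestCount N 1 : ℝ) / forestCount (N + m) 1) atTop
      (𝓝 (1 / 4 ^ m)) := by
    induction m with
    | zero => refine tendsto_const_nhds.congr fun N => ?_; simp [hpos N]
    | succ m ih =>
      have h2 := ih.mul ((tendsto_forestCount_one.comp (tendsto_add_atTop_nat m)).inv₀ (by norm_num))
      rw [show (1 : ℝ) / 4 ^ m * 4⁻¹ = 1 / 4 ^ (m + 1) by rw [pow_succ]; field_simp] at h2
      refine h2.congr fun N => ?_
      simp only [Function.comp, inv_div]
      rw [div_mul_div_cancel₀ (hpos _)]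
      rfl
  rw [← tendsto_add_atTop_iff_nat m]
  have h2 := (tendsto_forestCount n).mul h1
  rw [mul_one_div] at h2
  refine h2.congr fun N => ?_
  rw [Nat.add_sub_cancel, div_mul_div_cancel₀ (hpos _)]

/-! ### Trunks of forests -/

/-- The lowest levels of a forest with `n` roots, followed by a level of `m > 0` vertices. -/
def IsTrunk : ℕ → List (List ℕ) → ℕ → Prop
  | n, [], m => 0 < n ∧ n = m
  | n, c :: l, m => 0 < n ∧ c.length = n ∧ IsTrunk c.sum l m

theorem IsTrunk.pos {n m : ℕ} {p : List (List ℕ)} (h : IsTrunk n p m) : 0 < m := by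
  induction p generalizing n with
  | nil => obtain ⟨h1, rfl⟩ := h; exact h1
  | cons c l ih => exact ih h.2.2

theorem IsTrunk.isForest_append {n m : ℕ} {p : List (List ℕ)} (h : IsTrunk n p m)
    (l : List (List ℕ)) : IsForest n (p ++ l) ↔ IsForest m l := by
  induction p generalizing n with
  | nil => obtain ⟨h1, rfl⟩ := h; rfl
  | cons c p ih =>
    rw [List.cons_append]
    exact ⟨fun h' => (ih h.2.2).1 h'.2.2, fun h' => ⟨h.1, h.2.1, (ih h.2.2).2 h'⟩⟩

theorem IsTrunk.ncard_prefix {m : ℕ} {p : List (List ℕ)} (h : IsTrunk 1 p m) {N : ℕ}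
    (hN : forestSize p ≤ N) :
    {l ∈ forests 1 N | p <+: l}.ncard = forestCount (N - forestSize p) m := by
  rw [← ncard_forests]
  have : {l ∈ forests 1 N | p <+: l} = (p ++ ·) '' forests m (N - forestSize p) := by
    ext l
    constructor
    · rintro ⟨⟨h1, h2⟩, t, rfl⟩
      rw [forestSize_append] at h2
      exact ⟨t, ⟨(h.isForest_append t).1 h1, by omega⟩, rfl⟩
    · rintro ⟨t, ⟨h1, h2⟩, rfl⟩
      exact ⟨⟨(h.isForest_append t).2 h1, by rw [forestSize_append]; omega⟩, t, rfl⟩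
  rw [this, Set.ncard_image_of_injective _ (List.append_right_injective p)]

end

/-! ### Coded triangulations as isomorphism classes -/

namespace LayerCode

open RootedMap StripDart

variable {C D : LayerCode}

/-- The triangulation only depends on the relevant part of its code. -/
theorem iso_of_eq (ht : C.top = D.top)
    (h : ∀ k, C.Below k → ∀ i < C.n k, C.c k i = D.c k i) : Iso C.toRootedMap D.toRootedMap := by
  have hB : ∀ {k}, C.Below k ↔ D.Below k := by
    intro k; unfold Below; rw [ht]
  have hn : ∀ {k}, C.Below k → C.n k = D.n k := fun {k} hk =>
    levelSize_congr (fun k' hk' => h k' (by unfold Below at *; omega)) k le_rfl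
  have hc : C.c 0 0 = D.c 0 0 := h 0 below_zero 0 one_pos
  have hok : ∀ d, C.Ok d ↔ D.Ok d := by
    have hup : ∀ k i a, (C.Below k ∧ i < C.n k ∧ (a < C.c k i ∨ a = C.c k i ∧ 0 < k)) ↔
        (D.Below k ∧ i < D.n k ∧ (a < D.c k i ∨ a = D.c k i ∧ 0 < k)) := by
      intro k i a
      constructor
      · rintro ⟨h1, h2, h3⟩
        exact ⟨hB.1 h1, hn h1 ▸ h2, h k h1 i h2 ▸ h3⟩
      · rintro ⟨h1, h2, h3⟩
        rw [← hB] at h1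
        rw [← hn h1] at h2
        exact ⟨h1, h2, (h k h1 i h2).symm ▸ h3⟩
    have hri : ∀ k i, (0 < k ∧ C.Below k ∧ i < C.n k) ↔ (0 < k ∧ D.Below k ∧ i < D.n k) := by
      intro k i
      constructor
      · rintro ⟨h1, h2, h3⟩; exact ⟨h1, hB.1 h2, hn h2 ▸ h3⟩
      · rintro ⟨h1, h2, h3⟩; rw [← hB] at h2; exact ⟨h1, h2, (hn h2).symm ▸ h3⟩
    rintro (⟨k, i, a⟩ | ⟨k, i, a⟩ | ⟨k, i⟩ | ⟨k, i⟩)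
    exacts [hup k i a, hup k i a, hri k i, hri k i]
  have hrot : ∀ d, C.Ok d → C.rotFun d = D.rotFun d := by
    rintro (⟨k, i, a⟩ | ⟨k, i, _ | a⟩ | ⟨k, i⟩ | ⟨k, i⟩)
    · rintro ⟨hk, hi, ha⟩
      simp only [rotFun, h k hk i hi, hc]
    · rintro ⟨hk, hi, ha⟩
      simp only [rotFun, hc, ← hn hk, h k hk _ (cycPred_lt hi)]
    · rintro ⟨hk, hi, ha⟩
      simp only [rotFun, ← ht, ← hn hk, childSum_congr (h k hk) hi.le]
    · rintro ⟨h0, hk, hi⟩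
      have hk' : C.Below (k - 1) := by unfold Below at *; omega
      obtain ⟨h1, h2⟩ := parentIdx_congr (h (k - 1) hk') (lt_childSum_of_ok h0 hi)
      simp only [rotFun, ← hn hk', h1, h2]
    · rintro ⟨h0, hk, hi⟩
      simp only [rotFun, ← hn hk]
  exact ⟨Equiv.subtypeEquivRight hok, rfl, fun d => Subtype.ext (hrot d.1 d.2), fun d => rfl⟩

/-- The causal triangulation encoded by a plane tree. -/
def toCT (C : LayerCode) : CausalTriangulation :=
  Quotient.mk RootedMap.ctSetoid ⟨C.toRootedMap, C.isCT⟩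

theorem iso_toCT (C : LayerCode) : Iso C.toCT.toMap C.toRootedMap :=
  Quotient.exact (s := RootedMap.ctSetoid) (Quotient.out_eq (s := RootedMap.ctSetoid) C.toCT)

theorem toCT_eq_iff : C.toCT = D.toCT ↔ Iso C.toRootedMap D.toRootedMap :=
  Quotient.eq (r := RootedMap.ctSetoid)

end LayerCode

theorem CausalTriangulation.isCT_toMap (c : CausalTriangulation) : c.toMap.IsCT :=
  (Quotient.out (s := RootedMap.ctSetoid) c).2

theorem LayerCode.toCT_eq_of_iso {C : LayerCode} {c : CausalTriangulation}
    (h : RootedMap.Iso C.toRootedMap c.toMap) : C.toCT = c := by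
  rw [← Quotient.out_eq (s := RootedMap.ctSetoid) c]
  exact Quotient.sound (s := RootedMap.ctSetoid) h

/-! ### The finite causal triangulation encoded by a forest -/

theorem isForest_iff {n : ℕ} {l : List (List ℕ)} : IsForest n l ↔ (l.getD 0 []).length = n ∧
    (∀ k < l.length, 0 < (l.getD k []).length) ∧
    ∀ k, (l.getD k []).sum = (l.getD (k + 1) []).length := by
  induction l generalizing n with
  | nil => simp [IsForest, eq_comm]
  | cons c l ih =>
    simp only [IsForest, ih, List.getD_cons_zero]
    constructor
    · rintro ⟨h1, h2, h3, h4, h5⟩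
      refine ⟨h2, fun k hk => ?_, fun k => ?_⟩
      · rcases k with _ | k
        · simp only [List.getD_cons_zero]; omega
        · rw [List.getD_cons_succ]; exact h4 k (by simpa using hk)
      · rcases k with _ | k
        · simp only [List.getD_cons_zero, List.getD_cons_succ]; exact h3.symm
        · simp only [List.getD_cons_succ]; exact h5 k
    · rintro ⟨h1, h2, h3⟩
      refine ⟨by have := h2 0 (by simp); simp only [List.getD_cons_zero] at this; omega, h1, ?_,
        fun k hk => ?_, fun k => ?_⟩
      · have := h3 0
        simp only [List.getD_cons_zero, List.getD_cons_succ] at this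
        exact this.symm
      · have := h2 (k + 1) (by simpa using hk)
        rwa [List.getD_cons_succ] at this
      · have := h3 (k + 1)
        simpa only [List.getD_cons_succ] using this

theorem childSum_getD (c : List ℕ) : childSum (fun i => c.getD i 0) c.length = c.sum := by
  induction c with
  | nil => rfl
  | cons a c ih =>
    unfold childSum at ih ⊢
    rw [List.length_cons, Finset.sum_range_succ']
    simp only [List.getD_cons_succ, List.getD_cons_zero, List.sum_cons, ih]
    omega

/-- The numbers of children of the vertices of a forest, extended above the last level. -/
def forestChild (l : List (List ℕ)) (k i : ℕ) : ℕ :=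
  -- The last list of a forest consists of zeros. In the code its vertices have one child each, the
  -- apex of the triangle attached to an edge.
  if k + 1 < l.length then (l.getD k []).getD i 0 else 1

theorem levelSize_forestChild {l : List (List ℕ)} (h : IsForest 1 l) :
    ∀ k < l.length, levelSize (forestChild l) k = (l.getD k []).length := by
  obtain ⟨h1, h2, h3⟩ := isForest_iff.1 h
  intro k
  induction k with
  | zero => exact fun _ => h1.symm
  | succ k ih =>
    intro hk
    rw [levelSize_succ, ih (by omega), ← h3, ← childSum_getD]
    exact childSum_congr (fun i _ => by rw [forestChild, if_pos hk]) le_rfl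

theorem IsForest.length_pos {n : ℕ} {l : List (List ℕ)} (h : IsForest n l) (hn : 0 < n) :
    0 < l.length := by
  rcases l with _ | ⟨c, l⟩
  · exact absurd h hn.ne'
  · simp

theorem levelSize_forestChild_pos {l : List (List ℕ)} (h : IsForest 1 l) (k : ℕ) :
    0 < levelSize (forestChild l) k := by
  induction k with
  | zero => exact one_pos
  | succ k ih =>
    by_cases hk : k + 1 < l.length
    · rw [levelSize_forestChild h _ hk]
      exact (isForest_iff.1 h).2.1 _ hk
    · rw [levelSize_succ, childSum_congr (g := fun _ => 1)
        (fun i _ => by rw [forestChild, if_neg hk]) le_rfl]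
      simpa [childSum] using ih

theorem levelSize_const_one (k : ℕ) : levelSize (fun _ _ => 1) k = 1 := by
  induction k with
  | zero => rfl
  | succ k ih => rw [levelSize_succ, ih]; rfl

namespace LayerCode

open RootedMap StripDart

open Classical in
/-- The finite causal triangulation encoded by a forest with one root and at least two levels. -/
noncomputable def ofForest (l : List (List ℕ)) : LayerCode :=
  if h : IsForest 1 l ∧ l.length ≠ 1 then
    ⟨forestChild l, l.length, h.2, levelSize_forestChild_pos h.1,
      fun k hk i => by rw [forestChild, if_neg (by omega)]⟩
  else ⟨fun _ _ => 1, 0, by omega, fun k => by rw [levelSize_const_one]; exact one_pos,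
    fun k hk => by omega⟩

theorem ofForest_c {l : List (List ℕ)} (h : IsForest 1 l) (h1 : l.length ≠ 1) :
    (ofForest l).c = forestChild l := by rw [ofForest, dif_pos ⟨h, h1⟩]

theorem ofForest_top {l : List (List ℕ)} (h : IsForest 1 l) (h1 : l.length ≠ 1) :
    (ofForest l).top = l.length := by rw [ofForest, dif_pos ⟨h, h1⟩]

theorem ofForest_injOn : Set.InjOn (fun l => (ofForest l).toCT)
    {l | IsForest 1 l ∧ l.length ≠ 1} := by
  rintro l ⟨hl, hl1⟩ m ⟨hm, hm1⟩ h
  have hiso := toCT_eq_iff.1 h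
  have hl0 := hl.length_pos one_pos
  have hm0 := hm.length_pos one_pos
  have htop := top_eq_of_iso hiso (by rw [ofForest_top hl hl1]; omega)
    (by rw [ofForest_top hm hm1]; omega)
  have hcode := eq_of_iso hiso htop
  rw [ofForest_top hl hl1, ofForest_top hm hm1] at htop
  have hn : ∀ k < l.length, (l.getD k []).length = (m.getD k []).length ∧
      ∀ i < (l.getD k []).length, forestChild l k i = forestChild m k i := by
    intro k hk
    have := hcode k (Or.inr (by rwa [ofForest_top hl hl1]))
    unfold LayerCode.n at this
    rw [ofForest_c hl hl1, ofForest_c hm hm1, levelSize_forestChild hl k hk,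
      levelSize_forestChild hm k (htop ▸ hk)] at this
    exact this
  have hz : ∀ c : List ℕ, c.sum = 0 → c = List.replicate c.length 0 := by
    intro c hc
    rw [List.eq_replicate_iff]
    exact ⟨rfl, List.sum_eq_zero_iff.1 hc⟩
  have hget : ∀ k < l.length, l.getD k [] = m.getD k [] := by
    intro k hk
    obtain ⟨h1, h2⟩ := hn k hk
    by_cases hk1 : k + 1 < l.length
    · refine List.ext_getElem h1 fun i hi hi' => ?_
      have := h2 i hi
      rw [forestChild, forestChild, if_pos hk1, if_pos (htop ▸ hk1),
        List.getD_eq_getElem _ _ hi, List.getD_eq_getElem _ _ hi'] at this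
      exact this
    -- The code does not record the last list, but that list has sum zero and is thus determined by
    -- its length.
    · have e1 := (isForest_iff.1 hl).2.2 k
      have e2 := (isForest_iff.1 hm).2.2 k
      rw [List.getD_eq_default _ _ (by omega : l.length ≤ k + 1)] at e1
      rw [List.getD_eq_default _ _ (by omega : m.length ≤ k + 1)] at e2
      rw [hz _ e1, hz _ e2, h1]
  refine List.ext_getElem htop fun k hk hk' => ?_
  have := hget k hk
  rwa [List.getD_eq_getElem _ _ hk, List.getD_eq_getElem _ _ hk'] at this

theorem sum_map_range (f : ℕ → ℕ) (n : ℕ) : ((List.range n).map f).sum = childSum f n := by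
  induction n with
  | zero => rfl
  | succ n ih => rw [List.range_succ, List.map_append, List.sum_append, ih, childSum_succ]; simp

theorem exists_ofForest (C : LayerCode) (h0 : C.top ≠ 0) :
    ∃ l, IsForest 1 l ∧ l.length ≠ 1 ∧ (ofForest l).toCT = C.toCT := by
  set f : ℕ → List ℕ := fun k =>
    (List.range (C.n k)).map (fun i => if k + 1 < C.top then C.c k i else 0) with hf
  set l := (List.range C.top).map f with hl
  have hlen : l.length = C.top := by simp [hl]
  have hget : ∀ k < C.top, l.getD k [] = f k := by
    intro k hk
    rw [List.getD_eq_getElem _ _ (by omega)]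
    simp [hl]
  have hflen : ∀ k, (f k).length = C.n k := by intro k; simp [hf]
  have htop := C.top_ne
  have hfor : IsForest 1 l := by
    refine isForest_iff.2 ⟨?_, fun k hk => ?_, fun k => ?_⟩
    · rw [hget 0 (by omega), hflen]
      rfl
    · rw [hget k (by omega), hflen]
      exact C.pos k
    · by_cases hk : k + 1 < C.top
      · rw [hget k (by omega), hget _ hk, hflen, hf]
        simp only [if_pos hk]
        rw [sum_map_range]
        rfl
      · rw [List.getD_eq_default _ _ (by omega : l.length ≤ k + 1)]
        by_cases hk' : k < C.top
        · rw [hget k hk', hf]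
          simp [if_neg hk]
        · rw [List.getD_eq_default _ _ (by omega : l.length ≤ k)]
          rfl
  have hl1 : l.length ≠ 1 := by rw [hlen]; exact htop
  refine ⟨l, hfor, hl1, toCT_eq_iff.2 (iso_of_eq (by rw [ofForest_top hfor hl1, hlen]) ?_)⟩
  intro k hk i hi
  have hk' : k < C.top := by
    have := hk.resolve_left (by rw [ofForest_top hfor hl1]; omega)
    rwa [ofForest_top hfor hl1, hlen] at this
  unfold LayerCode.n at hi
  rw [ofForest_c hfor hl1] at hi ⊢
  rw [levelSize_forestChild hfor k (by omega), hget k hk', hflen] at hi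
  unfold forestChild
  split_ifs with h1
  · rw [hget k hk', List.getD_eq_getElem _ _ (by rw [hflen]; exact hi)]
    rw [hlen] at h1
    simp [hf, h1]
  · exact (C.top_eq k (by omega) i).symm

theorem area_ofForest {l : List (List ℕ)} (h : IsForest 1 l) (h1 : l.length ≠ 1) :
    (ofForest l).toRootedMap.area = 2 * forestSize l := by
  have hpos := h.length_pos one_pos
  rw [area_eq (by rw [ofForest_top h h1]; omega), ofForest_top h h1]
  congr 1
  unfold LayerCode.n
  rw [ofForest_c h h1]
  have hs : ∀ l : List (List ℕ), forestSize l = ∑ k ∈ Finset.range l.length, (l.getD k []).sum := by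
    intro l
    induction l with
    | nil => rfl
    | cons c l ih =>
      rw [forestSize_cons, List.length_cons, Finset.sum_range_succ', ih]
      simp only [List.getD_cons_succ, List.getD_cons_zero]
      omega
  obtain ⟨m, hm⟩ : ∃ m, l.length = m + 1 := ⟨l.length - 1, by omega⟩
  have h3 := (isForest_iff.1 h).2.2
  rw [hs, hm, Finset.sum_range_succ, h3 m, List.getD_eq_default _ _ (by omega : l.length ≤ m + 1),
    Finset.sum_Ico_eq_sum_range]
  simp only [List.length_nil, add_zero, Nat.add_sub_cancel]
  refine Finset.sum_congr rfl fun k hk => ?_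
  rw [Finset.mem_range] at hk
  rw [h3, add_comm 1 k, levelSize_forestChild h _ (by omega)]

end LayerCode

/-! ### The finite triangulations of a given area -/

namespace CausalTriangulation

open RootedMap

theorem length_ne_one_of_mem_forests {N : ℕ} (hN : 0 < N) {l : List (List ℕ)}
    (h : l ∈ forests 1 N) : l.length ≠ 1 := by
  intro hl
  obtain ⟨c, rfl⟩ := List.length_eq_one_iff.1 hl
  have h1 : c.sum = 0 := h.1.2.2
  have h2 : forestSize [c] = N := h.2
  simp [forestSize] at h2
  omega

/-- A finite causal triangulation is encoded by a forest. -/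
theorem ofArea_eq {N : ℕ} (hN : 0 < N) :
    ofArea N = (fun l => (LayerCode.ofForest l).toCT) '' forests 1 N := by
  ext c
  constructor
  · rintro ⟨⟨K, hK⟩, ha⟩
    obtain ⟨C, hC, hiso⟩ := hK.exists_layerCode
    have hK2 := hK.1
    obtain ⟨l, hl, hl1, he⟩ := C.exists_ofForest (by omega)
    have h1 : (LayerCode.ofForest l).toCT = c := he.trans (LayerCode.toCT_eq_of_iso hiso)
    refine ⟨l, ⟨hl, ?_⟩, h1⟩
    have h2 := (LayerCode.ofForest l).iso_toCT.area_eq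
    rw [h1, ha, LayerCode.area_ofForest hl hl1] at h2
    omega
  · rintro ⟨l, hl, rfl⟩
    have hl1 := length_ne_one_of_mem_forests hN hl
    have hiso := (LayerCode.ofForest l).iso_toCT
    refine ⟨?_, ?_⟩
    · refine (isCT_toMap _).resolve_left fun hinf => ?_
      have hpos := hl.1.length_pos one_pos
      have htop : (LayerCode.ofForest l).top ≠ 0 := by
        rw [LayerCode.ofForest_top hl.1 hl1]; omega
      have h1 := hinf.reachesHeight (R := (LayerCode.ofForest l).top + 1) (by omega)
      exact (LayerCode.isFiniteCT htop).not_reachesHeight (by omega)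
        ((hiso.sameBall hinf.1 _).reachesHeight h1)
    · dsimp only
      rw [hiso.area_eq, LayerCode.area_ofForest hl.1 hl1, hl.2]

theorem ofForest_injOn_forests {N : ℕ} (hN : 0 < N) :
    Set.InjOn (fun l => (LayerCode.ofForest l).toCT) (forests 1 N) := by
  have hsub : forests 1 N ⊆ {l | IsForest 1 l ∧ l.length ≠ 1} := fun l hl =>
    ⟨hl.1, length_ne_one_of_mem_forests hN hl⟩
  exact LayerCode.ofForest_injOn.mono hsub

theorem ofArea_finite {N : ℕ} (hN : 0 < N) : (ofArea N).Finite := by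
  rw [ofArea_eq hN]
  exact (forests_finite 1 N).image _

theorem ncard_ofArea {N : ℕ} (hN : 0 < N) : (ofArea N).ncard = forestCount N 1 := by
  rw [ofArea_eq hN, (ofForest_injOn_forests hN).ncard_image, ncard_forests]

/-! ### The metric -/

theorem dist_le_of_sameBall {c c' : CausalTriangulation} {R : ℕ}
    (h : SameBall R c.toMap c'.toMap) : dist c c' ≤ 1 / ((R : ℝ) + 1) := by
  have hb : BddBelow {x : ℝ | ∃ R : ℕ, SameBall R c.toMap c'.toMap ∧ x = 1 / ((R : ℝ) + 1)} := by
    refine ⟨0, ?_⟩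
    rintro x ⟨S, -, rfl⟩
    positivity
  exact csInf_le hb ⟨R, h, rfl⟩

theorem sameBall_of_dist_lt {c c' : CausalTriangulation} {R : ℕ}
    (h : dist c c' < 1 / ((R : ℝ) + 1)) : SameBall R c.toMap c'.toMap := by
  -- Without loops at the root, balls of radius `0` contain no darts and always agree. So the
  -- infimum is not the default value of an empty set.
  have hne : {x : ℝ | ∃ R : ℕ, SameBall R c.toMap c'.toMap ∧ x = 1 / ((R : ℝ) + 1)}.Nonempty := by
    by_contra hne
    rw [Set.not_nonempty_iff_eq_empty] at hne
    have hne0 : ¬ SameBall 0 c.toMap c'.toMap := fun h0 => by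
      exact Set.eq_empty_iff_forall_notMem.1 hne (1 / (((0 : ℕ) : ℝ) + 1)) ⟨0, h0, rfl⟩
    have hempty : ∀ c : CausalTriangulation, IsEmpty (c.toMap.ballDarts 0) := by
      intro c
      have hc : c.toMap.NoRootLoop := by
        rcases isCT_toMap c with h | ⟨K, h⟩
        · exact h.2.2.2.1
        · exact h.2.2.2.2.1
      exact ⟨fun d => hc d (Nat.le_zero.1 d.2.1) (Nat.le_zero.1 d.2.2)⟩
    have h1 := hempty c
    have h2 := hempty c'
    exact hne0 ⟨Equiv.equivOfIsEmpty _ _, fun x => isEmptyElim x, fun x => isEmptyElim x,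
      fun x => isEmptyElim x, fun x => isEmptyElim x⟩
  obtain ⟨x, ⟨S, hS, rfl⟩, hx⟩ := exists_lt_of_csInf_lt hne h
  refine hS.mono ?_
  by_contra hlt
  have h1 : ((S : ℝ) + 1) ≤ (R : ℝ) + 1 := by
    have : (S : ℝ) ≤ R := by exact_mod_cast (not_le.1 hlt).le
    linarith
  have h2 := one_div_le_one_div_of_le (by positivity) h1
  linarith

theorem eq_of_iso_toMap {c c' : CausalTriangulation} (h : Iso c.toMap c'.toMap) : c = c' := by
  rw [← Quotient.out_eq (s := RootedMap.ctSetoid) c, ← Quotient.out_eq (s := RootedMap.ctSetoid) c']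
  exact Quotient.sound (s := RootedMap.ctSetoid) h

/-- The ball of radius `K + 1` does not reach its own radius and therefore determines the map.
Finite triangulations are isolated points, so sets of them are open, in particular measurable. -/
theorem isOpen_singleton_of_isFiniteCT {c : CausalTriangulation} {K : ℕ}
    (h : c.toMap.IsFiniteCT K) : IsOpen {c} := by
  rw [Metric.isOpen_singleton_iff]
  refine ⟨1 / (((K + 1 : ℕ) : ℝ) + 1), by positivity, fun c' hc' => ?_⟩
  rw [dist_comm] at hc'
  have hs := sameBall_of_dist_lt hc'
  have h1 := isCT_toMap c
  have h2 := isCT_toMap c'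
  exact (eq_of_iso_toMap (hs.iso (by omega) h1.connected h2.connected h1.locallyFinite
    h2.locallyFinite (h.not_reachesHeight (by omega)))).symm

theorem isOpen_of_subset_ofArea {N : ℕ} {S : Set CausalTriangulation} (hS : S ⊆ ofArea N) :
    IsOpen S := by
  rw [← Set.biUnion_of_singleton S]
  exact isOpen_biUnion fun c hc => by
    obtain ⟨⟨K, hK⟩, -⟩ := hS hc
    exact isOpen_singleton_of_isFiniteCT hK

theorem uniformOn_apply {N : ℕ} (hN : 0 < N) (U : Set CausalTriangulation) :
    ProbabilityTheory.uniformOn (ofArea N) U =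
      ((ofArea N ∩ U).ncard : ENNReal) / forestCount N 1 := by
  have hfin := ofArea_finite hN
  have hm : MeasurableSet (ofArea N) := (isOpen_of_subset_ofArea subset_rfl).measurableSet
  have hm' : MeasurableSet (ofArea N ∩ U) :=
    (isOpen_of_subset_ofArea Set.inter_subset_left).measurableSet
  have hcount : ∀ S : Set CausalTriangulation, S.Finite → MeasurableSet S →
      MeasureTheory.Measure.count S = (S.ncard : ENNReal) := by
    intro S hS hSm
    rw [MeasureTheory.Measure.count_apply_finite' hS hSm, Set.ncard_eq_toFinset_card S hS]
  rw [ProbabilityTheory.uniformOn, ProbabilityTheory.cond_apply hm, hcount _ hfin hm,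
    hcount _ (hfin.inter_of_left _) hm', ncard_ofArea hN, ENNReal.div_eq_inv_mul]

/-- A lower bound for the probability of a set containing all triangulations which begin with one
of the trunks in `F`. -/
theorem sum_le_uniformOn {N R : ℕ} (hN : 0 < N) (F : Finset (List (List ℕ)))
    (m : List (List ℕ) → ℕ) (hF : ∀ p ∈ F, p.length = R ∧ IsTrunk 1 p (m p) ∧ forestSize p ≤ N)
    (U : Set CausalTriangulation)
    (hU : ∀ p ∈ F, ∀ l ∈ forests 1 N, p <+: l → (LayerCode.ofForest l).toCT ∈ U) :
    ((∑ p ∈ F, forestCount (N - forestSize p) (m p) : ℕ) : ENNReal) / forestCount N 1 ≤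
      ProbabilityTheory.uniformOn (ofArea N) U := by
  rw [uniformOn_apply hN]
  refine ENNReal.div_le_div_right ?_ _
  rw [Nat.cast_le]
  set A : List (List ℕ) → Set (List (List ℕ)) := fun p => {l ∈ forests 1 N | p <+: l} with hA
  have hAfin : ∀ p, (A p).Finite := fun p => (forests_finite 1 N).subset (Set.sep_subset _ _)
  have hunion : (⋃ p ∈ F, A p).ncard = ∑ p ∈ F, forestCount (N - forestSize p) (m p) := by
    have : ∀ F' ⊆ F, (⋃ p ∈ F', A p).ncard =
        ∑ p ∈ F', forestCount (N - forestSize p) (m p) := by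
      classical
      intro F'
      induction F' using Finset.induction_on with
      | empty => simp
      | insert p F' hp ih =>
        intro hsub
        have hpF := hsub (Finset.mem_insert_self p F')
        have hF' := (Finset.subset_insert p F').trans hsub
        have hfinU : (⋃ q ∈ F', A q).Finite := F'.finite_toSet.biUnion fun q _ => hAfin q
        rw [Finset.set_biUnion_insert, Set.ncard_union_eq _ (hAfin p)
          hfinU, ih hF', Finset.sum_insert hp,
          (hF p hpF).2.1.ncard_prefix (hF p hpF).2.2]
        rw [Set.disjoint_left]
        intro l hl hl'
        simp only [Set.mem_iUnion] at hl'
        obtain ⟨q, hq, hlq⟩ := hl'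
        -- Trunks of the same length that begin the same forest coincide, which makes the sets `A p`
        -- disjoint.
        have hpq : p = q := (List.prefix_of_prefix_length_le hl.2 hlq.2
          (by rw [(hF p hpF).1, (hF q (hF' hq)).1])).eq_of_length
          (by rw [(hF p hpF).1, (hF q (hF' hq)).1])
        exact hp (hpq ▸ hq)
    exact this F subset_rfl
  have hsubset : (⋃ p ∈ F, A p) ⊆ forests 1 N := by
    intro l hl
    simp only [Set.mem_iUnion] at hl
    obtain ⟨p, -, hlp⟩ := hl
    exact hlp.1
  rw [← hunion, ← ((ofForest_injOn_forests hN).mono hsubset).ncard_image]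
  refine Set.ncard_le_ncard ?_ ((ofArea_finite hN).inter_of_left _)
  rintro - ⟨l, hl, rfl⟩
  refine ⟨by rw [ofArea_eq hN]; exact ⟨l, hsubset hl, rfl⟩, ?_⟩
  simp only [Set.mem_iUnion] at hl
  obtain ⟨p, hp, hlp⟩ := hl
  exact hU p hp l hlp.1 hlp.2

end CausalTriangulation

section

open scoped ENNReal

/-! ### Sums over lists with geometric weights -/

/-- The mean of `φ` at the sum of `n` independent geometric variables. -/
noncomputable def geomMean : ℕ → (ℕ → ℝ≥0∞) → ℝ≥0∞
  | 0, φ => φ 0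
  | n + 1, φ => ∑' a : ℕ, 2⁻¹ ^ (a + 1) * geomMean n fun m => φ (a + m)

/-- Under `n` independent geometric variables a list `c` of length `n` has probability `2⁻¹ ^ (n +
c.sum)`. The induction splits off its first entry. -/
theorem tsum_length_eq (n : ℕ) (φ : ℕ → ℝ≥0∞) :
    ∑' c : {c : List ℕ // c.length = n}, 2⁻¹ ^ (n + c.1.sum) * φ c.1.sum = geomMean n φ := by
  induction n generalizing φ with
  | zero =>
    have : Unique {c : List ℕ // c.length = 0} :=
      ⟨⟨⟨[], rfl⟩⟩, fun c => Subtype.ext (List.eq_nil_of_length_eq_zero c.2)⟩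
    rw [tsum_fintype, Fintype.sum_unique]
    have h : (default : {c : List ℕ // c.length = 0}).1 = [] :=
      List.eq_nil_of_length_eq_zero (default : {c : List ℕ // c.length = 0}).2
    rw [h]
    simp [geomMean]
  | succ n ih =>
    let e : ℕ × {c : List ℕ // c.length = n} ≃ {c : List ℕ // c.length = n + 1} :=
      { toFun := fun p => ⟨p.1 :: p.2.1, by simp [p.2.2]⟩
        invFun := fun c => ⟨c.1.headD 0, c.1.tail, by simp [c.2]⟩
        left_inv := fun p => rfl
        right_inv := by
          rintro ⟨c, hc⟩
          rcases c with _ | ⟨a, c⟩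
          · simp at hc
          · rfl }
    rw [← e.tsum_eq, ENNReal.tsum_prod', geomMean]
    refine tsum_congr fun a => ?_
    rw [← ih, ← ENNReal.tsum_mul_left]
    refine tsum_congr fun c => ?_
    change 2⁻¹ ^ (n + 1 + (a :: c.1).sum) * φ (a :: c.1).sum = _
    rw [List.sum_cons, ← mul_assoc, ← pow_add]
    congr 2
    omega

theorem geomMean_add (n : ℕ) (φ ψ : ℕ → ℝ≥0∞) :
    geomMean n (fun m => φ m + ψ m) = geomMean n φ + geomMean n ψ := by
  simp only [← tsum_length_eq, mul_add, ENNReal.tsum_add]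

theorem geomMean_const_mul (n : ℕ) (a : ℝ≥0∞) (φ : ℕ → ℝ≥0∞) :
    geomMean n (fun m => a * φ m) = a * geomMean n φ := by
  simp only [← tsum_length_eq, ← ENNReal.tsum_mul_left]
  exact tsum_congr fun c => by ring

theorem geomMean_congr {n : ℕ} {φ ψ : ℕ → ℝ≥0∞} (h : ∀ m, φ m = ψ m) :
    geomMean n φ = geomMean n ψ := by rw [funext h]

theorem tsum_ofReal_of_hasSum {f : ℕ → ℝ} {a : ℝ} (h0 : ∀ n, 0 ≤ f n) (h : HasSum f a) :
    ∑' n, ENNReal.ofReal (f n) = ENNReal.ofReal a := by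
  rw [← ENNReal.ofReal_tsum_of_nonneg h0 h.summable, h.tsum_eq]

theorem ofReal_half_pow (n : ℕ) : ENNReal.ofReal ((1 / 2) ^ n) = 2⁻¹ ^ n := by
  rw [ENNReal.ofReal_pow (by norm_num), one_div, ENNReal.ofReal_inv_of_pos (by norm_num)]
  norm_num

/-- The generating function of the geometric distribution. -/
theorem tsum_geom_pow {r : ℝ} (h0 : 0 ≤ r) (h1 : r ≤ 1) :
    ∑' a : ℕ, 2⁻¹ ^ (a + 1) * ENNReal.ofReal r ^ a = ENNReal.ofReal (1 / (2 - r)) := by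
  have h := (hasSum_geometric_of_lt_one (r := r / 2) (by positivity) (by linarith)).mul_left (1 / 2)
  rw [show 1 / 2 * (1 - r / 2)⁻¹ = 1 / (2 - r) by
    have : (2 - r) ≠ 0 := by linarith
    have : (1 - r / 2) ≠ 0 := by linarith
    field_simp] at h
  rw [← tsum_ofReal_of_hasSum (fun n => by positivity) h]
  refine tsum_congr fun a => ?_
  rw [← ofReal_half_pow, ← ENNReal.ofReal_pow h0, ← ENNReal.ofReal_mul (by positivity)]
  congr 1
  rw [div_eq_mul_one_div r 2, mul_pow, pow_succ]
  ring

theorem tsum_geom_one : ∑' a : ℕ, (2⁻¹ : ℝ≥0∞) ^ (a + 1) = 1 := by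
  have := tsum_geom_pow zero_le_one le_rfl
  simpa using this.trans (by norm_num)

theorem tsum_geom_id : ∑' a : ℕ, (2⁻¹ : ℝ≥0∞) ^ (a + 1) * a = 1 := by
  have h := (hasSum_coe_mul_geometric_of_norm_lt_one (𝕜 := ℝ) (r := 1 / 2)
    (by norm_num)).mul_left (1 / 2)
  rw [show (1 : ℝ) / 2 * (1 / 2 / (1 - 1 / 2) ^ 2) = 1 by norm_num] at h
  rw [← ENNReal.ofReal_one, ← tsum_ofReal_of_hasSum (fun n => by positivity) h]
  refine tsum_congr fun a => ?_
  rw [← ofReal_half_pow, ← ENNReal.ofReal_natCast a, ← ENNReal.ofReal_mul (by positivity)]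
  congr 1
  rw [pow_succ]
  ring

theorem tsum_geom_sq : ∑' a : ℕ, (2⁻¹ : ℝ≥0∞) ^ (a + 1) * (a : ℝ≥0∞) ^ 2 = 3 := by
  have h0 := (hasSum_geometric_of_lt_one (r := (1 : ℝ) / 2) (by positivity) (by norm_num))
  have h1 := (hasSum_coe_mul_geometric_of_norm_lt_one (𝕜 := ℝ) (r := 1 / 2) (by norm_num))
  have h2 := (hasSum_choose_mul_geometric_of_norm_lt_one (𝕜 := ℝ) 2 (r := 1 / 2) (by norm_num))
  -- This uses `a ^ 2 = 2 * (a + 2).choose 2 - (3 * a + 2)`.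
  have h := ((h2.mul_left 2).sub ((h1.mul_left 3).add (h0.mul_left 2))).mul_left (1 / 2)
  have e : (1 : ℝ) / 2 * (2 * (1 / (1 - 1 / 2) ^ (2 + 1)) - (3 * (1 / 2 / (1 - 1 / 2) ^ 2) +
      2 * (1 - 1 / 2)⁻¹)) = 3 := by norm_num
  rw [e] at h
  have h' : HasSum (fun a : ℕ => (1 / 2 : ℝ) ^ (a + 1) * (a : ℝ) ^ 2) 3 := by
    refine h.congr_fun ?_
    intro a
    have hc : ((a + 2).choose 2 : ℝ) = (a + 2) * (a + 1) / 2 := by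
      rw [Nat.cast_choose_two]; push_cast; ring
    rw [hc, pow_succ]
    ring
  rw [show (3 : ℝ≥0∞) = ENNReal.ofReal 3 by norm_num,
    ← tsum_ofReal_of_hasSum (fun n => by positivity) h']
  refine tsum_congr fun a => ?_
  rw [← ofReal_half_pow, ← ENNReal.ofReal_natCast a, ← ENNReal.ofReal_pow (by positivity),
    ← ENNReal.ofReal_mul (by positivity)]

theorem geomMean_one (n : ℕ) : geomMean n (fun _ => 1) = 1 := by
  induction n with
  | zero => rfl
  | succ n ih => simp only [geomMean, ih, mul_one, tsum_geom_one]

theorem geomMean_pow {r : ℝ} (h0 : 0 ≤ r) (h1 : r ≤ 1) (n : ℕ) :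
    geomMean n (fun m => ENNReal.ofReal r ^ m) = ENNReal.ofReal (1 / (2 - r)) ^ n := by
  induction n with
  | zero => simp [geomMean]
  | succ n ih =>
    simp only [geomMean]
    rw [pow_succ, ← ih]
    conv_rhs => rw [← tsum_geom_pow h0 h1, ← ENNReal.tsum_mul_left]
    refine tsum_congr fun a => ?_
    simp only [pow_add _ a, geomMean_const_mul]
    ring

theorem geomMean_id (n : ℕ) : geomMean n (fun m => m) = n := by
  induction n with
  | zero => simp [geomMean]
  | succ n ih =>
    have h : ∀ a : ℕ, geomMean n (fun m => ((a + m : ℕ) : ℝ≥0∞)) = a + n := by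
      intro a
      have := geomMean_add n (fun _ => (a : ℝ≥0∞) * 1) (fun m => m)
      rw [geomMean_const_mul, geomMean_one, ih, mul_one] at this
      rw [← this]
      exact geomMean_congr fun m => by push_cast; rfl
    simp only [geomMean, h, mul_add, ENNReal.tsum_add, ENNReal.tsum_mul_right, tsum_geom_id,
      tsum_geom_one]
    push_cast
    ring

theorem geomMean_sq (n : ℕ) : geomMean n (fun m => (m : ℝ≥0∞) ^ 2) = n ^ 2 + 2 * n := by
  induction n with
  | zero => simp [geomMean]
  | succ n ih =>
    have h : ∀ a : ℕ, geomMean n (fun m => ((a + m : ℕ) : ℝ≥0∞) ^ 2) =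
        a ^ 2 + a * (2 * n) + (n ^ 2 + 2 * n) := by
      intro a
      have := geomMean_add n (fun m => (a : ℝ≥0∞) ^ 2 * 1 + a * 2 * m) (fun m => (m : ℝ≥0∞) ^ 2)
      rw [geomMean_add n (fun m => (a : ℝ≥0∞) ^ 2 * 1) (fun m => a * 2 * m), geomMean_const_mul,
        geomMean_const_mul, geomMean_one, ih, geomMean_id, mul_one, mul_assoc (a : ℝ≥0∞)] at this
      rw [← this]
      exact geomMean_congr fun m => by push_cast; ring
    simp only [geomMean, h, mul_add, ENNReal.tsum_add, ← mul_assoc, ENNReal.tsum_mul_right,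
      tsum_geom_sq, tsum_geom_id, tsum_geom_one]
    push_cast
    ring

theorem geomMean_one_sub_pow {r : ℝ} (h0 : 0 ≤ r) (h1 : r ≤ 1) (n : ℕ) :
    geomMean n (fun m => 1 - ENNReal.ofReal r ^ m) = 1 - ENNReal.ofReal (1 / (2 - r)) ^ n := by
  refine ENNReal.eq_sub_of_add_eq (ENNReal.pow_ne_top ENNReal.ofReal_ne_top) ?_
  rw [← geomMean_pow h0 h1, ← geomMean_add]
  refine Eq.trans ?_ (geomMean_one n)
  refine geomMean_congr fun m => tsub_add_cancel_of_le ?_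
  exact pow_le_one₀ zero_le (ENNReal.ofReal_le_one.2 h1)

/-! ### The offspring distributions -/

/-- The possible numbers of children of the vertices of a level of size `n`. -/
def Offspring (n : ℕ+) : Type := {c : List ℕ // c.length = n ∧ 0 < c.sum}

namespace Offspring

variable {n : ℕ+}

instance : MeasurableSpace (Offspring n) := ⊤

instance : DiscreteMeasurableSpace (Offspring n) := ⟨fun _ => trivial⟩

instance : Countable (Offspring n) := inferInstanceAs (Countable {c : List ℕ // c.length = n ∧ 0 < c.sum})

/-- The size of the next level. -/
def total (c : Offspring n) : ℕ+ := ⟨c.1.sum, c.2.2⟩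

/-- The conditional distribution of a level, given the preceding one. -/
noncomputable def weight (n : ℕ+) (c : Offspring n) : ℝ≥0∞ :=
  (c.1.sum : ℝ≥0∞) / n * 2⁻¹ ^ ((n : ℕ) + c.1.sum)

/-- The weight is the law of `n` geometric variables biased by their sum. Lists of sum zero, absent
from `Offspring n`, have bias zero and may be added back. -/
theorem tsum_weight_mul (φ : ℕ → ℝ≥0∞) :
    ∑' c : Offspring n, weight n c * φ c.1.sum = geomMean n (fun m => m * φ m) / n := by
  rw [ENNReal.div_eq_inv_mul, ← tsum_length_eq, ← ENNReal.tsum_mul_left]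
  set g : List ℕ → ℝ≥0∞ := fun c => (n : ℝ≥0∞)⁻¹ * (2⁻¹ ^ ((n : ℕ) + c.sum) * (c.sum * φ c.sum))
    with hg
  have h1 : ∑' c : Offspring n, weight n c * φ c.1.sum =
      ∑' c : ({c : List ℕ | c.length = n ∧ 0 < c.sum} : Set (List ℕ)), g c :=
    tsum_congr fun c => by
      rw [weight, hg, ENNReal.div_eq_inv_mul]
      ring
  have h2 : ∑' c : {c : List ℕ // c.length = n}, g c =
      ∑' c : ({c : List ℕ | c.length = n} : Set (List ℕ)), g c := rfl
  rw [h1, h2, tsum_subtype, tsum_subtype]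
  refine tsum_congr fun c => ?_
  by_cases h : c.length = n
  · by_cases h' : 0 < c.sum
    · rw [Set.indicator_of_mem (by exact ⟨h, h'⟩), Set.indicator_of_mem (by exact h)]
    · have h0 : c.sum = 0 := by omega
      rw [Set.indicator_of_notMem (by exact fun h3 => h' h3.2), Set.indicator_of_mem (by exact h)]
      simp only [hg, h0, Nat.cast_zero, zero_mul, mul_zero]
  · rw [Set.indicator_of_notMem (by exact fun h3 => h h3.1),
      Set.indicator_of_notMem (by exact h)]

/-- The sum of `n` geometric variables has mean `n`, so the bias divided by `n` has total mass one.
-/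
theorem hasSum_weight : HasSum (weight n) 1 := by
  have h := tsum_weight_mul (n := n) fun _ => 1
  simp only [mul_one] at h
  rw [geomMean_id, ENNReal.div_self (by simp) (by simp)] at h
  exact h ▸ ENNReal.summable.hasSum

noncomputable def pmf (n : ℕ+) : PMF (Offspring n) := ⟨weight n, hasSum_weight⟩

noncomputable def law (n : ℕ+) : MeasureTheory.Measure (Offspring n) := (pmf n).toMeasure

instance : MeasureTheory.IsProbabilityMeasure (law n) :=
  inferInstanceAs (MeasureTheory.IsProbabilityMeasure (pmf n).toMeasure)

theorem law_singleton (c : Offspring n) : law n {c} = weight n c :=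
  PMF.toMeasure_apply_singleton _ _ (MeasurableSet.singleton _)

end Offspring

end

/-! ### Limiting frequencies of trunks -/

section

open MeasureTheory Filter Topology
open scoped ENNReal

theorem isTrunk_concat {n m : ℕ} {p : List (List ℕ)} {c : List ℕ} : IsTrunk n (p ++ [c]) m ↔
    IsTrunk n p c.length ∧ c.sum = m ∧ 0 < m := by
  induction p generalizing n with
  | nil =>
    simp only [List.nil_append, IsTrunk]
    constructor
    · rintro ⟨h1, h2, h3, h4⟩; omega
    · rintro ⟨⟨h1, h2⟩, h3, h4⟩; omega
  | cons d p ih =>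
    simp only [List.cons_append, IsTrunk, ih]
    tauto

/-- The width of the top of a trunk. -/
def trunkWidth : ℕ → List (List ℕ) → ℕ
  | n, [] => n
  | _, c :: l => trunkWidth c.sum l

theorem IsTrunk.trunkWidth_eq {n m : ℕ} {p : List (List ℕ)} (h : IsTrunk n p m) :
    trunkWidth n p = m := by
  induction p generalizing n with
  | nil => exact h.2
  | cons c p ih => exact ih h.2.2

/-- The limiting frequency of the plane trees with a given trunk. -/
noncomputable def trunkWeight (p : List (List ℕ)) : ℝ≥0∞ :=
  ENNReal.ofReal (trunkWidth 1 p * 2 ^ trunkWidth 1 p / 2 / 4 ^ forestSize p)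

/-- The factor gained by a level is `(s / m) * 2 ^ s / 2 ^ m / 4 ^ s` with `s = c.1.sum`; it depends
on the trunk only through its width. This is what turns the limiting frequencies into the law of a
Markov chain. -/
theorem trunkWeight_concat {p : List (List ℕ)} {m : ℕ+} (h : IsTrunk 1 p m) (c : Offspring m) :
    trunkWeight (p ++ [c.1]) = trunkWeight p * Offspring.weight m c := by
  have h' : IsTrunk 1 (p ++ [c.1]) c.1.sum := isTrunk_concat.2 ⟨by rwa [c.2.1], rfl, c.2.2⟩
  have hm : (0 : ℝ) < (m : ℕ) := by exact_mod_cast m.pos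
  have hw : Offspring.weight m c =
      ENNReal.ofReal ((c.1.sum : ℝ) / (m : ℕ) * (1 / 2) ^ ((m : ℕ) + c.1.sum)) := by
    rw [Offspring.weight, ENNReal.ofReal_mul (by positivity), ofReal_half_pow,
      ENNReal.ofReal_div_of_pos hm, ENNReal.ofReal_natCast, ENNReal.ofReal_natCast]
  rw [trunkWeight, trunkWeight, hw, h.trunkWidth_eq, h'.trunkWidth_eq,
    ← ENNReal.ofReal_mul (by positivity), forestSize_append]
  congr 1
  have e : forestSize [c.1] = c.1.sum := by simp [forestSize]
  rw [e, pow_add (4 : ℝ), pow_add (1 / 2 : ℝ), one_div, inv_pow, inv_pow,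
    show (4 : ℝ) ^ c.1.sum = 2 ^ c.1.sum * 2 ^ c.1.sum by rw [← mul_pow]; norm_num]
  field_simp

/-! ### The random infinite tree -/

/-- Independent choices of the offspring of a level, for each height and width of the level. -/
abbrev TreeSpace : Type := (i : ℕ × ℕ+) → Offspring i.2

/-- The law of the choices. -/
noncomputable def treeLaw : Measure TreeSpace := Measure.infinitePi fun i => Offspring.law i.2

instance : IsProbabilityMeasure treeLaw :=
  inferInstanceAs (IsProbabilityMeasure (Measure.infinitePi fun i : ℕ × ℕ+ => Offspring.law i.2))

namespace TreeSpace

/-- The successive widths of the tree. -/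
def width (ω : TreeSpace) : ℕ → ℕ+
  | 0 => 1
  | k + 1 => (ω (k, width ω k)).total

/-- The offspring of the level `k`. -/
def level (ω : TreeSpace) (k : ℕ) : List ℕ := (ω (k, ω.width k)).1

/-- The offspring of the first `R` levels. -/
def trunk (ω : TreeSpace) (R : ℕ) : List (List ℕ) := (List.range R).map ω.level

variable (ω : TreeSpace)

theorem length_level (k : ℕ) : (ω.level k).length = ω.width k := (ω (k, ω.width k)).2.1

theorem trunk_succ (R : ℕ) : ω.trunk (R + 1) = ω.trunk R ++ [ω.level R] := by
  simp [trunk, List.range_succ]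

theorem length_trunk (R : ℕ) : (ω.trunk R).length = R := by simp [trunk]

theorem isTrunk_trunk (R : ℕ) : IsTrunk 1 (ω.trunk R) (ω.width R) := by
  induction R with
  | zero => exact ⟨one_pos, rfl⟩
  | succ R ih =>
    rw [trunk_succ, isTrunk_concat]
    exact ⟨by rwa [length_level], rfl, (ω.width (R + 1)).pos⟩

theorem trunkWidth_trunk (R : ℕ) : trunkWidth 1 (ω.trunk R) = ω.width R :=
  (ω.isTrunk_trunk R).trunkWidth_eq

theorem trunk_succ_eq_iff {R : ℕ} {p : List (List ℕ)} {c : List ℕ} :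
    ω.trunk (R + 1) = p ++ [c] ↔ ω.trunk R = p ∧ ω.level R = c := by
  rw [trunk_succ]
  constructor
  · intro h
    obtain ⟨h1, h2⟩ := List.append_inj' h rfl
    exact ⟨h1, List.singleton_inj.1 h2⟩
  · rintro ⟨rfl, rfl⟩; rfl

theorem setOf_trunk_eq_empty {R : ℕ} {p : List (List ℕ)}
    (h : ¬ (p.length = R ∧ ∃ m, IsTrunk 1 p m)) : {ω : TreeSpace | ω.trunk R = p} = ∅ := by
  rw [Set.eq_empty_iff_forall_notMem]
  rintro ω rfl
  exact h ⟨ω.length_trunk R, _, ω.isTrunk_trunk R⟩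

/-- Given the trunk, its widths are known, so each level reads one known coordinate. The coordinates
used before have height less than `R`; hence `(R, m₀)` is a new independent factor, of weight given
by `trunkWeight_concat`. -/
theorem exists_cylinder (R : ℕ) : ∀ p : List (List ℕ), ∀ m : ℕ, p.length = R → IsTrunk 1 p m →
    ∃ (s : Finset (ℕ × ℕ+)) (t : (i : ℕ × ℕ+) → Set (Offspring i.2)), (∀ i ∈ s, i.1 < R) ∧
      {ω : TreeSpace | ω.trunk R = p} = Set.pi s t ∧
      ∏ i ∈ s, Offspring.law i.2 (t i) = trunkWeight p := by
  induction R with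
  | zero =>
    intro p m hp _
    obtain rfl := List.eq_nil_of_length_eq_zero hp
    refine ⟨∅, fun _ => Set.univ, by simp, ?_, ?_⟩
    · simp [trunk]
    · simp [trunkWeight, trunkWidth, forestSize]
  | succ R ih =>
    intro p m hp hm
    obtain ⟨q, c, rfl⟩ : ∃ q c, p = q ++ [c] :=
      ⟨p.dropLast, p.getLast (by rintro rfl; simp at hp), (List.dropLast_append_getLast _).symm⟩
    obtain ⟨h1, rfl, h3⟩ := isTrunk_concat.1 hm
    let m₀ : ℕ+ := ⟨c.length, h1.pos⟩
    let c₀ : Offspring m₀ := ⟨c, rfl, h3⟩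
    have hq : q.length = R := by simpa using hp
    obtain ⟨s, t, hs, hst, hprod⟩ := ih q _ hq h1
    have hnot : ((R, m₀) : ℕ × ℕ+) ∉ s := fun h => lt_irrefl _ (hs _ h)
    refine ⟨insert (R, m₀) s, Function.update t (R, m₀) {c₀}, ?_, ?_, ?_⟩
    · intro i hi
      rcases Finset.mem_insert.1 hi with rfl | hi
      · exact Nat.lt_succ_self R
      · exact (hs i hi).trans (Nat.lt_succ_self R)
    · have h4 : Set.pi (s : Set (ℕ × ℕ+)) (Function.update t (R, m₀) {c₀}) =
          Set.pi (s : Set (ℕ × ℕ+)) t := by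
        refine Set.pi_congr rfl fun i hi => Function.update_of_ne ?_ _ _
        rintro rfl
        exact hnot hi
      rw [Finset.coe_insert, Set.insert_pi, h4, ← hst, Function.update_self]
      ext ω
      change ω.trunk (R + 1) = q ++ [c] ↔ ω (R, m₀) = c₀ ∧ ω.trunk R = q
      rw [trunk_succ_eq_iff, and_comm]
      refine and_congr_left fun h => ?_
      have hw : ω.width R = m₀ := PNat.eq (by
        rw [← trunkWidth_trunk, h]; exact h1.trunkWidth_eq)
      have key : ∀ n : ℕ+, n = m₀ → ((ω (R, n)).1 = c ↔ ω (R, m₀) = c₀) := by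
        rintro n rfl
        exact (Subtype.ext_iff (a1 := ω (R, m₀)) (a2 := c₀)).symm
      exact key _ hw
    · rw [Finset.prod_insert hnot, Function.update_self, Offspring.law_singleton]
      have h4 : ∏ i ∈ s, Offspring.law i.2 (Function.update t (R, m₀) {c₀} i) =
          ∏ i ∈ s, Offspring.law i.2 (t i) := by
        refine Finset.prod_congr rfl fun i hi => ?_
        rw [Function.update_of_ne]
        rintro rfl
        exact hnot hi
      rw [h4, hprod, mul_comm]
      exact (trunkWeight_concat (m := m₀) h1 c₀).symm

theorem treeLaw_trunk {R : ℕ} {p : List (List ℕ)} {m : ℕ} (hp : p.length = R)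
    (hm : IsTrunk 1 p m) : treeLaw {ω | ω.trunk R = p} = trunkWeight p := by
  obtain ⟨s, t, -, hst, hprod⟩ := exists_cylinder R p m hp hm
  rw [hst, treeLaw, Measure.infinitePi_pi _ fun i _ => MeasurableSet.of_discrete, hprod]

theorem measurableSet_trunk (R : ℕ) (p : List (List ℕ)) :
    MeasurableSet {ω : TreeSpace | ω.trunk R = p} := by
  by_cases h : p.length = R ∧ ∃ m, IsTrunk 1 p m
  · obtain ⟨hp, m, hm⟩ := h
    obtain ⟨s, t, -, hst, -⟩ := exists_cylinder R p m hp hm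
    rw [hst]
    exact MeasurableSet.pi s.countable_toSet fun i _ => MeasurableSet.of_discrete
  · rw [setOf_trunk_eq_empty h]
    exact MeasurableSet.empty

theorem measurableSet_trunk_mem (R : ℕ) (S : Set (List (List ℕ))) :
    MeasurableSet {ω : TreeSpace | ω.trunk R ∈ S} := by
  have : {ω : TreeSpace | ω.trunk R ∈ S} = ⋃ p ∈ S, {ω | ω.trunk R = p} := by ext; simp
  rw [this]
  exact MeasurableSet.biUnion S.to_countable fun p _ => measurableSet_trunk R p

end TreeSpace

theorem lintegral_comp_of_countable {Ω β : Type*} [MeasurableSpace Ω] {μ : Measure Ω}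
    [Countable β] {g : Ω → β} (hg : ∀ b, MeasurableSet {ω | g ω = b}) (φ : β → ℝ≥0∞) :
    ∫⁻ ω, φ (g ω) ∂μ = ∑' b, φ b * μ {ω | g ω = b} := by
  let _ : MeasurableSpace β := ⊤
  have : DiscreteMeasurableSpace β := ⟨fun _ => trivial⟩
  have hgm : Measurable g := measurable_to_countable' hg
  rw [← lintegral_map (f := φ) (Measurable.of_discrete) hgm, lintegral_countable']
  exact tsum_congr fun b => by rw [Measure.map_apply hgm (MeasurableSet.singleton b)]; rfl

namespace TreeSpace

/-- The Markov property of the widths. -/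
theorem lintegral_width_succ (R : ℕ) (φ : ℕ → ℝ≥0∞) :
    ∫⁻ ω : TreeSpace, φ (ω.width (R + 1)) ∂treeLaw =
      ∫⁻ ω : TreeSpace, geomMean (ω.width R) (fun m => m * φ m) / (ω.width R : ℕ) ∂treeLaw := by
  have hfib : ∀ (p : List (List ℕ)) (c : List ℕ),
      {ω : TreeSpace | (ω.trunk R, ω.level R) = (p, c)} = {ω | ω.trunk (R + 1) = p ++ [c]} := by
    intro p c
    ext ω
    simp only [Set.mem_ofPred_eq, Prod.mk.injEq, trunk_succ_eq_iff]
  have h1 := lintegral_comp_of_countable (μ := treeLaw)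
    (g := fun ω : TreeSpace => (ω.trunk R, ω.level R))
    (fun b => by rw [hfib b.1 b.2]; exact measurableSet_trunk _ _) (fun b => φ b.2.sum)
  have h2 := lintegral_comp_of_countable (μ := treeLaw) (g := fun ω : TreeSpace => ω.trunk R)
    (measurableSet_trunk R)
    (fun p => geomMean (trunkWidth 1 p) (fun m => m * φ m) / trunkWidth 1 p)
  simp only [trunkWidth_trunk] at h2
  rw [h2]
  refine h1.trans ?_
  rw [ENNReal.tsum_prod']
  refine tsum_congr fun p => ?_
  simp only [hfib]
  by_cases h : p.length = R ∧ ∃ m, IsTrunk 1 p m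
  · obtain ⟨hp, m, hm⟩ := h
    let m₀ : ℕ+ := ⟨m, hm.pos⟩
    have hm₀ : IsTrunk 1 p m₀ := hm
    have hsupp : Function.support (fun c : List ℕ =>
        φ c.sum * treeLaw {ω | ω.trunk (R + 1) = p ++ [c]}) ⊆
        {c : List ℕ | c.length = (m₀ : ℕ) ∧ 0 < c.sum} := by
      intro c hc
      by_contra hcn
      refine hc ?_
      dsimp only
      rw [setOf_trunk_eq_empty, measure_empty, mul_zero]
      rintro ⟨-, m', hm'⟩
      obtain ⟨h3, rfl, h4⟩ := isTrunk_concat.1 hm'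
      exact hcn ⟨h3.trunkWidth_eq.symm.trans hm.trunkWidth_eq, h4⟩
    rw [← tsum_subtype_eq_of_support_subset hsupp, hm.trunkWidth_eq]
    change ∑' c : Offspring m₀, φ c.1.sum * treeLaw {ω | ω.trunk (R + 1) = p ++ [c.1]} = _
    have hw := Offspring.tsum_weight_mul (n := m₀) φ
    change _ = geomMean m (fun m => m * φ m) / (m : ℝ≥0∞) at hw
    rw [← hw, ← ENNReal.tsum_mul_right]
    refine tsum_congr fun c => ?_
    have htr : IsTrunk 1 (p ++ [c.1]) c.1.sum := isTrunk_concat.2 ⟨by rw [c.2.1]; exact hm, rfl, c.2.2⟩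
    rw [treeLaw_trunk (by simp [hp]) htr, treeLaw_trunk hp hm, trunkWeight_concat hm₀]
    ring
  · rw [setOf_trunk_eq_empty h, measure_empty, mul_zero, ENNReal.tsum_eq_zero]
    intro c
    rw [setOf_trunk_eq_empty, measure_empty, mul_zero]
    rintro ⟨h3, m', hm'⟩
    exact h ⟨by simpa using h3, _, (isTrunk_concat.1 hm').1⟩

/-- Because of the bias, the conditional mean of the next width is the second moment `n ^ 2 + 2 * n`
of a sum of `n` geometric variables divided by `n`, that is `n + 2`. -/
theorem lintegral_width (R : ℕ) :
    ∫⁻ ω : TreeSpace, ((ω.width R : ℕ) : ℝ≥0∞) ∂treeLaw = 2 * R + 1 := by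
  induction R with
  | zero => simp [width]
  | succ R ih =>
    rw [lintegral_width_succ R (fun m => m)]
    have h : ∀ ω : TreeSpace, geomMean (ω.width R) (fun m => (m : ℝ≥0∞) * m) / (ω.width R : ℕ) =
        ((ω.width R : ℕ) : ℝ≥0∞) + 2 := by
      intro ω
      have h0 : ((ω.width R : ℕ) : ℝ≥0∞) ≠ 0 := by simp
      have hsq := geomMean_sq (ω.width R)
      simp only [sq] at hsq
      rw [hsq, ← add_mul, ENNReal.mul_div_cancel_right h0 (ENNReal.natCast_ne_top _)]
    simp only [h]
    rw [lintegral_add_right _ measurable_const, ih, lintegral_const, measure_univ]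
    push_cast
    ring

/-- For the function `(1 - s ^ w) / w` of the width `w` the bias cancels the denominator, and one
step of the chain replaces `s` by `1 / (2 - s)`, the geometric generating function. It maps `j / (j
+ 1)` to `(j + 1) / (j + 2)`. Start at `s = 0`, where the function is `w⁻¹`; after `R` steps the
parameter is `R / (R + 1)` and the width is `1`. -/
theorem lintegral_inv_width (R : ℕ) :
    ∫⁻ ω : TreeSpace, ((ω.width R : ℕ) : ℝ≥0∞)⁻¹ ∂treeLaw = ((R : ℝ≥0∞) + 1)⁻¹ := by
  let s : ℕ → ℝ := fun j => j / (j + 1)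
  have hs0 : ∀ j, 0 ≤ s j := fun j => by positivity
  have hs1 : ∀ j, s j ≤ 1 := fun j => by
    rw [div_le_one (by positivity)]; linarith
  have hsucc : ∀ j, 1 / (2 - s j) = s (j + 1) := fun j => by
    simp only [s]
    have h1 : (2 : ℝ) - j / (j + 1) = (j + 2) / (j + 1) := by field_simp; ring
    rw [h1, one_div_div]
    push_cast
    congr 1
    ring
  have key : ∀ R j, ∫⁻ ω : TreeSpace,
      (1 - ENNReal.ofReal (s j) ^ (ω.width R : ℕ)) / (ω.width R : ℕ) ∂treeLaw =
        1 - ENNReal.ofReal (s (R + j)) := by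
    intro R
    induction R with
    | zero => intro j; simp [width]
    | succ R ih =>
      intro j
      rw [lintegral_width_succ R (fun m => (1 - ENNReal.ofReal (s j) ^ m) / m)]
      have h : ∀ n : ℕ, geomMean n
          (fun m => (m : ℝ≥0∞) * ((1 - ENNReal.ofReal (s j) ^ m) / m)) =
            1 - ENNReal.ofReal (s (j + 1)) ^ n := by
        intro n
        rw [← hsucc, ← geomMean_one_sub_pow (hs0 j) (hs1 j)]
        refine geomMean_congr fun m => ?_
        rcases Nat.eq_zero_or_pos m with rfl | hm
        · simp
        · rw [ENNReal.mul_div_cancel (by exact_mod_cast hm.ne') (ENNReal.natCast_ne_top _)]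
      simp only [h]
      rw [ih (j + 1), show R + 1 + j = R + (j + 1) by omega]
  have h := key R 0
  have e : ∀ ω : TreeSpace, (1 - ENNReal.ofReal (s 0) ^ (ω.width R : ℕ)) / (ω.width R : ℕ) =
      ((ω.width R : ℕ) : ℝ≥0∞)⁻¹ := by
    intro ω
    simp [s]
  simp only [e] at h
  rw [h, add_zero, ← ENNReal.ofReal_one, ← ENNReal.ofReal_sub _ (hs0 R)]
  have h1 : 1 - s R = ((R : ℝ) + 1)⁻¹ := by simp only [s]; field_simp; ring
  rw [h1, ENNReal.ofReal_inv_of_pos (by positivity), ENNReal.ofReal_add (by positivity) zero_le_one,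
    ENNReal.ofReal_natCast, ENNReal.ofReal_one]

end TreeSpace

end

section

open MeasureTheory Filter Topology
open scoped ENNReal

/-! ### Growth of the volume -/

/-- On `k ≤ R` the weight `(k + 1) ^ p` is at most `(R + 1) ^ p`, so the weighted series bounds the
partial sums. One is added to its value to keep `A` positive. -/
theorem exists_sum_le_of_tsum_ne_top {g : ℕ → ℝ} (hg : ∀ k, 0 ≤ g k) {p : ℝ} (hp : 0 ≤ p)
    (h : ∑' k : ℕ, ENNReal.ofReal (g k * ((k : ℝ) + 1) ^ (-p)) ≠ ∞) :
    ∃ A, 0 < A ∧ ∀ R : ℕ, ∑ k ∈ Finset.Icc 1 R, g k ≤ A * ((R : ℝ) + 1) ^ p := by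
  have ha : ∀ k : ℕ, 0 ≤ g k * ((k : ℝ) + 1) ^ (-p) := fun k => mul_nonneg (hg k) (by positivity)
  have hs : Summable fun k : ℕ => g k * ((k : ℝ) + 1) ^ (-p) := by
    have := ENNReal.summable_toReal h
    simpa only [ENNReal.toReal_ofReal (ha _)] using this
  refine ⟨∑' k : ℕ, g k * ((k : ℝ) + 1) ^ (-p) + 1, by
    have : 0 ≤ ∑' k : ℕ, g k * ((k : ℝ) + 1) ^ (-p) := tsum_nonneg ha
    linarith,
    fun R => ?_⟩
  have h1 : ∑ k ∈ Finset.Icc 1 R, g k ≤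
      (∑ k ∈ Finset.Icc 1 R, g k * ((k : ℝ) + 1) ^ (-p)) * ((R : ℝ) + 1) ^ p := by
    rw [Finset.sum_mul]
    refine Finset.sum_le_sum fun k hk => ?_
    have hkR : (k : ℝ) ≤ R := by exact_mod_cast (Finset.mem_Icc.1 hk).2
    have h2 : ((k : ℝ) + 1) ^ p ≤ ((R : ℝ) + 1) ^ p :=
      Real.rpow_le_rpow (by positivity) (by linarith) hp
    have h3 : ((k : ℝ) + 1) ^ (-p) * ((k : ℝ) + 1) ^ p = 1 := by
      rw [← Real.rpow_add (by positivity), neg_add_cancel, Real.rpow_zero]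
    calc g k = g k * ((k : ℝ) + 1) ^ (-p) * ((k : ℝ) + 1) ^ p := by rw [mul_assoc, h3, mul_one]
      _ ≤ _ := mul_le_mul_of_nonneg_left h2 (ha k)
  refine h1.trans (mul_le_mul_of_nonneg_right ?_ (by positivity))
  have := hs.sum_le_tsum (Finset.Icc 1 R) fun k _ => ha k
  linarith

/-- The upper bound is `h1`; the lower bound comes from `h2` and the Cauchy–Schwarz inequality `R ^
2 ≤ (∑ w) * ∑ w⁻¹`. Constants disappear after division by `log R`. The exponents run through the
countable family `1 / (q + 1)` so that almost sure bounds can be combined. -/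
theorem tendsto_log_div_log {w B : ℕ → ℕ} (hw : ∀ k, 0 < w k)
    (h1 : ∀ q : ℕ, ∃ A : ℝ, 0 < A ∧ ∀ R : ℕ, ∑ k ∈ Finset.Icc 1 R, (w k : ℝ) ≤
      A * ((R : ℝ) + 1) ^ (2 + 1 / ((q : ℝ) + 1)))
    (h2 : ∀ q : ℕ, ∃ A : ℝ, 0 < A ∧ ∀ R : ℕ, ∑ k ∈ Finset.Icc 1 R, (w k : ℝ)⁻¹ ≤
      A * ((R : ℝ) + 1) ^ (1 / ((q : ℝ) + 1)))
    (hB : ∀ R, 0 < R → ∑ k ∈ Finset.Icc 1 R, w k ≤ B R ∧ B R ≤ 4 * ∑ k ∈ Finset.Icc 1 R, w k) :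
    Tendsto (fun R : ℕ => Real.log (B R) / Real.log R) atTop (𝓝 2) := by
  have hV : ∀ R, 0 < R → (0 : ℝ) < ∑ k ∈ Finset.Icc 1 R, (w k : ℝ) := fun R hR =>
    Finset.sum_pos (fun k _ => by exact_mod_cast hw k) ⟨1, Finset.mem_Icc.2 ⟨le_rfl, hR⟩⟩
  have hB' : ∀ R, 0 < R → ∑ k ∈ Finset.Icc 1 R, (w k : ℝ) ≤ B R ∧
      (B R : ℝ) ≤ 4 * ∑ k ∈ Finset.Icc 1 R, (w k : ℝ) := fun R hR => by
    obtain ⟨h3, h4⟩ := hB R hR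
    exact ⟨by exact_mod_cast h3, by exact_mod_cast h4⟩
  have hlogR : ∀ R : ℕ, 2 ≤ R → 0 < Real.log R ∧
      Real.log ((R : ℝ) + 1) ≤ Real.log 2 + Real.log R := fun R hR => by
    have hR' : (2 : ℝ) ≤ R := by exact_mod_cast hR
    refine ⟨Real.log_pos (by linarith), ?_⟩
    rw [← Real.log_mul (by norm_num) (by linarith)]
    exact Real.log_le_log (by linarith) (by linarith)
  have hlog0 : ∀ c d : ℝ, Tendsto (fun R : ℕ => c + d / Real.log R) atTop (𝓝 c) := fun c d => by
    have := (Real.tendsto_log_atTop.comp tendsto_natCast_atTop_atTop).const_div_atTop d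
    simpa using this.const_add c
  have hup : ∀ q : ℕ, ∃ d : ℝ, ∀ R : ℕ, 2 ≤ R →
      Real.log (B R) / Real.log R ≤ 2 + 1 / ((q : ℝ) + 1) + d / Real.log R := by
    intro q
    obtain ⟨A, hA, hAR⟩ := h1 q
    refine ⟨Real.log (4 * A) + (2 + 1 / ((q : ℝ) + 1)) * Real.log 2, fun R hR => ?_⟩
    obtain ⟨hl, hl'⟩ := hlogR R hR
    obtain ⟨h3, h4⟩ := hB' R (by omega)
    have hBpos := (hV R (by omega)).trans_le h3
    rw [div_le_iff₀ hl, add_mul, div_mul_cancel₀ _ hl.ne']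
    have h5 : (B R : ℝ) ≤ 4 * A * ((R : ℝ) + 1) ^ (2 + 1 / ((q : ℝ) + 1)) := by
      have := hAR R; linarith
    have h6 := Real.log_le_log hBpos h5
    rw [Real.log_mul (by positivity) (by positivity), Real.log_rpow (by positivity)] at h6
    have h7 := mul_le_mul_of_nonneg_left hl'
      (show (0 : ℝ) ≤ 2 + 1 / ((q : ℝ) + 1) by positivity)
    rw [mul_add] at h7
    linarith
  have hlow : ∀ q : ℕ, ∃ d : ℝ, ∀ R : ℕ, 2 ≤ R →
      2 - 1 / ((q : ℝ) + 1) + d / Real.log R ≤ Real.log (B R) / Real.log R := by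
    intro q
    obtain ⟨A, hA, hAR⟩ := h2 q
    refine ⟨-(Real.log A + 1 / ((q : ℝ) + 1) * Real.log 2), fun R hR => ?_⟩
    obtain ⟨hl, hl'⟩ := hlogR R hR
    obtain ⟨h3, h4⟩ := hB' R (by omega)
    have hVpos := hV R (by omega)
    have hBpos := hVpos.trans_le h3
    rw [le_div_iff₀ hl, add_mul, div_mul_cancel₀ _ hl.ne']
    have hR0 : (0 : ℝ) < R := by exact_mod_cast (by omega : 0 < R)
    have hcs : (R : ℝ) ^ 2 ≤ (∑ k ∈ Finset.Icc 1 R, (w k : ℝ)) *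
        ∑ k ∈ Finset.Icc 1 R, (w k : ℝ)⁻¹ := by
      have := Finset.sum_sq_le_sum_mul_sum_of_sq_le_mul (Finset.Icc 1 R) (r := fun _ => (1 : ℝ))
        (f := fun k => (w k : ℝ)) (g := fun k => (w k : ℝ)⁻¹) (fun k _ => by positivity)
        (fun k _ => by positivity) (fun k _ => by
          have : (w k : ℝ) ≠ 0 := by exact_mod_cast (hw k).ne'
          rw [mul_inv_cancel₀ this, one_pow])
      simpa using this
    have h5 : (R : ℝ) ^ 2 ≤ B R * (A * ((R : ℝ) + 1) ^ (1 / ((q : ℝ) + 1))) :=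
      hcs.trans (mul_le_mul h3 (hAR R) (Finset.sum_nonneg fun k _ => by positivity) hBpos.le)
    have h6 := Real.log_le_log (by positivity) h5
    rw [Real.log_mul hBpos.ne' (by positivity), Real.log_mul hA.ne' (by positivity),
      Real.log_rpow (by positivity), Real.log_pow] at h6
    have h7 := mul_le_mul_of_nonneg_left hl' (show (0 : ℝ) ≤ 1 / ((q : ℝ) + 1) by positivity)
    rw [mul_add] at h7
    push_cast at h6
    linarith
  refine tendsto_order.2 ⟨fun a ha => ?_, fun a ha => ?_⟩
  · obtain ⟨q, hq⟩ := exists_nat_one_div_lt (show 0 < 2 - a by linarith)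
    obtain ⟨d, hd⟩ := hlow q
    filter_upwards [(tendsto_order.1 (hlog0 (2 - 1 / ((q : ℝ) + 1)) d)).1 a (by linarith),
      eventually_ge_atTop 2] with R h3 h4
    exact h3.trans_le (hd R h4)
  · obtain ⟨q, hq⟩ := exists_nat_one_div_lt (show 0 < a - 2 by linarith)
    obtain ⟨d, hd⟩ := hup q
    filter_upwards [(tendsto_order.1 (hlog0 (2 + 1 / ((q : ℝ) + 1)) d)).2 a (by linarith),
      eventually_ge_atTop 2] with R h3 h4
    exact (hd R h4).trans_lt h3

namespace TreeSpace

theorem measurable_width (k : ℕ) : Measurable fun ω : TreeSpace => (ω.width k : ℕ) := by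
  refine measurable_to_countable' fun n => ?_
  have : (fun ω : TreeSpace => (ω.width k : ℕ)) ⁻¹' {n} =
      {ω | ω.trunk k ∈ {p | trunkWidth 1 p = n}} := by
    ext ω
    simp [trunkWidth_trunk]
  rw [this]
  exact measurableSet_trunk_mem _ _

theorem tsum_rpow_ne_top {ε : ℝ} (hε : 0 < ε) :
    ∑' k : ℕ, ENNReal.ofReal (((k : ℝ) + 1) ^ (-(1 + ε))) ≠ ∞ := by
  have h := (summable_nat_add_iff 1).2 (Real.summable_nat_rpow_inv.2 (show 1 < 1 + ε by linarith))
  have h' : Summable fun k : ℕ => ((k : ℝ) + 1) ^ (-(1 + ε)) := by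
    refine h.congr fun k => ?_
    rw [Real.rpow_neg (by positivity)]
    push_cast
    rfl
  exact h'.tsum_ofReal_ne_top

theorem ae_tsum_ne_top {f : ℕ → ℕ → ℝ≥0∞} {b : ℕ → ℝ≥0∞} (hb : ∑' k, b k ≠ ∞)
    (hf : ∀ k, ∫⁻ ω : TreeSpace, f k (ω.width k) ∂treeLaw ≤ b k) :
    ∀ᵐ ω : TreeSpace ∂treeLaw, ∑' k, f k (ω.width k) ≠ ∞ := by
  have hm : ∀ k, Measurable fun ω : TreeSpace => f k (ω.width k) := fun k =>
    (Measurable.of_discrete (f := f k)).comp (measurable_width k)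
  have h : ∫⁻ ω : TreeSpace, ∑' k, f k (ω.width k) ∂treeLaw ≠ ∞ := by
    rw [lintegral_tsum fun k => (hm k).aemeasurable]
    exact ne_top_of_le_ne_top hb (ENNReal.tsum_le_tsum hf)
  filter_upwards [ae_lt_top (Measurable.tsum hm) h] with ω hω using hω.ne

/-- The mean width is at most `2 * (k + 1)`, so the weights `(k + 1) ^ (-(2 + ε))` make the expected
series converge. -/
theorem ae_sum_width_le (q : ℕ) : ∀ᵐ ω : TreeSpace ∂treeLaw, ∃ A : ℝ, 0 < A ∧ ∀ R : ℕ,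
    ∑ k ∈ Finset.Icc 1 R, ((ω.width k : ℕ) : ℝ) ≤
      A * ((R : ℝ) + 1) ^ (2 + 1 / ((q : ℝ) + 1)) := by
  have hε : (0 : ℝ) < 1 / ((q : ℝ) + 1) := by positivity
  set ε : ℝ := 1 / ((q : ℝ) + 1)
  have h := ae_tsum_ne_top (b := fun k => 2 * ENNReal.ofReal (((k : ℝ) + 1) ^ (-(1 + ε))))
    (f := fun k n => (n : ℝ≥0∞) * ENNReal.ofReal (((k : ℝ) + 1) ^ (-(2 + ε))))
    (by rw [ENNReal.tsum_mul_left]; exact ENNReal.mul_ne_top (by simp) (tsum_rpow_ne_top hε))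
    (fun k => by
      have hm : Measurable fun ω : TreeSpace => ((ω.width k : ℕ) : ℝ≥0∞) :=
        (Measurable.of_discrete (f := fun n : ℕ => (n : ℝ≥0∞))).comp (measurable_width k)
      rw [lintegral_mul_const _ hm, lintegral_width]
      have e1 : (2 * (k : ℝ≥0∞) + 1) ≤ 2 * ENNReal.ofReal ((k : ℝ) + 1) := by
        rw [ENNReal.ofReal_add (by positivity) zero_le_one, ENNReal.ofReal_natCast,
          ENNReal.ofReal_one, mul_add, mul_one]
        gcongr
        exact one_le_two
      refine (mul_le_mul_left e1 _).trans (le_of_eq ?_)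
      rw [mul_assoc, ← ENNReal.ofReal_mul (by positivity)]
      congr 2
      rw [← Real.rpow_one_add' (by positivity) (by linarith)]
      congr 1
      ring)
  filter_upwards [h] with ω hω
  refine exists_sum_le_of_tsum_ne_top (fun k => by positivity) (by positivity) ?_
  convert hω using 3 with k
  rw [ENNReal.ofReal_mul (by positivity), ENNReal.ofReal_natCast]

/-- The mean of the inverse width is `1 / (k + 1)`, so here the weights `(k + 1) ^ (-ε)` suffice. -/
theorem ae_sum_inv_width_le (q : ℕ) : ∀ᵐ ω : TreeSpace ∂treeLaw, ∃ A : ℝ, 0 < A ∧ ∀ R : ℕ,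
    ∑ k ∈ Finset.Icc 1 R, ((ω.width k : ℕ) : ℝ)⁻¹ ≤
      A * ((R : ℝ) + 1) ^ (1 / ((q : ℝ) + 1)) := by
  have hε : (0 : ℝ) < 1 / ((q : ℝ) + 1) := by positivity
  set ε : ℝ := 1 / ((q : ℝ) + 1)
  have h := ae_tsum_ne_top (b := fun k => ENNReal.ofReal (((k : ℝ) + 1) ^ (-(1 + ε))))
    (f := fun k n => (n : ℝ≥0∞)⁻¹ * ENNReal.ofReal (((k : ℝ) + 1) ^ (-ε)))
    (tsum_rpow_ne_top hε)
    (fun k => by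
      have hm : Measurable fun ω : TreeSpace => ((ω.width k : ℕ) : ℝ≥0∞)⁻¹ :=
        (Measurable.of_discrete (f := fun n : ℕ => (n : ℝ≥0∞)⁻¹)).comp (measurable_width k)
      rw [lintegral_mul_const _ hm, lintegral_inv_width]
      have e1 : ((k : ℝ≥0∞) + 1)⁻¹ = ENNReal.ofReal (((k : ℝ) + 1)⁻¹) := by
        rw [ENNReal.ofReal_inv_of_pos (by positivity),
          ENNReal.ofReal_add (by positivity) zero_le_one, ENNReal.ofReal_natCast,
          ENNReal.ofReal_one]
      rw [e1, ← ENNReal.ofReal_mul (by positivity)]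
      refine le_of_eq ?_
      congr 1
      rw [← Real.rpow_neg_one, ← Real.rpow_add (by positivity)]
      congr 1
      ring)
  filter_upwards [h] with ω hω
  refine exists_sum_le_of_tsum_ne_top (fun k => by positivity) hε.le ?_
  convert hω using 3 with k
  have hpos : (0 : ℝ) < (ω.width k : ℕ) := by exact_mod_cast (ω.width k).pos
  rw [ENNReal.ofReal_mul (by positivity), ENNReal.ofReal_inv_of_pos hpos, ENNReal.ofReal_natCast]

/-! ### The random infinite triangulation -/

/-- The code of the infinite tree. -/
def child (ω : TreeSpace) (k i : ℕ) : ℕ := (ω.level k).getD i 0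

theorem levelSize_child (ω : TreeSpace) (k : ℕ) : levelSize ω.child k = ω.width k := by
  induction k with
  | zero => rfl
  | succ k ih =>
    rw [levelSize_succ, ih, ← length_level]
    exact childSum_getD _

def code (ω : TreeSpace) : LayerCode :=
  ⟨ω.child, 0, by omega, fun k => by rw [levelSize_child]; exact (ω.width k).pos,
    fun k hk => by omega⟩

theorem n_code (ω : TreeSpace) (k : ℕ) : ω.code.n k = ω.width k := ω.levelSize_child k

theorem ae_hasHausdorffDim :
    ∀ᵐ ω : TreeSpace ∂treeLaw, ω.code.toRootedMap.HasHausdorffDim 2 := by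
  filter_upwards [ae_all_iff.2 ae_sum_width_le, ae_all_iff.2 ae_sum_inv_width_le] with ω h1 h2
  refine tendsto_log_div_log (w := fun k => (ω.width k : ℕ)) (fun k => (ω.width k).pos) h1 h2
    fun R hR => ?_
  have hvol : ω.code.volume R = ∑ k ∈ Finset.Icc 1 R, (ω.width k : ℕ) :=
    Finset.sum_congr rfl fun k _ => ω.n_code k
  rw [← hvol]
  exact ⟨LayerCode.volume_le_ballSize (Or.inl rfl), LayerCode.ballSize_le_volume hR⟩

theorem agree_of_trunk_eq {ω ω' : TreeSpace} {R : ℕ} (h : ω.trunk R = ω'.trunk R) :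
    LayerCode.Agree R ω.code ω'.code := by
  have hl : ∀ k < R, ω.level k = ω'.level k := fun k hk =>
    List.map_inj_left.1 h k (List.mem_range.2 hk)
  refine ⟨fun k hk i _ => ?_, Or.inl rfl, Or.inl rfl⟩
  change (ω.level k).getD i 0 = (ω'.level k).getD i 0
  rw [hl k hk]

/-- Above a trunk with `R` levels there is a further level of positive width, so the forest has more
than `R` levels and its cut lies above height `R`. -/
theorem agree_ofForest {ω : TreeSpace} {R : ℕ} {l : List (List ℕ)} (hl : IsForest 1 l)
    (hl1 : l.length ≠ 1) (h : ω.trunk R <+: l) :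
    LayerCode.Agree R ω.code (LayerCode.ofForest l) := by
  obtain ⟨t, rfl⟩ := h
  have ht := ((ω.isTrunk_trunk R).isForest_append t).1 hl
  have ht0 := ht.length_pos (ω.width R).pos
  have hlen : R < (ω.trunk R ++ t).length := by
    rw [List.length_append, length_trunk]; omega
  refine ⟨fun k hk i _ => ?_, Or.inl rfl, Or.inr (by rwa [LayerCode.ofForest_top hl hl1])⟩
  rw [LayerCode.ofForest_c hl hl1, forestChild, if_pos (by omega),
    List.getD_append _ _ _ _ (by rwa [length_trunk])]
  change (ω.level k).getD i 0 = _
  congr 1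
  rw [List.getD_eq_getElem _ _ (by rwa [length_trunk])]
  simp [trunk]

end TreeSpace

end

section

open MeasureTheory Filter Topology
open scoped ENNReal

/-! ### The limiting law -/

namespace CausalTriangulation

open RootedMap

theorem isOpen_setOf_toMap {R : ℕ} {P : RootedMap → Prop}
    (hP : ∀ G H, SameBall R G H → P G → P H) : IsOpen {c : CausalTriangulation | P c.toMap} := by
  refine Metric.isOpen_iff.2 fun c hc => ⟨1 / ((R : ℝ) + 1), by positivity, fun c' hc' => ?_⟩
  rw [Metric.mem_ball, dist_comm] at hc'
  exact hP _ _ (sameBall_of_dist_lt hc') hc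

theorem measurableSet_isInfiniteCT :
    MeasurableSet {c : CausalTriangulation | c.toMap.IsInfiniteCT} := by
  have : {c : CausalTriangulation | c.toMap.IsInfiniteCT} =
      ⋂ R : ℕ, ⋂ _ : 0 < R, {c | c.toMap.ReachesHeight R} := by
    ext c
    simp only [Set.mem_iInter, Set.mem_ofPred_eq]
    exact (isCT_toMap c).isInfiniteCT_iff
  rw [this]
  exact MeasurableSet.iInter fun R => MeasurableSet.iInter fun _ =>
    (isOpen_setOf_toMap fun _ _ h => h.reachesHeight).measurableSet

theorem measurableSet_hasHausdorffDim (δ : ℝ) :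
    MeasurableSet {c : CausalTriangulation | c.toMap.HasHausdorffDim δ} := by
  have hm : ∀ R, Measurable fun c : CausalTriangulation => c.toMap.ballSize R := fun R =>
    measurable_to_countable' fun n =>
      (isOpen_setOf_toMap (R := R) (P := fun G => G.ballSize R = n)
        fun _ _ h h' => h.ballSize_eq.symm.trans h').measurableSet
  refine measurableSet_tendsto (𝓝 δ)
    (f := fun (R : ℕ) (c : CausalTriangulation) => Real.log (c.toMap.ballSize R) / Real.log R)
    fun R => ?_
  exact (Measurable.of_discrete (f := fun n : ℕ => Real.log n / Real.log R)).comp (hm R)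

theorem isProbabilityMeasure_uniformOn {N : ℕ} (hN : 0 < N) :
    IsProbabilityMeasure (ProbabilityTheory.uniformOn (ofArea N)) := by
  refine ⟨?_⟩
  rw [uniformOn_apply hN, Set.inter_univ, ncard_ofArea hN]
  exact ENNReal.div_self (by exact_mod_cast (forestCount_one_pos N).ne')
    (ENNReal.natCast_ne_top _)

end CausalTriangulation

theorem LayerCode.Agree.dist_toCT_le {C D : LayerCode} {R : ℕ} (h : Agree R C D) :
    dist C.toCT D.toCT ≤ 1 / ((R : ℝ) + 1) := by
  refine CausalTriangulation.dist_le_of_sameBall ?_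
  exact (C.iso_toCT.sameBall (CausalTriangulation.isCT_toMap _).connected R).trans
    (h.sameBall.trans
      (D.iso_toCT.sameBall (CausalTriangulation.isCT_toMap _).connected R).symm)

namespace TreeSpace

/-- The trunks with `R` levels which force a triangulation to lie in `U`. -/
def forcing (R : ℕ) (U : Set CausalTriangulation) : Set (List (List ℕ)) :=
  {p | (∀ ω : TreeSpace, ω.trunk R = p → ω.code.toCT ∈ U) ∧
    ∀ l, IsForest 1 l → l.length ≠ 1 → p <+: l → (LayerCode.ofForest l).toCT ∈ U}

theorem trunk_mono (ω : TreeSpace) {R S : ℕ} (h : R ≤ S) : ω.trunk R <+: ω.trunk S := by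
  induction S, h using Nat.le_induction with
  | base => exact List.prefix_rfl
  | succ S _ ih =>
    rw [trunk_succ]
    exact ih.trans (List.prefix_append _ _)

theorem trunk_eq_of_le {ω ω' : TreeSpace} {R S : ℕ} (h : R ≤ S) (he : ω.trunk S = ω'.trunk S) :
    ω.trunk R = ω'.trunk R :=
  (List.prefix_of_prefix_length_le (ω.trunk_mono h) (he ▸ ω'.trunk_mono h)
    (by rw [length_trunk, length_trunk])).eq_of_length (by rw [length_trunk, length_trunk])

theorem monotone_trunk_mem_forcing (U : Set CausalTriangulation) :
    Monotone fun R => {ω : TreeSpace | ω.trunk R ∈ forcing R U} := by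
  intro R S h ω hω
  exact ⟨fun ω' hω' => hω.1 ω' (trunk_eq_of_le h hω'),
    fun l hl hl1 hp => hω.2 l hl hl1 ((ω.trunk_mono h).trans hp)⟩

/-- A point of an open set has some metric ball around it inside the set, and all trees sharing a
long enough trunk, finite ones included, encode triangulations in that ball. -/
theorem preimage_eq_iUnion {U : Set CausalTriangulation} (hU : IsOpen U) :
    (fun ω : TreeSpace => ω.code.toCT) ⁻¹' U = ⋃ R, {ω | ω.trunk R ∈ forcing R U} := by
  ext ω
  rw [Set.mem_iUnion]
  constructor
  · intro hω
    obtain ⟨ε, hε, hball⟩ := Metric.isOpen_iff.1 hU _ hω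
    obtain ⟨R, hR⟩ := exists_nat_one_div_lt hε
    refine ⟨R, fun ω' h' => hball ?_, fun l hl hl1 hp => hball ?_⟩
    · exact (agree_of_trunk_eq h').dist_toCT_le.trans_lt hR
    · rw [Metric.mem_ball, dist_comm]
      exact (agree_ofForest hl hl1 hp).dist_toCT_le.trans_lt hR
  · rintro ⟨R, h, -⟩
    exact h ω rfl

theorem measurable_toCT : Measurable fun ω : TreeSpace => ω.code.toCT := by
  refine measurable_of_isOpen fun U hU => ?_
  rw [preimage_eq_iUnion hU]
  exact MeasurableSet.iUnion fun R => measurableSet_trunk_mem R _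

theorem tendsto_sum_trunkWeight (F : Finset (List (List ℕ))) :
    Tendsto (fun N => ((∑ p ∈ F, forestCount (N - forestSize p) (trunkWidth 1 p) : ℕ) : ℝ≥0∞) /
      forestCount N 1) atTop (𝓝 (∑ p ∈ F, trunkWeight p)) := by
  have h := tendsto_finsetSum F fun p _ => ENNReal.tendsto_ofReal
    (tendsto_forestCount_sub (trunkWidth 1 p) (forestSize p))
  refine h.congr' ?_
  filter_upwards with N
  have hpos : (0 : ℝ) < forestCount N 1 := by exact_mod_cast forestCount_one_pos N
  rw [Nat.cast_sum, div_eq_mul_inv, Finset.sum_mul]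
  refine Finset.sum_congr rfl fun p _ => ?_
  rw [ENNReal.ofReal_div_of_pos hpos, ENNReal.ofReal_natCast, ENNReal.ofReal_natCast,
    div_eq_mul_inv]

/-- The left side is a countable sum over trunks, hence a supremum over finite sets of trunks;
impossible trunks have probability zero and are filtered out. For a finite set the frequencies among
trees of size `N` converge to the trunk weights, and they bound the uniform measure of `U` from
below. -/
theorem treeLaw_forcing_le (R : ℕ) (U : Set CausalTriangulation) :
    treeLaw {ω | ω.trunk R ∈ forcing R U} ≤ liminf (fun N =>
      ProbabilityTheory.uniformOn (CausalTriangulation.ofArea N) U) atTop := by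
  classical
  have hunion : {ω : TreeSpace | ω.trunk R ∈ forcing R U} =
      ⋃ p : forcing R U, {ω | ω.trunk R = p.1} := by ext; simp
  have hdisj : Pairwise (Function.onFun Disjoint fun p : forcing R U =>
      {ω : TreeSpace | ω.trunk R = p.1}) := by
    intro p q hpq
    rw [Function.onFun, Set.disjoint_left]
    intro ω hp hq
    exact hpq (Subtype.ext (Eq.trans (Eq.symm hp) hq))
  rw [hunion, measure_iUnion hdisj fun p => measurableSet_trunk R p, ENNReal.tsum_eq_iSup_sum]
  refine iSup_le fun F => ?_
  set F' : Finset (List (List ℕ)) := (F.image Subtype.val).filter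
    fun p => p.length = R ∧ ∃ m, IsTrunk 1 p m with hF'
  have hmem : ∀ p ∈ F', p ∈ forcing R U ∧ p.length = R ∧ IsTrunk 1 p (trunkWidth 1 p) := by
    intro p hp
    obtain ⟨h1, h2, m, hm⟩ := Finset.mem_filter.1 hp
    obtain ⟨q, -, rfl⟩ := Finset.mem_image.1 h1
    exact ⟨q.2, h2, by rwa [hm.trunkWidth_eq]⟩
  have hsum : ∑ p ∈ F, treeLaw {ω | ω.trunk R = p} = ∑ p ∈ F', trunkWeight p := by
    rw [hF', Finset.sum_filter, Finset.sum_image (Subtype.val_injective.injOn)]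
    refine Finset.sum_congr rfl fun p _ => ?_
    split_ifs with h
    · obtain ⟨h1, m, hm⟩ := h
      exact treeLaw_trunk h1 hm
    · rw [setOf_trunk_eq_empty h, measure_empty]
  rw [hsum, ← (tendsto_sum_trunkWeight F').liminf_eq]
  refine liminf_le_liminf ?_
  filter_upwards [eventually_gt_atTop 0, (F'.eventually_all).2
    fun p _ => eventually_ge_atTop (forestSize p)] with N hN hsize
  exact CausalTriangulation.sum_le_uniformOn hN F' (trunkWidth 1)
    (fun p hp => ⟨(hmem p hp).2.1, (hmem p hp).2.2, hsize p hp⟩) U fun p hp l hl hpl =>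
      (hmem p hp).1.2 l hl.1 (CausalTriangulation.length_ne_one_of_mem_forests hN hl) hpl

end TreeSpace

/-- The law of the infinite triangulation encoded by the random infinite tree. -/
noncomputable def limitLaw : ProbabilityMeasure CausalTriangulation :=
  ⟨treeLaw.map fun ω => ω.code.toCT,
    Measure.isProbabilityMeasure_map TreeSpace.measurable_toCT.aemeasurable⟩

theorem limitLaw_le_liminf {U : Set CausalTriangulation} (hU : IsOpen U) :
    (limitLaw : Measure CausalTriangulation) U ≤ liminf (fun N =>
      ProbabilityTheory.uniformOn (CausalTriangulation.ofArea N) U) atTop := by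
  change treeLaw.map _ U ≤ _
  rw [Measure.map_apply TreeSpace.measurable_toCT hU.measurableSet,
    TreeSpace.preimage_eq_iUnion hU, (TreeSpace.monotone_trunk_mem_forcing U).measure_iUnion]
  exact iSup_le fun R => TreeSpace.treeLaw_forcing_le R U

/-- Weak convergence of probability measures follows from the lower bounds on open sets. The index
is shifted by one because probability measures are obtained for positive areas. -/
theorem isUniformInfiniteCT_limitLaw : CausalTriangulation.IsUniformInfiniteCT limitLaw := by
  let μ : ℕ → ProbabilityMeasure CausalTriangulation := fun N =>
    ⟨ProbabilityTheory.uniformOn (CausalTriangulation.ofArea (N + 1)),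
      CausalTriangulation.isProbabilityMeasure_uniformOn N.succ_pos⟩
  have h : Tendsto μ atTop (𝓝 limitLaw) := by
    refine tendsto_of_forall_isOpen_le_liminf_nat' fun U hU => ?_
    have h1 := limitLaw_le_liminf hU
    rwa [← liminf_nat_add _ 1] at h1
  have h1 := (ProbabilityMeasure.tendsto_nhds_iff_toFiniteMeasure_tendsto_nhds _).1 h
  exact (tendsto_add_atTop_iff_nat 1).1 h1

theorem ae_limitLaw : ∀ᵐ c ∂(limitLaw : Measure CausalTriangulation),
    c.toMap.IsInfiniteCT ∧ c.toMap.HasHausdorffDim 2 := by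
  change ∀ᵐ c ∂(treeLaw.map _), _
  refine (ae_map_iff (p := fun c : CausalTriangulation =>
    c.toMap.IsInfiniteCT ∧ c.toMap.HasHausdorffDim 2) TreeSpace.measurable_toCT.aemeasurable
    (CausalTriangulation.measurableSet_isInfiniteCT.inter
      (CausalTriangulation.measurableSet_hasHausdorffDim 2))).2 ?_
  filter_upwards [TreeSpace.ae_hasHausdorffDim] with ω hω
  have hct := CausalTriangulation.isCT_toMap ω.code.toCT
  have hinf := LayerCode.isInfiniteCT (C := ω.code) rfl
  have hball := fun R => ω.code.iso_toCT.sameBall hct.connected R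
  refine ⟨hct.isInfiniteCT_iff.2 fun R hR =>
    (hball R).symm.reachesHeight (hinf.reachesHeight hR), ?_⟩
  unfold RootedMap.HasHausdorffDim at hω ⊢
  exact hω.congr fun R => by rw [(hball R).ballSize_eq]

end

theorem theorem3 :
    (∃ ρ : MeasureTheory.ProbabilityMeasure CausalTriangulation,
      CausalTriangulation.IsUniformInfiniteCT ρ) ∧
    ∀ ρ : MeasureTheory.ProbabilityMeasure CausalTriangulation,
      CausalTriangulation.IsUniformInfiniteCT ρ →
      ∀ᵐ c ∂(ρ : MeasureTheory.Measure CausalTriangulation),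
        c.toMap.IsInfiniteCT ∧ c.toMap.HasHausdorffDim 2 := by
  refine ⟨⟨limitLaw, isUniformInfiniteCT_limitLaw⟩, fun ρ hρ => ?_⟩
  -- Weak limits are unique, so it suffices to treat `limitLaw`.
  have h : ρ.toFiniteMeasure = limitLaw.toFiniteMeasure :=
    tendsto_nhds_unique hρ isUniformInfiniteCT_limitLaw
  have h' : (ρ : MeasureTheory.Measure CausalTriangulation) = limitLaw :=
    congrArg MeasureTheory.FiniteMeasure.toMeasure h
  rw [h']
  exact ae_limitLaw
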